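/- Let $d\ge 1$. For $f\in\mathcal S'(\mathbb R^n)$ and a window $g\in\mathcal S(\mathbb R^n)$, $g\neq 0$, let $V_gf(x,\xi)=\langle f, M_\xi T_x g\rangle=\int f(t)\,\overline{g(t-x)}\,e^{-2\pi i\xi\cdot t}\,dt$ be the short-time Fourier transform. For $p,q\in[1,\infty]$ and a weight $m>0$ on $\mathbb R^{2n}$ put $$\|f\|_{M^{p,q}_m(\mathbb R^n)}=\Big\|\ \xi\mapsto\big\|V_gf(\cdot,\xi)\,m(\cdot,\xi)\big\|_{L^p(\mathbb R^n)}\Big\|_{L^q(\mathbb R^n)},\qquad M^{p,q}_m(\mathbb R^n)=\{f\in\mathcal S'(\mathbb R^n):\|f\|_{M^{p,q}_m}<\infty\},$$ and write $M^{p,q}$ for $m\equiv1$. Fix nonzero windows in $\mathcal S(\mathbb R^d)$ and in $\mathcal S(\mathbb R^{2d})$ to define the norms on $\mathbb R^d$ and on $\mathbb R^{2d}$; the statement holds for every choice of them (the constants may depend on the choice). For $s\in\mathbb R$ let $v_s(z)=(1+|z|^2)^{s/2}$, $z\in\mathbb R^{2d}$, and $(1\otimes v_s)(z,\zeta)=v_s(\zeta)$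 for $z,\zeta\in\mathbb R^{2d}$. Let $$W(f_1,f_2)(x,\xi)=\int_{\mathbb R^d}f_1\big(x+\tfrac t2\big)\,\overline{f_2\big(x-\tfrac t2\big)}\,e^{-2\pi i\xi\cdot t}\,dt$$ be the cross-Wigner distribution, extended to $f_1,f_2\in\mathcal S'(\mathbb R^d)$ as the tempered distribution on $\mathbb R^{2d}$ given by $\langle W(f_1,f_2),\Psi\rangle=\langle f_1\otimes\overline{f_2},K_\Psi\rangle$ (bilinear pairings) with $K_\Psi(u,v)=\int\Psi\big(\tfrac{u+v}2,\xi\big)e^{-2\pi i\xi\cdot(u-v)}\,d\xi$. Let $p_1,q_1,p_2,q_2,p,q\in[1,\infty]$ (with $1/\infty=0$), and consider the conditions $$p_1,q_1,p_2,q_2\le q \tag{1}$$ $$\frac1{p_1}+\frac1{p_2}\ge\frac1p+\frac1q,\qquad \frac1{q_1}+\frac1{q_2}\ge\frac1p+\frac1q. \tag{2}$$ (Sufficiency.) If (1) and (2) hold and $s\in\mathbb R$, then there is a constant $C$ such that for all $f_1\in M^{p_1,q_1}_{v_{|s|}}(\mathbb R^d)$ and $f_2\in M^{p_2,q_2}_{v_s}(\mathbb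 R^d)$ one has $W(f_1,f_2)\in M^{p,q}_{1\otimes v_s}(\mathbb R^{2d})$ and $$\|W(f_1,f_2)\|_{M^{p,q}_{1\otimes v_s}}\le C\,\|f_1\|_{M^{p_1,q_1}_{v_{|s|}}}\,\|f_2\|_{M^{p_2,q_2}_{v_s}}.$$ (Necessity.) Conversely, if there is a constant $C$ such that $$\|W(f_1,f_2)\|_{M^{p,q}}\le C\,\|f_1\|_{M^{p_1,q_1}}\,\|f_2\|_{M^{p_2,q_2}}\qquad\text{for all } f_1,f_2\in\mathcal S(\mathbb R^d),$$ then (1) and (2) hold. -/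

import Mathlib

open SchwartzMap MeasureTheory
open scoped ENNReal NNReal

namespace TFA

open scoped ContDiff LineDeriv

section Calculus

variable {D : Type*} [NormedAddCommGroup D] [NormedSpace ℝ D]
variable {V : Type*} [NormedAddCommGroup V] [NormedSpace ℝ V]

/-- A criterion for operators from a Schwartz space to functions on a finite-dimensional space:
if a class of operators has rapidly decreasing values and is stable under directional derivatives
along a basis, then its members take values in Schwartz functions, with seminorm bounds. -/
theorem smooth_and_bounds {ι : Type*} [Fintype ι] [FiniteDimensional ℝ V]
    (b : Module.Basis ι ℝ V) (𝒪 : Set (𝓢(D, ℂ) → V → ℂ))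
    (h1 : ∀ T ∈ 𝒪, ∀ Φ, Differentiable ℝ (T Φ))
    (h2 : ∀ T ∈ 𝒪, ∀ i, ∃ T' ∈ 𝒪, ∀ Φ v, fderiv ℝ (T Φ) v (b i) = T' Φ v)
    (h3 : ∀ T ∈ 𝒪, ∀ k : ℕ, ∃ (s : Finset (ℕ × ℕ)) (C : ℝ), 0 ≤ C ∧ ∀ (Φ : 𝓢(D, ℂ)) (v : V),
      ‖v‖ ^ k * ‖T Φ v‖ ≤ C * s.sup (schwartzSeminormFamily ℂ D ℂ) Φ) (n : ℕ) :
    ∀ T ∈ 𝒪, (∀ Φ, ContDiff ℝ n (T Φ)) ∧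
      ∀ k : ℕ, ∃ (s : Finset (ℕ × ℕ)) (C : ℝ), 0 ≤ C ∧ ∀ (Φ : 𝓢(D, ℂ)) (v : V),
      ‖v‖ ^ k * ‖iteratedFDeriv ℝ n (T Φ) v‖ ≤
        C * s.sup (schwartzSeminormFamily ℂ D ℂ) Φ := by
  induction n with
  | zero =>
    intro T hT
    refine ⟨fun Φ => ?_, fun k => ?_⟩
    · exact contDiff_zero.2 (h1 T hT Φ).continuous
    · simpa using h3 T hT k
  | succ n ih =>
    intro T hT
    choose T' hT' hd using h2 T hT
    let R : ι → ℂ →L[ℝ] (V →L[ℝ] ℂ) := fun i =>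
      ContinuousLinearMap.smulRightL ℝ V ℂ (LinearMap.toContinuousLinearMap (b.coord i))
    have hf : ∀ Φ, fderiv ℝ (T Φ) = fun v => ∑ i, (R i ∘ T' i Φ) v := by
      intro Φ
      funext v
      refine ContinuousLinearMap.coe_injective (b.ext fun j => ?_)
      classical
      simp only [R, ContinuousLinearMap.coe_coe, hd, Function.comp_apply,
        sum_apply, ContinuousLinearMap.smulRightL_apply_apply,
        ContinuousLinearMap.smulRight_apply, LinearMap.coe_toContinuousLinearMap',
        Module.Basis.coord_apply, Module.Basis.repr_self, Finsupp.single_apply]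
      simp
    have hc : ∀ Φ i, ContDiff ℝ n (R i ∘ T' i Φ) := fun Φ i =>
      (R i).contDiff.comp ((ih _ (hT' i)).1 Φ)
    refine ⟨fun Φ => ?_, fun k => ?_⟩
    · rw [Nat.cast_add, Nat.cast_one, contDiff_succ_iff_fderiv]
      refine ⟨h1 T hT Φ, by simp, ?_⟩
      rw [hf]
      exact ContDiff.sum fun i _ => hc Φ i
    · choose s C hC hb using fun i => (ih _ (hT' i)).2 k
      refine ⟨Finset.univ.biUnion s, ∑ i, ‖R i‖ * C i,
        Finset.sum_nonneg fun i _ => mul_nonneg (norm_nonneg (R i)) (hC i), fun Φ v => ?_⟩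
      rw [← norm_iteratedFDeriv_fderiv, hf, iteratedFDeriv_sum fun i _ => hc Φ i,
        Finset.sum_apply, Finset.sum_mul]
      calc ‖v‖ ^ k * ‖∑ i, iteratedFDeriv ℝ n (R i ∘ T' i Φ) v‖
          ≤ ‖v‖ ^ k * ∑ i, ‖R i‖ * ‖iteratedFDeriv ℝ n (T' i Φ) v‖ := by
            gcongr
            refine (norm_sum_le _ _).trans (Finset.sum_le_sum fun i _ => ?_)
            exact (R i).norm_iteratedFDeriv_comp_left ((ih _ (hT' i)).1 Φ).contDiffAt le_rfl
        _ = ∑ i, ‖R i‖ * (‖v‖ ^ k * ‖iteratedFDeriv ℝ n (T' i Φ) v‖) := by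
            rw [Finset.mul_sum]
            exact Finset.sum_congr rfl fun i _ => by ring
        _ ≤ _ := by
            refine Finset.sum_le_sum fun i _ => ?_
            rw [mul_assoc]
            refine mul_le_mul_of_nonneg_left ((hb i Φ v).trans ?_) (norm_nonneg (R i))
            refine mul_le_mul_of_nonneg_left ?_ (hC i)
            exact Finset.sup_mono (f := schwartzSeminormFamily ℂ D ℂ)
              (Finset.subset_biUnion_of_mem s (Finset.mem_univ i)) Φ

/-- A continuous linear map between Schwartz spaces satisfies seminorm bounds. -/
theorem exists_seminorm_le (L : 𝓢(D, ℂ) →L[ℂ] 𝓢(V, ℂ)) (k n : ℕ) :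
    ∃ (s : Finset (ℕ × ℕ)) (C : ℝ), 0 ≤ C ∧ ∀ Φ : 𝓢(D, ℂ),
      SchwartzMap.seminorm ℂ k n (L Φ) ≤ C * s.sup (schwartzSeminormFamily ℂ D ℂ) Φ := by
  obtain ⟨s, C, -, h⟩ := Seminorm.bound_of_continuous (schwartz_withSeminorms ℂ D ℂ)
    ((schwartzSeminormFamily ℂ V ℂ (k, n)).comp (L : 𝓢(D, ℂ) →ₗ[ℂ] 𝓢(V, ℂ)))
    (((schwartz_withSeminorms ℂ V ℂ).continuous_seminorm (k, n)).comp L.continuous)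
  exact ⟨s, C, C.2, fun Φ => h Φ⟩

theorem lineDeriv_comm (Φ : 𝓢(D, ℂ)) (a c : D) : ∂_{a} (∂_{c} Φ) = ∂_{c} (∂_{a} Φ) := by
  ext z
  have h : ∀ a c : D, (∂_{a} (∂_{c} Φ)) z = fderiv ℝ (fderiv ℝ Φ) z a c := by
    intro a c
    rw [lineDerivOp_apply_eq_fderiv]
    have : ((∂_{c} Φ : 𝓢(D, ℂ)) : D → ℂ) = fun w => fderiv ℝ Φ w c := by
      funext w
      exact lineDerivOp_apply_eq_fderiv c Φ w
    rw [this]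
    have hd : DifferentiableAt ℝ (fderiv ℝ Φ) z :=
      ((Φ.smooth 2).fderiv_right (m := 1) (by norm_num)).differentiable (by norm_num) z
    rw [fderiv_clm_apply hd (differentiableAt_const c)]
    simp
  rw [h, h]
  have := (Φ.smooth 2).contDiffAt (x := z) |>.isSymmSndFDerivAt (by simp)
  exact this a c

theorem iteratedLineDeriv_comm (Φ : 𝓢(D, ℂ)) (a : D) {n : ℕ} (m : Fin n → D) :
    ∂^{m} (∂_{a} Φ) = ∂_{a} (∂^{m} Φ) := by
  induction n with
  | zero => simp
  | succ n ih => rw [LineDeriv.iteratedLineDerivOp_succ_left, ih, lineDeriv_comm,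
      LineDeriv.iteratedLineDerivOp_succ_left]

/-- Second order Taylor estimate for translations in the Schwartz space. -/
theorem translation_remainder (Φ : 𝓢(D, ℂ)) (k n : ℕ) :
    ∃ C : ℝ, 0 ≤ C ∧ ∀ a : D, ‖a‖ ≤ 1 →
      SchwartzMap.seminorm ℂ k n (compSubConstCLM ℂ (-a) Φ - Φ - ∂_{a} Φ) ≤ C * ‖a‖ ^ 2 := by
  set M : ℝ := 2 ^ k * ((Finset.Iic (k, n + 2)).sup (schwartzSeminormFamily ℂ D ℂ)) Φ
  have hM : 0 ≤ M := by positivity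
  have hbd : ∀ w : D, (1 + ‖w‖) ^ k * ‖iteratedFDeriv ℝ (n + 2) Φ w‖ ≤ M := fun w =>
    one_add_le_sup_seminorm_apply (m := (k, n + 2)) le_rfl le_rfl Φ w
  refine ⟨2 ^ k * M, by positivity, fun a ha => ?_⟩
  refine seminorm_le_bound ℂ k n _ (by positivity) fun z => ?_
  set u := iteratedFDeriv ℝ n Φ
  have hu : ∀ i : ℕ, Differentiable ℝ (iteratedFDeriv ℝ i Φ) := fun i =>
    (Φ.smooth ⊤).differentiable_iteratedFDeriv (by exact_mod_cast ENat.natCast_lt_top i)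
  have hR : iteratedFDeriv ℝ n (compSubConstCLM ℂ (-a) Φ - Φ - ∂_{a} Φ : 𝓢(D, ℂ)) z
      = u (z + a) - u z - fderiv ℝ u z a := by
    ext m
    rw [← iteratedLineDerivOp_eq_iteratedFDeriv, sub_eq_add_neg, sub_eq_add_neg,
      LineDeriv.iteratedLineDerivOp_add, LineDeriv.iteratedLineDerivOp_add,
      LineDeriv.iteratedLineDerivOp_neg, LineDeriv.iteratedLineDerivOp_neg]
    simp only [add_apply, neg_apply]
    have e1 : (∂^{m} (compSubConstCLM ℂ (-a) Φ)) z = u (z + a) m := by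
      rw [iteratedLineDerivOp_eq_iteratedFDeriv]
      have : ((compSubConstCLM ℂ (-a) Φ : 𝓢(D, ℂ)) : D → ℂ) = fun w => Φ (w + a) := by
        funext w; simp
      rw [this, iteratedFDeriv_comp_add_right]
    have e2 : (∂^{m} (∂_{a} Φ)) z = fderiv ℝ u z a m := by
      have := iteratedFDeriv_succ_apply_left (𝕜 := ℝ) (f := Φ) (x := z)
        (Fin.cons a m : Fin (n + 1) → D)
      rw [← iteratedLineDerivOp_eq_iteratedFDeriv,
        LineDeriv.iteratedLineDerivOp_succ_left] at this
      simpa [iteratedLineDeriv_comm] using this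
    rw [e1, e2, iteratedLineDerivOp_eq_iteratedFDeriv]
    simp [u, sub_eq_add_neg]
  rw [hR]
  set K : ℝ := 2 ^ k * M / (1 + ‖z‖) ^ k
  have hz : 0 < 1 + ‖z‖ := by positivity
  have hK : 0 ≤ K := by positivity
  have hw : ∀ w ∈ Metric.closedBall z ‖a‖, ‖iteratedFDeriv ℝ (n + 2) Φ w‖ ≤ K := by
    intro w hw
    rw [le_div_iff₀ (by positivity)]
    have h1 : 1 + ‖z‖ ≤ 2 * (1 + ‖w‖) := by
      have : ‖z - w‖ ≤ ‖a‖ := by rw [← dist_eq_norm, dist_comm]; exact hw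
      have := norm_le_norm_add_norm_sub' z w
      have := norm_nonneg w
      linarith
    calc ‖iteratedFDeriv ℝ (n + 2) Φ w‖ * (1 + ‖z‖) ^ k
        ≤ ‖iteratedFDeriv ℝ (n + 2) Φ w‖ * (2 * (1 + ‖w‖)) ^ k := by gcongr
      _ = 2 ^ k * ((1 + ‖w‖) ^ k * ‖iteratedFDeriv ℝ (n + 2) Φ w‖) := by rw [mul_pow]; ring
      _ ≤ 2 ^ k * M := by gcongr; exact hbd w
  have hconv : Convex ℝ (Metric.closedBall z ‖a‖) := convex_closedBall _ _
  have hz0 : z ∈ Metric.closedBall z ‖a‖ := Metric.mem_closedBall_self (norm_nonneg _)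
  have hza : z + a ∈ Metric.closedBall z ‖a‖ := by simp [Metric.mem_closedBall]
  have hD : ∀ w ∈ Metric.closedBall z ‖a‖, ‖fderiv ℝ u w - fderiv ℝ u z‖ ≤ K * ‖a‖ := by
    intro w hwm
    have e : ‖fderiv ℝ u w - fderiv ℝ u z‖ =
        ‖iteratedFDeriv ℝ (n + 1) Φ w - iteratedFDeriv ℝ (n + 1) Φ z‖ := by
      have e := (continuousMultilinearCurryLeftEquiv ℝ (fun _ : Fin (n + 1) => D) ℂ).norm_map
        (iteratedFDeriv ℝ (n + 1) Φ w - iteratedFDeriv ℝ (n + 1) Φ z)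
      rw [← e, (continuousMultilinearCurryLeftEquiv ℝ (fun _ : Fin (n + 1) => D) ℂ).map_sub,
        fderiv_iteratedFDeriv]
      rfl
    rw [e]
    refine (hconv.norm_image_sub_le_of_norm_fderiv_le (𝕜 := ℝ) (fun x _ => hu (n + 1) x)
      (C := K) ?_ hz0 hwm).trans ?_
    · intro x hx
      rw [norm_fderiv_iteratedFDeriv]
      exact hw x hx
    · gcongr
      rw [← dist_eq_norm]; exact hwm
  have hT := hconv.norm_image_sub_le_of_norm_hasFDerivWithin_le' (f := u) (𝕜 := ℝ)
    (fun x _ => ((hu n x).hasFDerivAt).hasFDerivWithinAt) hD hz0 hza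
  rw [add_sub_cancel_left] at hT
  calc ‖z‖ ^ k * ‖u (z + a) - u z - fderiv ℝ u z a‖
      ≤ (1 + ‖z‖) ^ k * (K * ‖a‖ * ‖a‖) := by
        gcongr
        linarith [norm_nonneg z]
    _ = 2 ^ k * M * ‖a‖ ^ 2 := by
        simp only [K]
        field_simp

theorem seminorm_lineDeriv_le (Φ : 𝓢(D, ℂ)) (a : D) (k n : ℕ) :
    SchwartzMap.seminorm ℂ k n (∂_{a} Φ) ≤ ‖a‖ * SchwartzMap.seminorm ℂ k (n + 1) Φ := by
  refine seminorm_le_bound ℂ k n _ (by positivity) fun z => ?_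
  have e : ((∂_{a} Φ : 𝓢(D, ℂ)) : D → ℂ) = fun w => fderiv ℝ Φ w a := by
    funext w
    exact lineDerivOp_apply_eq_fderiv a Φ w
  have hd : ContDiffAt ℝ n (fderiv ℝ Φ) z :=
    ((Φ.smooth (n + 1 : ℕ)).fderiv_right (m := n) (by norm_cast)).contDiffAt
  have h := norm_iteratedFDeriv_clm_apply_const (c := a) hd le_rfl
  rw [norm_iteratedFDeriv_fderiv] at h
  rw [e]
  calc ‖z‖ ^ k * ‖iteratedFDeriv ℝ n (fun w => fderiv ℝ Φ w a) z‖
      ≤ ‖z‖ ^ k * (‖a‖ * ‖iteratedFDeriv ℝ (n + 1) Φ z‖) := by gcongr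
    _ = ‖a‖ * (‖z‖ ^ k * ‖iteratedFDeriv ℝ (n + 1) Φ z‖) := by ring
    _ ≤ _ := by gcongr; exact Φ.le_seminorm ℂ k (n + 1) z

end Calculus

section Partial

variable {E F G : Type*} [NormedAddCommGroup E] [NormedSpace ℝ E]
  [NormedAddCommGroup F] [NormedSpace ℝ F] [NormedAddCommGroup G] [NormedSpace ℝ G]

/-- The restriction `Φ ↦ Φ(x, ·)` of a Schwartz function on a product. -/
noncomputable def slice (x : E) : 𝓢(E × F, ℂ) →L[ℂ] 𝓢(F, ℂ) :=
  compCLM ℂ (g := fun y : F => (x, (0 : F)) + ContinuousLinearMap.inr ℝ E F y)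
    ((Function.HasTemperateGrowth.const _).add
      (ContinuousLinearMap.inr ℝ E F).hasTemperateGrowth)
    ⟨1, 1, fun y => by
      have : ‖y‖ ≤ ‖((x, (0 : F)) + ContinuousLinearMap.inr ℝ E F y : E × F)‖ := by
        simp [Prod.norm_def]
      linarith⟩

@[simp]
theorem slice_apply (x : E) (Φ : 𝓢(E × F, ℂ)) (y : F) : slice x Φ y = Φ (x, y) := by
  simp [slice]

theorem norm_pow_mul_seminorm_slice_le (j k n : ℕ) (x : E) (Φ : 𝓢(E × F, ℂ)) :
    ‖x‖ ^ j * SchwartzMap.seminorm ℂ k n (slice x Φ) ≤ SchwartzMap.seminorm ℂ (j + k) n Φ := by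
  have key : ∀ y : F, ‖x‖ ^ j * (‖y‖ ^ k * ‖iteratedFDeriv ℝ n (slice x Φ) y‖) ≤
      SchwartzMap.seminorm ℂ (j + k) n Φ := by
    intro y
    have e : ((slice x Φ : 𝓢(F, ℂ)) : F → ℂ) =
        (fun z => Φ (z + (x, (0 : F)))) ∘ ContinuousLinearMap.inr ℝ E F := by
      funext w
      simp
    have hs : ContDiff ℝ n (fun z => Φ (z + (x, (0 : F)))) :=
      (Φ.smooth n).comp (contDiff_id.add contDiff_const)
    have h : ‖iteratedFDeriv ℝ n (slice x Φ) y‖ ≤ ‖iteratedFDeriv ℝ n Φ (x, y)‖ := by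
      rw [e, ContinuousLinearMap.iteratedFDeriv_comp_right _ hs y le_rfl,
        iteratedFDeriv_comp_add_right]
      refine (ContinuousMultilinearMap.norm_compContinuousLinearMap_le _ _).trans ?_
      have : ContinuousLinearMap.inr ℝ E F y + (x, (0 : F)) = (x, y) := by simp
      rw [this]
      refine mul_le_of_le_one_right (norm_nonneg _) (Finset.prod_le_one (fun _ _ => norm_nonneg _)
        fun _ _ => ContinuousLinearMap.norm_inr_le_one ℝ E F)
    have hx : ‖x‖ ≤ ‖(x, y)‖ := norm_fst_le (x, y)
    have hy : ‖y‖ ≤ ‖(x, y)‖ := norm_snd_le (x, y)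
    calc ‖x‖ ^ j * (‖y‖ ^ k * ‖iteratedFDeriv ℝ n (slice x Φ) y‖)
        ≤ ‖(x, y)‖ ^ j * (‖(x, y)‖ ^ k * ‖iteratedFDeriv ℝ n Φ (x, y)‖) := by gcongr
      _ = ‖(x, y)‖ ^ (j + k) * ‖iteratedFDeriv ℝ n Φ (x, y)‖ := by rw [pow_add]; ring
      _ ≤ _ := Φ.le_seminorm ℂ (j + k) n (x, y)
  rcases eq_or_ne (‖x‖ ^ j) 0 with h0 | h0
  · rw [h0, zero_mul]
    positivity
  · have hp : 0 < ‖x‖ ^ j := lt_of_le_of_ne (by positivity) h0.symm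
    rw [← le_div_iff₀' hp]
    refine seminorm_le_bound ℂ k n _ (by positivity) fun y => ?_
    rw [le_div_iff₀' hp]
    exact key y

theorem slice_add (x a : E) (Φ : 𝓢(E × F, ℂ)) :
    slice (x + a) Φ = slice x (compSubConstCLM ℂ (-(a, (0 : F))) Φ) := by
  ext y
  simp

theorem partial_bound (L : 𝓢(F, ℂ) →L[ℂ] 𝓢(G, ℂ)) (k : ℕ) :
    ∃ (s : Finset (ℕ × ℕ)) (C : ℝ), 0 ≤ C ∧ ∀ (Φ : 𝓢(E × F, ℂ)) (z : E × G),
      ‖z‖ ^ k * ‖L (slice z.1 Φ) z.2‖ ≤ C * s.sup (schwartzSeminormFamily ℂ (E × F) ℂ) Φ := by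
  -- the two cases `‖z‖ = ‖z.1‖` and `‖z‖ = ‖z.2‖`
  have main : ∀ j l : ℕ, ∃ (s : Finset (ℕ × ℕ)) (C : ℝ), 0 ≤ C ∧
      ∀ (Φ : 𝓢(E × F, ℂ)) (z : E × G),
      ‖z.1‖ ^ j * (‖z.2‖ ^ l * ‖L (slice z.1 Φ) z.2‖) ≤
        C * s.sup (schwartzSeminormFamily ℂ (E × F) ℂ) Φ := by
    intro j l
    obtain ⟨s, C, hC, h⟩ := exists_seminorm_le L l 0
    refine ⟨s.image (fun i => (j + i.1, i.2)), C * s.card, by positivity, fun Φ z => ?_⟩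
    have h0 := (L (slice z.1 Φ)).norm_pow_mul_le_seminorm ℂ l z.2
    calc ‖z.1‖ ^ j * (‖z.2‖ ^ l * ‖L (slice z.1 Φ) z.2‖)
        ≤ ‖z.1‖ ^ j * (C * ∑ i ∈ s, SchwartzMap.seminorm ℂ i.1 i.2 (slice z.1 Φ)) := by
          refine mul_le_mul_of_nonneg_left (h0.trans ((h _).trans ?_)) (by positivity)
          gcongr
          have := Seminorm.finset_sup_le_sum (schwartzSeminormFamily ℂ F ℂ) s (slice z.1 Φ)
          rwa [sum_apply] at this
      _ = C * ∑ i ∈ s, ‖z.1‖ ^ j * SchwartzMap.seminorm ℂ i.1 i.2 (slice z.1 Φ) := by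
          rw [← Finset.mul_sum]; ring
      _ ≤ C * ∑ i ∈ s, (s.image (fun i => (j + i.1, i.2))).sup
            (schwartzSeminormFamily ℂ (E × F) ℂ) Φ := by
          gcongr with i hi
          refine (norm_pow_mul_seminorm_slice_le j i.1 i.2 z.1 Φ).trans ?_
          exact Seminorm.le_finset_sup_apply (p := schwartzSeminormFamily ℂ (E × F) ℂ)
            (i := (j + i.1, i.2)) (Finset.mem_image_of_mem _ hi)
      _ = _ := by rw [Finset.sum_const, nsmul_eq_mul]; ring
  obtain ⟨s, C, hC, h⟩ := main k 0
  obtain ⟨s', C', hC', h'⟩ := main 0 k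
  refine ⟨s ∪ s', C + C', by positivity, fun Φ z => ?_⟩
  have m1 : s.sup (schwartzSeminormFamily ℂ (E × F) ℂ) Φ ≤
      (s ∪ s').sup (schwartzSeminormFamily ℂ (E × F) ℂ) Φ :=
    Finset.sup_mono (f := schwartzSeminormFamily ℂ (E × F) ℂ) Finset.subset_union_left Φ
  have m2 : s'.sup (schwartzSeminormFamily ℂ (E × F) ℂ) Φ ≤
      (s ∪ s').sup (schwartzSeminormFamily ℂ (E × F) ℂ) Φ :=
    Finset.sup_mono (f := schwartzSeminormFamily ℂ (E × F) ℂ) Finset.subset_union_right Φ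
  have hz : ‖z‖ ^ k ≤ ‖z.1‖ ^ k + ‖z.2‖ ^ k := by
    rw [Prod.norm_def]
    rcases max_cases ‖z.1‖ ‖z.2‖ with ⟨e, _⟩ | ⟨e, _⟩ <;> rw [e] <;> simp
  have a1 := h Φ z
  have a2 := h' Φ z
  simp only [pow_zero, one_mul] at a1 a2
  calc ‖z‖ ^ k * ‖L (slice z.1 Φ) z.2‖
      ≤ (‖z.1‖ ^ k + ‖z.2‖ ^ k) * ‖L (slice z.1 Φ) z.2‖ := by gcongr
    _ ≤ C * s.sup (schwartzSeminormFamily ℂ (E × F) ℂ) Φ +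
        C' * s'.sup (schwartzSeminormFamily ℂ (E × F) ℂ) Φ := by rw [add_mul]; gcongr
    _ ≤ _ := by rw [add_mul]; gcongr

theorem partial_hasFDerivAt [FiniteDimensional ℝ E] (L : 𝓢(F, ℂ) →L[ℂ] 𝓢(G, ℂ))
    (Φ : 𝓢(E × F, ℂ)) (z : E × G) :
    ∃ f' : E × G →L[ℝ] ℂ, HasFDerivAt (fun w : E × G => L (slice w.1 Φ) w.2) f' z ∧
      ∀ a c, f' (a, c) = L (slice z.1 (∂_{(a, (0 : F))} Φ)) z.2 +
        (∂_{c} (L (slice z.1 Φ))) z.2 := by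
  obtain ⟨x, y⟩ := z
  let B : 𝓢(E × F, ℂ) →L[ℂ] 𝓢(G, ℂ) := L ∘L slice x
  let A : E →ₗ[ℝ] ℂ :=
    { toFun := fun a => B (∂_{(a, (0 : F))} Φ) y
      map_add' := fun a a' => by
        have : ((a + a', (0 : F)) : E × F) = (a, 0) + (a', 0) := by simp
        rw [this, LineDeriv.lineDerivOp_left_add, map_add, add_apply]
      map_smul' := fun r a => by
        have : ((r • a, (0 : F)) : E × F) = r • (a, 0) := by simp
        rw [this, LineDeriv.lineDerivOp_left_smul]
        have h2 : r • (∂_{(a, (0 : F))} Φ : 𝓢(E × F, ℂ)) = (r : ℂ) • ∂_{(a, (0 : F))} Φ := by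
          ext w; simp
        rw [h2, map_smul]
        simp }
  refine ⟨(LinearMap.toContinuousLinearMap A).coprod (fderiv ℝ (B Φ) y), ?_, fun a c => ?_⟩
  swap
  · simp only [ContinuousLinearMap.coprod_apply, LinearMap.coe_toContinuousLinearMap',
      lineDerivOp_apply_eq_fderiv]
    rfl
  rw [hasFDerivAt_iff_isLittleO_nhds_zero]
  have t2 : (fun v : E × G => B Φ (y + v.2) - B Φ y - fderiv ℝ (B Φ) y v.2)
      =o[nhds 0] fun v => v := by
    have h := ((B Φ).differentiableAt (x := y)).hasFDerivAt
    have h' := (hasFDerivAt_iff_isLittleO_nhds_zero.1 h).comp_tendsto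
      (k := fun v : E × G => v.2) (l' := nhds 0) (by
        simpa using (continuous_snd (X := E) (Y := G)).tendsto 0)
    exact h'.trans_isBigO (Asymptotics.isBigO_of_le _ fun v => norm_snd_le v)
  -- the remaining part is quadratic
  obtain ⟨s, C, hC, hB⟩ := exists_seminorm_le B 0 0
  obtain ⟨s', C', hC', hB'⟩ := exists_seminorm_le B 0 1
  choose K hK hrem using fun i : ℕ × ℕ => translation_remainder Φ i.1 i.2
  let K' : ℕ × ℕ → ℝ := fun i => SchwartzMap.seminorm ℂ i.1 (i.2 + 1) Φ
  have t1 : (fun v : E × G =>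
      B (compSubConstCLM ℂ (-(v.1, (0 : F))) Φ - Φ - ∂_{(v.1, (0 : F))} Φ) (y + v.2) +
      (B (∂_{(v.1, (0 : F))} Φ) (y + v.2) - B (∂_{(v.1, (0 : F))} Φ) y))
      =o[nhds 0] fun v => v := by
    refine Asymptotics.IsBigO.trans_isLittleO (g := fun v : E × G => ‖v‖ ^ 2) ?_
      (Asymptotics.isLittleO_norm_pow_id one_lt_two)
    refine Asymptotics.IsBigO.of_bound (C * ∑ i ∈ s, K i + C' * ∑ i ∈ s', K' i) ?_
    filter_upwards [Metric.closedBall_mem_nhds (0 : E × G) one_pos] with v hv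
    have hv1 : ‖v‖ ≤ 1 := by simpa using hv
    have ha : ‖((v.1, (0 : F)) : E × F)‖ ≤ ‖v‖ := by
      simp [Prod.norm_def]
    set a : E × F := (v.1, (0 : F))
    have b1 : ‖B (compSubConstCLM ℂ (-a) Φ - Φ - ∂_{a} Φ) (y + v.2)‖ ≤
        C * (∑ i ∈ s, K i) * ‖v‖ ^ 2 := by
      refine ((B _).norm_le_seminorm ℂ _).trans ((hB _).trans ?_)
      rw [mul_assoc]
      gcongr
      refine (Seminorm.finset_sup_le_sum (schwartzSeminormFamily ℂ (E × F) ℂ) s _).trans ?_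
      rw [sum_apply, Finset.sum_mul]
      refine Finset.sum_le_sum fun i _ => (hrem i a (ha.trans hv1)).trans ?_
      have := hK i
      gcongr
    have b2 : ‖B (∂_{a} Φ) (y + v.2) - B (∂_{a} Φ) y‖ ≤ C' * (∑ i ∈ s', K' i) * ‖v‖ ^ 2 := by
      have hs : SchwartzMap.seminorm ℂ 0 1 (B (∂_{a} Φ)) ≤ C' * (∑ i ∈ s', K' i) * ‖v‖ := by
        refine (hB' _).trans ?_
        rw [mul_assoc]
        gcongr
        refine (Seminorm.finset_sup_le_sum (schwartzSeminormFamily ℂ (E × F) ℂ) s' _).trans ?_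
        rw [sum_apply, Finset.sum_mul]
        refine Finset.sum_le_sum fun i _ => (seminorm_lineDeriv_le Φ a i.1 i.2).trans ?_
        rw [mul_comm]
        gcongr
      have hm := convex_univ.norm_image_sub_le_of_norm_fderiv_le (𝕜 := ℝ)
        (f := (B (∂_{a} Φ))) (C := SchwartzMap.seminorm ℂ 0 1 (B (∂_{a} Φ)))
        (fun w _ => (B (∂_{a} Φ)).differentiableAt)
        (fun w _ => by
          have := (B (∂_{a} Φ)).norm_iteratedFDeriv_le_seminorm ℂ 1 w
          rwa [norm_iteratedFDeriv_one] at this) (Set.mem_univ y) (Set.mem_univ (y + v.2))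
      rw [add_sub_cancel_left] at hm
      calc _ ≤ _ := hm
        _ ≤ (C' * (∑ i ∈ s', K' i) * ‖v‖) * ‖v‖ := by
          gcongr
          exact norm_snd_le v
        _ = _ := by ring
    rw [Real.norm_of_nonneg (by positivity), add_mul]
    exact (norm_add_le _ _).trans (add_le_add b1 b2)
  refine (t2.add t1).congr_left fun v => ?_
  have e : L (slice (x + v.1) Φ) = B (compSubConstCLM ℂ (-(v.1, (0 : F))) Φ) := by
    rw [slice_add]; rfl
  have eA : (LinearMap.toContinuousLinearMap A) v.1 = B (∂_{(v.1, (0 : F))} Φ) y := rfl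
  simp only [Prod.fst_add, Prod.snd_add, e, map_sub, sub_apply, ContinuousLinearMap.coprod_apply,
    eA]
  have e0 : L (slice x Φ) = B Φ := rfl
  rw [e0]
  ring

/-- The operator `1 ⊗ L` acting on the second variable only: for a continuous linear map `L`
between Schwartz spaces, `(partialCLM L Φ) (x, ·) = L (Φ (x, ·))`. -/
noncomputable def partialCLM [FiniteDimensional ℝ E] [FiniteDimensional ℝ G]
    (L : 𝓢(F, ℂ) →L[ℂ] 𝓢(G, ℂ)) : 𝓢(E × F, ℂ) →L[ℂ] 𝓢(E × G, ℂ) :=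
  have key := smooth_and_bounds
    ((Module.finBasis ℝ E).prod (Module.finBasis ℝ G))
    {T : 𝓢(E × F, ℂ) → E × G → ℂ | ∃ (L' : 𝓢(F, ℂ) →L[ℂ] 𝓢(G, ℂ))
      (P : 𝓢(E × F, ℂ) →L[ℂ] 𝓢(E × F, ℂ)), T = fun Φ z => L' (slice z.1 (P Φ)) z.2}
    (by
      rintro _ ⟨L', P, rfl⟩ Φ z
      obtain ⟨f', hf, -⟩ := partial_hasFDerivAt L' (P Φ) z
      exact hf.differentiableAt)
    (by
      rintro _ ⟨L', P, rfl⟩ i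
      rcases i with i | i
      · refine ⟨_, ⟨L', LineDeriv.lineDerivOpCLM ℂ 𝓢(E × F, ℂ)
          ((Module.finBasis ℝ E i, (0 : F)) : E × F) ∘L P, rfl⟩, fun Φ z => ?_⟩
        obtain ⟨f', hf, h⟩ := partial_hasFDerivAt L' (P Φ) z
        rw [hf.fderiv]
        have : ((Module.finBasis ℝ E).prod (Module.finBasis ℝ G)) (Sum.inl i) =
          (Module.finBasis ℝ E i, (0 : G)) := by ext <;> simp
        rw [this, h]
        simp
      · refine ⟨_, ⟨LineDeriv.lineDerivOpCLM ℂ 𝓢(G, ℂ) (Module.finBasis ℝ G i) ∘L L', P, rfl⟩,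
          fun Φ z => ?_⟩
        obtain ⟨f', hf, h⟩ := partial_hasFDerivAt L' (P Φ) z
        rw [hf.fderiv]
        have : ((Module.finBasis ℝ E).prod (Module.finBasis ℝ G)) (Sum.inr i) =
          ((0 : E), Module.finBasis ℝ G i) := by ext <;> simp
        rw [this, h]
        have h0 : (∂_{((0 : E), (0 : F))} (P Φ) : 𝓢(E × F, ℂ)) = 0 :=
          LineDeriv.lineDerivOp_left_zero (P Φ)
        simp [h0])
    (by
      rintro _ ⟨L', P, rfl⟩ k
      obtain ⟨s, C, hC, h⟩ := partial_bound (E := E) L' k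
      obtain ⟨s', C', -, h'⟩ := Seminorm.bound_of_continuous
        (schwartz_withSeminorms ℂ (E × F) ℂ)
        ((s.sup (schwartzSeminormFamily ℂ (E × F) ℂ)).comp
          (P : 𝓢(E × F, ℂ) →ₗ[ℂ] 𝓢(E × F, ℂ)))
        (((schwartz_withSeminorms ℂ (E × F) ℂ).finset_sups.continuous_seminorm s).comp
          P.continuous)
      refine ⟨s', C * C', by positivity, fun Φ z => (h (P Φ) z).trans ?_⟩
      rw [mul_assoc]
      exact mul_le_mul_of_nonneg_left (h' Φ) hC)
  mkCLM (fun Φ z => L (slice z.1 Φ) z.2) (fun Φ Ψ z => by simp) (fun c Φ z => by simp)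
    (fun Φ => contDiff_infty.2 fun n =>
      (key n _ ⟨L, ContinuousLinearMap.id ℂ _, rfl⟩).1 Φ)
    (fun n => (key n.2 _ ⟨L, ContinuousLinearMap.id ℂ _, rfl⟩).2 n.1)

@[simp]
theorem partialCLM_apply [FiniteDimensional ℝ E] [FiniteDimensional ℝ G]
    (L : 𝓢(F, ℂ) →L[ℂ] 𝓢(G, ℂ)) (Φ : 𝓢(E × F, ℂ)) (x : E) (y : G) :
    partialCLM L Φ (x, y) = L (slice x Φ) y := rfl

end Partial

section TimeFrequency

variable {E : Type*} [NormedAddCommGroup E] [InnerProductSpace ℝ E]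

/-- The character `t ↦ exp (-2πi ξ·t)`. -/
noncomputable def character (ξ t : E) : ℂ :=
  Complex.exp (-(2 * Real.pi * Complex.I) * (inner ℝ ξ t : ℝ))

theorem character_hasTemperateGrowth (ξ : E) : (character ξ).HasTemperateGrowth := by
  have h : (fun r : ℝ => Complex.exp (-(2 * Real.pi * Complex.I) * (r : ℂ))).HasTemperateGrowth := by
    set c : ℂ := -(2 * Real.pi * Complex.I) with hc
    have hit : ∀ n : ℕ, iteratedDeriv n (fun r : ℝ => Complex.exp (c * (r : ℂ))) =
        fun r : ℝ => c ^ n * Complex.exp (c * (r : ℂ)) := by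
      intro n
      induction n with
      | zero => simp
      | succ n ih =>
        rw [iteratedDeriv_succ, ih]
        funext r
        have h1 : HasDerivAt (fun r : ℝ => Complex.exp (c * (r : ℂ)))
            (Complex.exp (c * (r : ℂ)) * (c * 1)) r :=
          ((Complex.ofRealCLM.hasDerivAt (x := r)).const_mul c).cexp
        rw [(h1.const_mul (c ^ n)).deriv]
        ring
    refine ⟨?_, fun n => ⟨0, ‖c‖ ^ n, fun r => ?_⟩⟩
    · exact (contDiff_const.mul Complex.ofRealCLM.contDiff).cexp
    · rw [norm_iteratedFDeriv_eq_norm_iteratedDeriv, hit]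
      have : ‖Complex.exp (c * (r : ℂ))‖ = 1 := by
        rw [Complex.norm_exp]
        simp [hc]
      simp [this]
  exact h.comp (Function.hasTemperateGrowth_inner_right ξ)

theorem norm_character (ξ t : E) : ‖character ξ t‖ = 1 := by
  rw [character, Complex.norm_exp]
  simp

theorem continuous_character : Continuous fun w : E × E => character w.1 w.2 := by
  unfold character
  fun_prop

/-- Complex conjugation of Schwartz functions. -/
noncomputable def conjSchwartz (φ : 𝓢(E, ℂ)) : 𝓢(E, ℂ) :=
  postcompCLM (𝕜 := ℝ) (Complex.conjCLE : ℂ →L[ℝ] ℂ) φ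

@[simp]
theorem conjSchwartz_apply (φ : 𝓢(E, ℂ)) (t : E) :
    conjSchwartz φ t = (starRingEnd ℂ) (φ t) := rfl

theorem continuous_conjSchwartz : Continuous (conjSchwartz : 𝓢(E, ℂ) → 𝓢(E, ℂ)) :=
  (postcompCLM (𝕜 := ℝ) (E := E) (Complex.conjCLE : ℂ →L[ℝ] ℂ)).continuous

/-- The complex conjugate of a tempered distribution, `⟨f̄, φ⟩ = conj ⟨f, φ̄⟩`. -/
noncomputable def conjDist (f : 𝓢'(E, ℂ)) : 𝓢'(E, ℂ) :=
  ContinuousLinearMap.toPointwiseConvergenceCLM ℂ (RingHom.id ℂ) 𝓢(E, ℂ) ℂ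
    { toFun := fun φ => (starRingEnd ℂ) (f (conjSchwartz φ))
      map_add' := fun φ ψ => by
        have : conjSchwartz (φ + ψ) = conjSchwartz φ + conjSchwartz ψ := by ext t; simp
        rw [this, map_add, map_add]
      map_smul' := fun c φ => by
        have : conjSchwartz (c • φ) = (starRingEnd ℂ c) • conjSchwartz φ := by ext t; simp
        rw [this, map_smul]
        simp
      cont := Complex.continuous_conj.comp ((map_continuous f).comp continuous_conjSchwartz) }

@[simp]
theorem conjDist_apply (f : 𝓢'(E, ℂ)) (φ : 𝓢(E, ℂ)) :
    conjDist f φ = (starRingEnd ℂ) (f (conjSchwartz φ)) := rfl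

/-- The complex conjugate of the time-frequency shift `M_ξ T_x g`, that is the Schwartz function
`t ↦ conj (g (t - x)) exp (-2πi ξ·t)`. -/
noncomputable def conjShift (g : 𝓢(E, ℂ)) (x ξ : E) : 𝓢(E, ℂ) :=
  smulLeftCLM ℂ (character ξ) (conjSchwartz (compSubConstCLM ℂ x g))

theorem conjShift_apply (g : 𝓢(E, ℂ)) (x ξ t : E) :
    conjShift g x ξ t = (starRingEnd ℂ) (g (t - x)) * character ξ t := by
  rw [conjShift, smulLeftCLM_apply_apply (character_hasTemperateGrowth ξ)]
  simp [mul_comm]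

/-- The short-time Fourier transform
`V_g f (x, ξ) = ⟨f, M_ξ T_x g⟩ = ∫ f(t) conj (g (t - x)) exp (-2πi ξ·t) dt`
of a tempered distribution `f` with window `g`. -/
noncomputable def stft (g : 𝓢(E, ℂ)) (f : 𝓢'(E, ℂ)) (x ξ : E) : ℂ :=
  f (conjShift g x ξ)

/-- The constant function `1` on a one-point space. -/
noncomputable def oneSchwartz : 𝓢(PUnit.{1}, ℂ) :=
  HasCompactSupport.toSchwartzMap (f := fun _ : PUnit.{1} => (1 : ℂ))
    (HasCompactSupport.of_compactSpace _) contDiff_const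

/-- Pairing a Schwartz function on a product with a tempered distribution in the second variable:
`(pairSnd f Φ) x = ⟨f, Φ (x, ·)⟩`. The tensor product of `f₁` and `f₂` is
`Φ ↦ f₁ (pairSnd f₂ Φ)`. -/
noncomputable def pairSnd [FiniteDimensional ℝ E] (f : 𝓢'(E, ℂ)) : 𝓢(E × E, ℂ) →L[ℂ] 𝓢(E, ℂ) :=
  compCLMOfContinuousLinearEquiv ℂ (ContinuousLinearEquiv.prodUnique ℝ E PUnit.{1}).symm ∘L
    partialCLM
      { toFun := fun ψ => f ψ • oneSchwartz
        map_add' := fun φ ψ => by rw [map_add, add_smul]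
        map_smul' := fun c φ => by rw [map_smul, smul_assoc]; rfl
        cont := (map_continuous f).smul continuous_const }

@[simp]
theorem pairSnd_apply [FiniteDimensional ℝ E] (f : 𝓢'(E, ℂ)) (Φ : 𝓢(E × E, ℂ)) (x : E) :
    pairSnd f Φ x = f (slice x Φ) := by
  change (f (slice x Φ) • oneSchwartz) PUnit.unit = _
  simp [oneSchwartz]

/-- The linear change of variables `(u, v) ↦ ((u + v) / 2, u - v)`, the inverse of
`(x, t) ↦ (x + t / 2, x - t / 2)`. -/
noncomputable def midpointDiff (E : Type*) [NormedAddCommGroup E] [InnerProductSpace ℝ E] :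
    (E × E) ≃L[ℝ] E × E where
  toFun w := ((1 / 2 : ℝ) • (w.1 + w.2), w.1 - w.2)
  invFun w := (w.1 + (1 / 2 : ℝ) • w.2, w.1 - (1 / 2 : ℝ) • w.2)
  map_add' w w' := by ext <;> simp <;> module
  map_smul' c w := by ext <;> simp <;> module
  left_inv w := by ext <;> simp <;> module
  right_inv w := by ext <;> simp <;> module
  continuous_toFun := by fun_prop
  continuous_invFun := by fun_prop

variable [FiniteDimensional ℝ E] [MeasurableSpace E] [BorelSpace E]

theorem partialFourier_apply (Φ : 𝓢(E × E, ℂ)) (x t : E) :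
    partialCLM (fourierTransformCLM ℂ) Φ (x, t) = ∫ ξ, Φ (x, ξ) * character ξ t := by
  rw [partialCLM_apply, fourierTransformCLM_apply, fourier_coe]
  rw [Real.fourier_eq']
  refine integral_congr_ae (Filter.Eventually.of_forall fun ξ => ?_)
  simp only [character, smul_eq_mul, slice_apply, real_inner_comm]
  rw [mul_comm]
  congr 2
  push_cast
  ring

/-- The kernel `(u, v) ↦ ∫ Ψ((u + v) / 2, ξ) exp (-2πi ξ·(u - v)) dξ` of a Schwartz function `Ψ`
on phase space: the partial Fourier transform in the second variable followed by a linear change of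
variables. -/
noncomputable def wignerKernel : 𝓢(WithLp 2 (E × E), ℂ) →L[ℂ] 𝓢(E × E, ℂ) :=
  compCLMOfContinuousLinearEquiv ℂ (midpointDiff E) ∘L
    partialCLM (fourierTransformCLM ℂ) ∘L
      compCLMOfContinuousLinearEquiv ℂ (WithLp.prodContinuousLinearEquiv 2 ℝ E E).symm

theorem wignerKernel_apply (Ψ : 𝓢(WithLp 2 (E × E), ℂ)) (u v : E) :
    wignerKernel Ψ (u, v) =
      ∫ ξ, Ψ (WithLp.toLp 2 ((1 / 2 : ℝ) • (u + v), ξ)) * character ξ (u - v) := by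
  exact partialFourier_apply _ _ _

/-- The cross-Wigner distribution of two tempered distributions,
`⟨W(f₁, f₂), Ψ⟩ = ⟨f₁ ⊗ f̄₂, wignerKernel Ψ⟩`, a tempered distribution on phase space. -/
noncomputable def crossWigner (f₁ f₂ : 𝓢'(E, ℂ)) : 𝓢'(WithLp 2 (E × E), ℂ) :=
  PointwiseConvergenceCLM.precomp ℂ (pairSnd (conjDist f₂) ∘L wignerKernel) f₁

theorem crossWigner_apply (f₁ f₂ : 𝓢'(E, ℂ)) (Ψ : 𝓢(WithLp 2 (E × E), ℂ)) :
    crossWigner f₁ f₂ Ψ = f₁ (pairSnd (conjDist f₂) (wignerKernel Ψ)) := rfl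

/-- The cross-Wigner distribution of two functions,
`W(f₁, f₂)(x, ξ) = ∫ f₁(x + t/2) conj (f₂(x - t/2)) exp (-2πi ξ·t) dt`. -/
noncomputable def crossWignerFun (f₁ f₂ : E → ℂ) (x ξ : E) : ℂ :=
  ∫ t, f₁ (x + (1 / 2 : ℝ) • t) * (starRingEnd ℂ) (f₂ (x - (1 / 2 : ℝ) • t)) * character ξ t

/-- On Schwartz functions the two definitions of the cross-Wigner distribution agree. -/
theorem crossWigner_schwartz (f₁ f₂ : 𝓢(E, ℂ)) (Ψ : 𝓢(WithLp 2 (E × E), ℂ)) :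
    crossWigner (toTemperedDistributionCLM E ℂ volume f₁) (toTemperedDistributionCLM E ℂ volume f₂)
      Ψ = ∫ z, Ψ z * crossWignerFun f₁ f₂ z.fst z.snd := by
  -- `S x t = ∫ Ψ(x, ξ) exp (-2πi ξ·t) dξ` and `H x t = f₁(x + t/2) conj (f₂(x - t/2))`
  let Ψ' : 𝓢(E × E, ℂ) :=
    compCLMOfContinuousLinearEquiv ℂ (WithLp.prodContinuousLinearEquiv 2 ℝ E E).symm Ψ
  let S : 𝓢(E × E, ℂ) := partialCLM (fourierTransformCLM ℂ) Ψ'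
  let H : E × E → ℂ := fun w =>
    f₁ (w.1 + (1 / 2 : ℝ) • w.2) * (starRingEnd ℂ) (f₂ (w.1 - (1 / 2 : ℝ) • w.2))
  have hS : ∀ x t, S (x, t) = ∫ ξ, Ψ' (x, ξ) * character ξ t := by
    exact fun x t => partialFourier_apply _ _ _
  have hHc : Continuous H := by
    have := f₁.continuous
    have := f₂.continuous
    fun_prop
  set M₁ := SchwartzMap.seminorm ℂ 0 0 f₁
  set M₂ := SchwartzMap.seminorm ℂ 0 0 f₂
  have hHb : ∀ w, ‖H w‖ ≤ M₁ * M₂ := by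
    intro w
    simp only [H, norm_mul, RCLike.norm_conj]
    gcongr
    · exact f₁.norm_le_seminorm ℂ _
    · exact f₂.norm_le_seminorm ℂ _
  have : (volume : Measure (E × E)).IsAddHaarMeasure :=
    inferInstanceAs (Measure.prod volume volume : Measure (E × E)).IsAddHaarMeasure
  have hint : ∀ R : 𝓢(E × E, ℂ), Integrable R (volume : Measure (E × E)) := fun R => R.integrable
  have hmul : ∀ (R : 𝓢(E × E, ℂ)) (h : E × E → ℂ), Continuous h → (∀ w, ‖h w‖ ≤ M₁ * M₂) →
      Integrable (fun w => R w * h w) (volume : Measure (E × E)) := fun R h hc hb =>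
    (hint R).mul_bdd hc.aestronglyMeasurable (Filter.Eventually.of_forall hb)
  -- the left-hand side
  have hL : crossWigner (toTemperedDistributionCLM E ℂ volume f₁)
      (toTemperedDistributionCLM E ℂ volume f₂) Ψ =
      ∫ u, ∫ v, S (midpointDiff E (u, v)) * H (midpointDiff E (u, v)) := by
    rw [crossWigner_apply]
    refine (toTemperedDistributionCLM_apply_apply volume f₁ _).trans ?_
    refine integral_congr_ae (Filter.Eventually.of_forall fun u => ?_)
    simp only [pairSnd_apply, conjDist_apply, smul_eq_mul]
    rw [toTemperedDistributionCLM_apply_apply volume f₂]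
    rw [← integral_conj, ← integral_mul_const]
    refine integral_congr_ae (Filter.Eventually.of_forall fun v => ?_)
    have e := (midpointDiff E).symm_apply_apply (u, v)
    have e1 : (midpointDiff E (u, v)).1 + (1 / 2 : ℝ) • (midpointDiff E (u, v)).2 = u :=
      congrArg Prod.fst e
    have e2 : (midpointDiff E (u, v)).1 - (1 / 2 : ℝ) • (midpointDiff E (u, v)).2 = v :=
      congrArg Prod.snd e
    have e3 : wignerKernel Ψ (u, v) = S (midpointDiff E (u, v)) := rfl
    simp only [H, e1, e2, map_mul, conjSchwartz_apply, slice_apply, smul_eq_mul,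
      Complex.conj_conj, e3]
    ring
  let J : E × E → ℂ := fun w => S w * H w
  have hJ : Integrable J (volume : Measure (E × E)) := hmul S H hHc hHb
  -- shear in the second variable
  have hshear : ∀ u, ∫ v, J (midpointDiff E (u, v)) = ∫ t, J (u - (1 / 2 : ℝ) • t, t) := by
    intro u
    rw [← integral_sub_left_eq_self (fun v => J (midpointDiff E (u, v))) volume u]
    refine integral_congr_ae (Filter.Eventually.of_forall fun t => ?_)
    have : midpointDiff E (u, u - t) = (u - (1 / 2 : ℝ) • t, t) := by
      ext1
      · change (1 / 2 : ℝ) • (u + (u - t)) = u - (1 / 2 : ℝ) • t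
        module
      · change u - (u - t) = t
        simp
    simp only [this]
  let sh : (E × E) ≃L[ℝ] E × E :=
    { toFun := fun w => (w.1 - (1 / 2 : ℝ) • w.2, w.2)
      invFun := fun w => (w.1 + (1 / 2 : ℝ) • w.2, w.2)
      map_add' := fun w w' => by ext <;> simp; module
      map_smul' := fun c w => by ext <;> simp; module
      left_inv := fun w => by ext <;> simp
      right_inv := fun w => by ext <;> simp
      continuous_toFun := by fun_prop
      continuous_invFun := by fun_prop }
  have hJsh : Integrable (fun w : E × E => J (w.1 - (1 / 2 : ℝ) • w.2, w.2))
      (volume : Measure (E × E)) :=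
    hmul (compCLMOfContinuousLinearEquiv ℂ sh S) (H ∘ sh) (hHc.comp sh.continuous)
      fun w => hHb _
  have hL2 : ∫ u, ∫ v, J (midpointDiff E (u, v)) = ∫ x, ∫ t, J (x, t) := by
    simp only [hshear]
    rw [integral_integral_swap hJsh]
    have : ∀ t, ∫ u, J (u - (1 / 2 : ℝ) • t, t) = ∫ x, J (x, t) := fun t =>
      integral_sub_right_eq_self (fun x => J (x, t)) ((1 / 2 : ℝ) • t)
    simp only [this]
    exact (integral_integral_swap hJ).symm
  -- the right-hand side
  have hHt : ∀ x, Integrable (fun t => H (x, t)) := by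
    intro x
    have h2 : Integrable (fun t => f₂ (x - (1 / 2 : ℝ) • t)) := by
      have h := ((f₂.integrable (μ := volume)).comp_sub_left x)
      exact h.comp_smul (by norm_num : (1 / 2 : ℝ) ≠ 0)
    have h2' : Integrable (fun t => (starRingEnd ℂ) (f₂ (x - (1 / 2 : ℝ) • t))) :=
      (LinearIsometryEquiv.integrable_comp_iff (Complex.conjLIE)).2 h2
    refine h2'.bdd_mul (c := M₁) ?_ (Filter.Eventually.of_forall fun t => f₁.norm_le_seminorm ℂ _)
    have := f₁.continuous
    exact Continuous.aestronglyMeasurable (by fun_prop)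
  have hW : ∀ x ξ, crossWignerFun f₁ f₂ x ξ = ∫ t, H (x, t) * character ξ t := fun x ξ => rfl
  have hx : ∀ x, ∫ ξ, Ψ' (x, ξ) * crossWignerFun f₁ f₂ x ξ = ∫ t, J (x, t) := by
    intro x
    have hΨx : Integrable (fun ξ => Ψ' (x, ξ)) := by
      have := (slice x Ψ').integrable (μ := volume)
      exact this.congr (Filter.Eventually.of_forall fun ξ => slice_apply x Ψ' ξ)
    have hprod : Integrable (fun w : E × E => Ψ' (x, w.1) * (H (x, w.2) * character w.1 w.2))
        (volume.prod volume) := by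
      have h := (hΨx.mul_prod (hHt x)).mul_bdd (c := 1)
        (continuous_character (E := E)).aestronglyMeasurable
        (Filter.Eventually.of_forall fun w => (norm_character w.1 w.2).le)
      exact h.congr (Filter.Eventually.of_forall fun w => by simp only [mul_assoc])
    calc ∫ ξ, Ψ' (x, ξ) * crossWignerFun f₁ f₂ x ξ
        = ∫ ξ, ∫ t, Ψ' (x, ξ) * (H (x, t) * character ξ t) := by
          simp only [hW, integral_const_mul]
      _ = ∫ t, ∫ ξ, Ψ' (x, ξ) * (H (x, t) * character ξ t) := integral_integral_swap hprod
      _ = ∫ t, J (x, t) := by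
          refine integral_congr_ae (Filter.Eventually.of_forall fun t => ?_)
          simp only [J, hS, ← integral_mul_const]
          refine integral_congr_ae (Filter.Eventually.of_forall fun ξ => ?_)
          simp only
          ring
  have hΨW : Integrable (fun w : E × E => Ψ' w * crossWignerFun f₁ f₂ w.1 w.2)
      (volume.prod volume) := by
    have hm : AEStronglyMeasurable (fun w : E × E => crossWignerFun f₁ f₂ w.1 w.2)
        (volume.prod volume) := by
      refine StronglyMeasurable.aestronglyMeasurable ?_
      refine StronglyMeasurable.integral_prod_right'
        (f := fun w : (E × E) × E => H (w.1.1, w.2) * character w.1.2 w.2) ?_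
      refine Continuous.stronglyMeasurable ?_
      have := continuous_character (E := E)
      exact (hHc.comp (by fun_prop)).mul (this.comp (by fun_prop : Continuous
        fun w : (E × E) × E => (w.1.2, w.2)))
    refine (hint Ψ').mul_bdd (c := M₁ * ∫ t, ‖f₂ ((1 / 2 : ℝ) • t)‖) hm
      (Filter.Eventually.of_forall fun w => ?_)
    have hsub : ∫ t, ‖f₂ (w.1 - (1 / 2 : ℝ) • t)‖ = ∫ t, ‖f₂ ((1 / 2 : ℝ) • t)‖ := by
      rw [← integral_sub_left_eq_self (fun t => ‖f₂ ((1 / 2 : ℝ) • t)‖) volume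
        ((2 : ℝ) • w.1)]
      refine integral_congr_ae (Filter.Eventually.of_forall fun t => ?_)
      simp only [smul_sub, smul_smul]
      norm_num
    rw [hW, ← hsub, ← integral_const_mul]
    refine norm_integral_le_of_norm_le ?_ (Filter.Eventually.of_forall fun t => ?_)
    · have h := ((f₂.integrable (μ := volume)).comp_sub_left w.1)
      exact ((h.comp_smul (by norm_num : (1 / 2 : ℝ) ≠ 0)).norm).const_mul _
    · simp only [H, norm_mul, norm_character, RCLike.norm_conj, mul_one]
      gcongr
      exact f₁.norm_le_seminorm ℂ _
  have hR : ∫ z, Ψ z * crossWignerFun f₁ f₂ z.fst z.snd = ∫ x, ∫ t, J (x, t) := by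
    rw [← (WithLp.volume_preserving_toLp E E).integral_comp
      (MeasurableEquiv.toLp 2 (E × E)).measurableEmbedding]
    simp only [← hx]
    exact integral_prod _ hΨW
  rw [hL, hR]
  exact hL2

end TimeFrequency

section Norms

variable {E : Type*} [NormedAddCommGroup E] [InnerProductSpace ℝ E]
  [FiniteDimensional ℝ E] [MeasurableSpace E] [BorelSpace E]


/-- The weighted mixed norm of `L^{p,q}_m`, for `1 ≤ p, q ≤ ∞`: the `L^q` norm in the second
variable of the `L^p` norm in the first variable of `F m`. -/
noncomputable def mixedNorm (p q : ℝ≥0∞) (m : E → E → ℝ) (F : E → E → ℂ) : ℝ≥0∞ :=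
  eLpNorm (fun ξ => eLpNorm (fun x => F x ξ * (m x ξ : ℂ)) p volume) q volume

/-- The modulation space norm `‖V_g f‖_{L^{p,q}_m}` with window `g`. -/
noncomputable def modNorm (g : 𝓢(E, ℂ)) (p q : ℝ≥0∞) (m : E → E → ℝ) (f : 𝓢'(E, ℂ)) : ℝ≥0∞ :=
  mixedNorm p q m (stft g f)

/-- The modulation space `M^{p,q}_m`: tempered distributions whose short-time Fourier transform
with window `g` lies in `L^{p,q}_m`. -/
def modulationSpace (g : 𝓢(E, ℂ)) (p q : ℝ≥0∞) (m : E → E → ℝ) : Set 𝓢'(E, ℂ) :=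
  {f | modNorm g p q m f < ⊤}

/-- The weight `v_s(z) = (1 + |z|²)^{s/2}`. -/
noncomputable def polyWeight {Z : Type*} [NormedAddCommGroup Z] (s : ℝ) (z : Z) : ℝ :=
  (1 + ‖z‖ ^ 2) ^ (s / 2)

/-- `v_s` as a weight on phase space. -/
noncomputable def phaseWeight (s : ℝ) (x ξ : E) : ℝ :=
  polyWeight s (WithLp.toLp 2 (x, ξ))

/-- `1 ⊗ v_s`, a weight depending only on the second variable. -/
noncomputable def freqWeight (s : ℝ) (_x ξ : E) : ℝ :=
  polyWeight s ξ

end Norms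

end TFA

/-!
The short-time Fourier transform of `W(f₁, f₂)` with window `W(g, g)` satisfies
`|V W(f₁, f₂)(z, ζ)| = |V_g f₁(z - J ζ / 2)| * |V_g f₂(z + J ζ / 2)|` with `J (x, ξ) = (ξ, -x)`,
and a modulation norm changes by at most a constant factor when the window is changed. For `p ≤ q`
the norm of `W(f₁, f₂)` is therefore governed by the `L^{q/p}` norm of a convolution on phase space
of `p`-th powers, and Young's inequality for mixed norms gives the boundedness after enlarging the
exponents of `f₁` and `f₂` up to equality in (2); for `p > q` replace `p` by `q`. The weights are
distributed by Peetre's inequality.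

Conversely, all the norms are explicit for Gaussian windows and functions. Gaussians whose
short-time Fourier transforms decay slowly in one variable yield inequalities between powers of the
decay rates, and letting one rate, respectively both rates, tend to zero gives (1) and (2).
-/

namespace TFA

open scoped LineDeriv BoundedContinuousFunction FourierTransform

/-! ### Hölder, Minkowski and Young inequalities for functions with values in `[0, ∞]` -/

section Lebesgue

variable {α β : Type*} [MeasurableSpace α] [MeasurableSpace β] {μ : Measure α} {ν : Measure β}

theorem eLpNorm_eq_lintegral_rpow {p : ℝ≥0∞} (h0 : p ≠ 0) (ht : p ≠ ∞) (f : α → ℝ≥0∞) :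
    eLpNorm f p μ = (∫⁻ x, f x ^ p.toReal ∂μ) ^ p.toReal⁻¹ := by
  simpa using eLpNorm_eq_lintegral_rpow_enorm_toReal h0 ht (f := f) (μ := μ)

theorem eLpNorm_rpow_eq_lintegral {p : ℝ≥0∞} (h0 : p ≠ 0) (ht : p ≠ ∞) (f : α → ℝ≥0∞) :
    eLpNorm f p μ ^ p.toReal = ∫⁻ x, f x ^ p.toReal ∂μ := by
  rw [eLpNorm_eq_lintegral_rpow h0 ht, ENNReal.rpow_inv_rpow (ENNReal.toReal_pos h0 ht).ne']

theorem eLpNorm_one_eq_lintegral (f : α → ℝ≥0∞) : eLpNorm f 1 μ = ∫⁻ x, f x ∂μ := by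
  simp [eLpNorm_one_eq_lintegral_enorm]

theorem eLpNorm_top_le_iff {f : α → ℝ≥0∞} {c : ℝ≥0∞} :
    eLpNorm f ∞ μ ≤ c ↔ ∀ᵐ x ∂μ, f x ≤ c := by
  rw [eLpNorm_exponent_top, eLpNormEssSup_eq_essSup_enorm]
  exact ⟨fun h => (ENNReal.ae_le_essSup f).mono fun x hx => hx.trans h,
    fun h => essSup_le_of_ae_le _ h⟩

theorem ae_le_eLpNorm_top (f : α → ℝ≥0∞) : ∀ᵐ x ∂μ, f x ≤ eLpNorm f ∞ μ :=
  eLpNorm_top_le_iff.1 le_rfl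

theorem eLpNorm_mono_ennreal {p : ℝ≥0∞} {f g : α → ℝ≥0∞} (h : ∀ x, f x ≤ g x) :
    eLpNorm f p μ ≤ eLpNorm g p μ :=
  eLpNorm_mono_enorm (by simpa using h)

theorem lintegral_mul_le_eLpNorm_top_mul_eLpNorm_one {f g : α → ℝ≥0∞} (hg : AEMeasurable g μ) :
    ∫⁻ x, f x * g x ∂μ ≤ eLpNorm f ∞ μ * eLpNorm g 1 μ := by
  rw [eLpNorm_one_eq_lintegral, ← lintegral_const_mul'' _ hg]
  exact lintegral_mono_ae ((ae_le_eLpNorm_top f).mono fun x hx => mul_le_mul_left hx (g x))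

theorem lintegral_mul_le_eLpNorm_mul_eLpNorm {p q : ℝ≥0∞} [hpq : p.HolderConjugate q]
    {f g : α → ℝ≥0∞} (hf : AEMeasurable f μ) (hg : AEMeasurable g μ) :
    ∫⁻ x, f x * g x ∂μ ≤ eLpNorm f p μ * eLpNorm g q μ := by
  rcases eq_or_ne p ∞ with rfl | hp
  · obtain rfl : q = 1 := by simpa using hpq.inv_add_inv_eq_inv
    exact lintegral_mul_le_eLpNorm_top_mul_eLpNorm_one hg
  rcases eq_or_ne q ∞ with rfl | hq
  · obtain rfl : p = 1 := by simpa using hpq.inv_add_inv_eq_inv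
    simpa only [mul_comm] using lintegral_mul_le_eLpNorm_top_mul_eLpNorm_one (f := g) hf
  rw [eLpNorm_eq_lintegral_rpow (ENNReal.HolderConjugate.ne_zero p q) hp,
    eLpNorm_eq_lintegral_rpow (ENNReal.HolderConjugate.ne_zero q p) hq]
  simpa only [one_div, Pi.mul_apply] using ENNReal.lintegral_mul_le_Lp_mul_Lq μ
    (ENNReal.HolderConjugate.toReal_of_ne_top hp hq) hf hg

theorem exists_measurable_le_lt_lintegral [SigmaFinite μ] {f : α → ℝ≥0∞} {L : ℝ≥0∞}
    (hL : L < ∫⁻ x, f x ∂μ) :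
    ∃ g : α → ℝ≥0∞, Measurable g ∧ (∀ x, g x ≤ f x) ∧ ∫⁻ x, g x ∂μ ≠ ∞ ∧ L < ∫⁻ x, g x ∂μ := by
  simp only [lintegral_eq_nnreal f, lt_iSup_iff] at hL
  obtain ⟨φ, hφf, hφ⟩ := hL
  rw [← SimpleFunc.lintegral_eq_lintegral] at hφ
  obtain ⟨g, hgφ, hg, hLg⟩ := SimpleFunc.exists_lt_lintegral_simpleFunc_of_lt_lintegral
    (f := φ) (by simpa using hφ)
  exact ⟨fun x => g x, g.measurable.coe_nnreal_ennreal,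
    fun x => (ENNReal.coe_le_coe.2 (hgφ x)).trans (hφf x), hg.ne, hLg⟩

/- Test the hypothesis with `g ^ (1 / s')`, where `g ≤ F ^ s` has finite integral close to
`∫ F ^ s`. -/
theorem lintegral_rpow_le_of_forall_lintegral_mul_le [SigmaFinite μ] {s s' : ℝ}
    (hs : s.HolderConjugate s') {F : α → ℝ≥0∞} {K : ℝ≥0∞}
    (h : ∀ g : α → ℝ≥0∞, Measurable g →
      ∫⁻ x, F x * g x ∂μ ≤ K * (∫⁻ x, g x ^ s' ∂μ) ^ s'⁻¹) :
    ∫⁻ x, F x ^ s ∂μ ≤ K ^ s := by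
  refine le_of_forall_lt fun L hL => ?_
  obtain ⟨g, hg, hgF, hfin, hLg⟩ := exists_measurable_le_lt_lintegral hL
  refine hLg.trans_le ?_
  set I := ∫⁻ x, g x ∂μ
  have hI : I ≠ 0 := (bot_le.trans_lt hLg).ne'
  have split (x : ℝ≥0∞) : x ^ s⁻¹ * x ^ s'⁻¹ = x := by
    rw [← ENNReal.rpow_add_of_nonneg _ _ hs.inv_nonneg hs.symm.inv_nonneg,
      hs.inv_add_inv_eq_one, ENNReal.rpow_one]
  have key : I ^ s⁻¹ * I ^ s'⁻¹ ≤ K * I ^ s'⁻¹ :=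
    calc I ^ s⁻¹ * I ^ s'⁻¹
        = ∫⁻ x, g x ^ s⁻¹ * g x ^ s'⁻¹ ∂μ := by simp only [split, I]
      _ ≤ ∫⁻ x, F x * g x ^ s'⁻¹ ∂μ := lintegral_mono fun x =>
          mul_le_mul_left ((ENNReal.rpow_inv_le_iff hs.pos).2 (hgF x)) _
      _ ≤ K * I ^ s'⁻¹ := by
          simpa only [ENNReal.rpow_inv_rpow hs.symm.ne_zero] using
            h (fun x => g x ^ s'⁻¹) (hg.pow_const _)
  rw [ENNReal.mul_le_mul_iff_left (by simp [hI, hfin])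
    (ENNReal.rpow_ne_top_of_nonneg hs.symm.inv_nonneg hfin)] at key
  exact (ENNReal.rpow_inv_le_iff hs.pos).1 key

theorem eLpNorm_le_of_forall_lintegral_mul_le [SigmaFinite μ] {r r' : ℝ≥0∞}
    [hr : r.HolderConjugate r'] {F : α → ℝ≥0∞} (hF : Measurable F) {K : ℝ≥0∞}
    (h : ∀ g : α → ℝ≥0∞, Measurable g → ∫⁻ x, F x * g x ∂μ ≤ K * eLpNorm g r' μ) :
    eLpNorm F r μ ≤ K := by
  rcases eq_or_ne r ∞ with rfl | hrt
  · obtain rfl : r' = 1 := by simpa using hr.inv_add_inv_eq_inv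
    rw [eLpNorm_top_le_iff]
    refine ae_le_of_forall_setLIntegral_le_of_sigmaFinite hF fun s hs _ => ?_
    have hs' := h (s.indicator 1) (measurable_one.indicator hs)
    rw [eLpNorm_one_eq_lintegral, lintegral_indicator_one hs] at hs'
    rw [setLIntegral_const, ← lintegral_indicator hs]
    simpa only [← Set.indicator_mul_right, Pi.one_apply, mul_one] using hs'
  rcases eq_or_ne r' ∞ with rfl | hrt'
  · obtain rfl : r = 1 := by simpa using hr.inv_add_inv_eq_inv
    have h1 : eLpNorm (1 : α → ℝ≥0∞) ∞ μ ≤ 1 := eLpNorm_top_le_iff.2 (.of_forall fun _ => le_rfl)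
    rw [eLpNorm_one_eq_lintegral]
    simpa using (h 1 measurable_one).trans (mul_le_mul_right h1 K)
  have hc := ENNReal.HolderConjugate.toReal_of_ne_top hrt hrt'
  rw [eLpNorm_eq_lintegral_rpow (ENNReal.HolderConjugate.ne_zero r r') hrt,
    ENNReal.rpow_inv_le_iff hc.pos]
  refine lintegral_rpow_le_of_forall_lintegral_mul_le hc fun g hg => ?_
  simpa only [eLpNorm_eq_lintegral_rpow (ENNReal.HolderConjugate.ne_zero r' r) hrt'] using h g hg

theorem measurable_eLpNorm_prodMk [SFinite μ] {f : α × β → ℝ≥0∞} (hf : Measurable f)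
    (p : ℝ≥0∞) : Measurable fun y => eLpNorm (fun x => f (x, y)) p μ := by
  rcases eq_or_ne p 0 with rfl | h0
  · simp
  rcases eq_or_ne p ∞ with rfl | ht
  · refine measurable_of_Iic fun c => ?_
    have hs : MeasurableSet {z : β × α | c < f (z.2, z.1)} :=
      measurableSet_lt measurable_const (hf.comp measurable_swap)
    convert measurable_measure_prodMk_left (ν := μ) hs (measurableSet_singleton 0) using 1
    ext y
    simp only [Set.mem_preimage, Set.mem_Iic, eLpNorm_top_le_iff, ae_iff, not_le,
      Set.mem_singleton_iff]
    rfl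
  · simp only [eLpNorm_eq_lintegral_rpow h0 ht]
    exact ((hf.comp measurable_swap).pow_const p.toReal).lintegral_prod_right'.pow_const _

theorem eLpNorm_lintegral_le [SigmaFinite μ] [SFinite ν] {r : ℝ≥0∞} (hr : 1 ≤ r)
    {f : α × β → ℝ≥0∞} (hf : Measurable f) :
    eLpNorm (fun x => ∫⁻ y, f (x, y) ∂ν) r μ ≤ ∫⁻ y, eLpNorm (fun x => f (x, y)) r μ ∂ν := by
  have : r.HolderConjugate r.conjExponent := .conjExponent hr
  refine eLpNorm_le_of_forall_lintegral_mul_le (r' := r.conjExponent)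
    hf.lintegral_prod_right' fun g hg => ?_
  calc ∫⁻ x, (∫⁻ y, f (x, y) ∂ν) * g x ∂μ
      = ∫⁻ x, ∫⁻ y, f (x, y) * g x ∂ν ∂μ :=
        lintegral_congr fun x => (lintegral_mul_const _ (by fun_prop)).symm
    _ = ∫⁻ y, ∫⁻ x, f (x, y) * g x ∂μ ∂ν :=
        lintegral_lintegral_swap (hf.mul (hg.comp measurable_fst)).aemeasurable
    _ ≤ ∫⁻ y, eLpNorm (fun x => f (x, y)) r μ * eLpNorm g r.conjExponent μ ∂ν :=
        lintegral_mono fun y => lintegral_mul_le_eLpNorm_mul_eLpNorm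
          (hf.comp measurable_prodMk_right).aemeasurable hg.aemeasurable
    _ = (∫⁻ y, eLpNorm (fun x => f (x, y)) r μ ∂ν) * eLpNorm g r.conjExponent μ :=
        lintegral_mul_const _ (measurable_eLpNorm_prodMk hf r)

theorem rpow_mul_rpow_sub (x : ℝ≥0∞) {s t : ℝ} (hs : 0 ≤ s) (hst : s ≤ t) :
    x ^ s * x ^ (t - s) = x ^ t := by
  rw [← ENNReal.rpow_add_of_nonneg _ _ hs (sub_nonneg.2 hst), add_sub_cancel]

/- Hölder's inequality with exponents `r`, `(a⁻¹ - r⁻¹)⁻¹`, `(b⁻¹ - r⁻¹)⁻¹` for the factorization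
`f g = (f ^ a g ^ b) ^ (1 / r) · f ^ (1 - a / r) · g ^ (1 - b / r)`. -/
theorem lintegral_mul_le_of_inv_add_inv {a b r : ℝ} (ha : 0 < a) (hb : 0 < b) (hr : 0 < r)
    (har : r⁻¹ ≤ a⁻¹) (hbr : r⁻¹ ≤ b⁻¹) (h : a⁻¹ + b⁻¹ = 1 + r⁻¹) {f g : α → ℝ≥0∞}
    (hf : AEMeasurable f μ) (hg : AEMeasurable g μ) :
    ∫⁻ x, f x * g x ∂μ ≤ (∫⁻ x, f x ^ a * g x ^ b ∂μ) ^ r⁻¹ *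
      ((∫⁻ x, f x ^ a ∂μ) ^ (a⁻¹ - r⁻¹) * (∫⁻ x, g x ^ b ∂μ) ^ (b⁻¹ - r⁻¹)) := by
  have hr' := (inv_pos.2 hr).le
  have holder := ENNReal.lintegral_prod_norm_pow_le (μ := μ) (Finset.univ : Finset (Fin 3))
    (f := ![fun x => f x ^ a * g x ^ b, fun x => f x ^ a, fun x => g x ^ b])
    (p := ![r⁻¹, a⁻¹ - r⁻¹, b⁻¹ - r⁻¹])
    (by simpa [Fin.forall_fin_succ] using
      ⟨(hf.pow_const a).mul (hg.pow_const b), hf.pow_const a, hg.pow_const b⟩)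
    (by simp only [Fin.sum_univ_three, Matrix.cons_val]; linarith)
    (by simpa [Fin.forall_fin_succ] using ⟨hr.le, har, hbr⟩)
  simp only [Fin.prod_univ_three, Matrix.cons_val, mul_assoc] at holder
  refine (lintegral_mono fun x => le_of_eq ?_).trans holder
  have hfx := rpow_mul_rpow_sub (f x ^ a) hr' har
  have hgx := rpow_mul_rpow_sub (g x ^ b) hr' hbr
  rw [ENNReal.rpow_rpow_inv ha.ne'] at hfx
  rw [ENNReal.rpow_rpow_inv hb.ne'] at hgx
  rw [ENNReal.mul_rpow_of_nonneg _ _ hr']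
  nth_rewrite 1 [← hfx, ← hgx]
  ring

/-- The mixed Lebesgue norm `‖F‖_{L^{p,q}}`: the `L^p` norm is taken in the first variable and
then the `L^q` norm in the second one. -/
noncomputable def mixedELpNorm (F : α × β → ℝ≥0∞) (p q : ℝ≥0∞) (μ : Measure α) (ν : Measure β) :
    ℝ≥0∞ :=
  eLpNorm (fun y => eLpNorm (fun x => F (x, y)) p μ) q ν

end Lebesgue

section Convolution

theorem inv_le_inv_of_inv_add_inv {a b r : ℝ≥0∞} (hb : 1 ≤ b) (h : a⁻¹ + b⁻¹ = 1 + r⁻¹) :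
    r⁻¹ ≤ a⁻¹ := by
  have hb' : b⁻¹ ≤ 1 := ENNReal.inv_le_one.2 hb
  refine (ENNReal.add_le_add_iff_left ENNReal.one_ne_top).1 (h.symm.trans_le ?_)
  rw [add_comm 1]
  gcongr

theorem one_le_of_inv_add_inv {a b r : ℝ≥0∞} (ha : 1 ≤ a) (hb : 1 ≤ b)
    (h : a⁻¹ + b⁻¹ = 1 + r⁻¹) : 1 ≤ r := by
  rw [← ENNReal.inv_le_one]
  exact (inv_le_inv_of_inv_add_inv hb h).trans (ENNReal.inv_le_one.2 ha)

theorem toReal_inv_add_inv {a b r : ℝ≥0∞} (ha : 1 ≤ a) (hb : 1 ≤ b) (hr : 1 ≤ r)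
    (h : a⁻¹ + b⁻¹ = 1 + r⁻¹) : a.toReal⁻¹ + b.toReal⁻¹ = 1 + r.toReal⁻¹ := by
  have inv_ne_top {c : ℝ≥0∞} (hc : 1 ≤ c) : c⁻¹ ≠ ∞ :=
    ENNReal.inv_ne_top.2 (one_pos.trans_le hc).ne'
  simp only [← ENNReal.toReal_inv]
  rw [← ENNReal.toReal_add (inv_ne_top ha) (inv_ne_top hb), h,
    ENNReal.toReal_add ENNReal.one_ne_top (inv_ne_top hr), ENNReal.toReal_one]

variable {G : Type*} [MeasurableSpace G] [AddCommGroup G] [MeasurableAdd₂ G] [MeasurableNeg G]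
  {μ : Measure G} [μ.IsAddLeftInvariant]

theorem lintegral_lconvolution [SFinite μ] {f g : G → ℝ≥0∞} (hf : Measurable f)
    (hg : Measurable g) :
    ∫⁻ x, (f ⋆ₗ[μ] g) x ∂μ = (∫⁻ x, f x ∂μ) * ∫⁻ x, g x ∂μ := by
  have hfg : Measurable fun z : G × G => f z.2 * g (-z.2 + z.1) := by fun_prop
  simp only [lconvolution_def]
  rw [lintegral_lintegral_swap hfg.aemeasurable]
  have inner (y : G) : ∫⁻ x, f y * g (-y + x) ∂μ = f y * ∫⁻ x, g x ∂μ := by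
    rw [lintegral_const_mul _ (by fun_prop), lintegral_add_left_eq_self]
  simp only [inner, lintegral_mul_const _ hf]

variable [μ.IsNegInvariant]

theorem lintegral_neg_add_eq_self (f : G → ℝ≥0∞) (x : G) :
    ∫⁻ y, f (-y + x) ∂μ = ∫⁻ y, f y ∂μ := by
  simpa only [neg_add_eq_sub] using lintegral_sub_left_eq_self f x

variable [SigmaFinite μ]

theorem lintegral_lconvolution_rpow_le {a b r : ℝ} (ha : 0 < a) (hb : 0 < b) (hr : 0 < r)
    (har : r⁻¹ ≤ a⁻¹) (hbr : r⁻¹ ≤ b⁻¹) (h : a⁻¹ + b⁻¹ = 1 + r⁻¹) {f g : G → ℝ≥0∞}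
    (hf : Measurable f) (hg : Measurable g) :
    (∫⁻ x, (f ⋆ₗ[μ] g) x ^ r ∂μ) ^ r⁻¹ ≤
      (∫⁻ x, f x ^ a ∂μ) ^ a⁻¹ * (∫⁻ x, g x ^ b ∂μ) ^ b⁻¹ := by
  set X := ∫⁻ x, f x ^ a ∂μ
  set Y := ∫⁻ x, g x ^ b ∂μ
  have hr' := (inv_pos.2 hr).le
  let c : G → ℝ≥0∞ := (fun x => f x ^ a) ⋆ₗ[μ] fun x => g x ^ b
  have pointwise (x : G) :
      (f ⋆ₗ[μ] g) x ≤ c x ^ r⁻¹ * (X ^ (a⁻¹ - r⁻¹) * Y ^ (b⁻¹ - r⁻¹)) := by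
    have := lintegral_mul_le_of_inv_add_inv (μ := μ) (g := fun y => g (-y + x)) ha hb hr har hbr h
      hf.aemeasurable (by fun_prop)
    rwa [lintegral_neg_add_eq_self (fun y => g y ^ b)] at this
  calc (∫⁻ x, (f ⋆ₗ[μ] g) x ^ r ∂μ) ^ r⁻¹
      ≤ (∫⁻ x, c x * (X ^ (a⁻¹ - r⁻¹) * Y ^ (b⁻¹ - r⁻¹)) ^ r ∂μ) ^ r⁻¹ := by
        gcongr with x
        refine (ENNReal.rpow_le_rpow (pointwise x) hr.le).trans_eq ?_
        rw [ENNReal.mul_rpow_of_nonneg _ _ hr.le, ENNReal.rpow_inv_rpow hr.ne']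
    _ = (X * Y) ^ r⁻¹ * (X ^ (a⁻¹ - r⁻¹) * Y ^ (b⁻¹ - r⁻¹)) := by
        rw [lintegral_mul_const _ (measurable_lconvolution μ (by fun_prop) (by fun_prop)),
          lintegral_lconvolution (by fun_prop) (by fun_prop),
          ENNReal.mul_rpow_of_nonneg _ _ hr', ENNReal.rpow_rpow_inv hr.ne']
    _ = (X ^ r⁻¹ * X ^ (a⁻¹ - r⁻¹)) * (Y ^ r⁻¹ * Y ^ (b⁻¹ - r⁻¹)) := by
        rw [ENNReal.mul_rpow_of_nonneg _ _ hr']; ring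
    _ = X ^ a⁻¹ * Y ^ b⁻¹ := by
        rw [rpow_mul_rpow_sub _ hr' har, rpow_mul_rpow_sub _ hr' hbr]

theorem eLpNorm_lconvolution_le {a b r : ℝ≥0∞} (ha : 1 ≤ a) (hb : 1 ≤ b)
    (h : a⁻¹ + b⁻¹ = 1 + r⁻¹) {f g : G → ℝ≥0∞} (hf : Measurable f) (hg : Measurable g) :
    eLpNorm (f ⋆ₗ[μ] g) r μ ≤ eLpNorm f a μ * eLpNorm g b μ := by
  rcases eq_or_ne r ∞ with rfl | hrt
  · have : a.HolderConjugate b := ⟨by simpa using h⟩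
    refine eLpNorm_top_le_iff.2 (.of_forall fun x => ?_)
    refine (lintegral_mul_le_eLpNorm_mul_eLpNorm (p := a) (q := b) hf.aemeasurable
      (by fun_prop)).trans_eq ?_
    simp only [neg_add_eq_sub]
    congr 1
    exact eLpNorm_comp_measurePreserving hg.aestronglyMeasurable
      (Measure.measurePreserving_sub_left μ x)
  have hr := one_le_of_inv_add_inv ha hb h
  have har := inv_le_inv_of_inv_add_inv hb h
  have hbr := inv_le_inv_of_inv_add_inv ha ((add_comm _ _).trans h)
  have hat : a ≠ ∞ := fun ht => hrt <| by simpa [ht] using har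
  have hbt : b ≠ ∞ := fun ht => hrt <| by simpa [ht] using hbr
  have ne_zero {c : ℝ≥0∞} (hc : 1 ≤ c) : c ≠ 0 := (one_pos.trans_le hc).ne'
  have inv_mono {c : ℝ≥0∞} (hc : 1 ≤ c) (hcr : r⁻¹ ≤ c⁻¹) : r.toReal⁻¹ ≤ c.toReal⁻¹ := by
    rw [← ENNReal.toReal_inv, ← ENNReal.toReal_inv]
    exact ENNReal.toReal_mono (ENNReal.inv_ne_top.2 (ne_zero hc)) hcr
  rw [eLpNorm_eq_lintegral_rpow (ne_zero hr) hrt, eLpNorm_eq_lintegral_rpow (ne_zero ha) hat,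
    eLpNorm_eq_lintegral_rpow (ne_zero hb) hbt]
  exact lintegral_lconvolution_rpow_le (ENNReal.toReal_pos (ne_zero ha) hat)
    (ENNReal.toReal_pos (ne_zero hb) hbt) (ENNReal.toReal_pos (ne_zero hr) hrt)
    (inv_mono ha har) (inv_mono hb hbr) (toReal_inv_add_inv ha hb hr h) hf hg

variable {H : Type*} [MeasurableSpace H] [AddCommGroup H] [MeasurableAdd₂ H] [MeasurableNeg H]
  {ν : Measure H} [SigmaFinite ν] [ν.IsAddLeftInvariant] [ν.IsNegInvariant]

theorem mixedELpNorm_lconvolution_le {a₁ b₁ r₁ a₂ b₂ r₂ : ℝ≥0∞} (ha₁ : 1 ≤ a₁) (hb₁ : 1 ≤ b₁)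
    (h₁ : a₁⁻¹ + b₁⁻¹ = 1 + r₁⁻¹) (ha₂ : 1 ≤ a₂) (hb₂ : 1 ≤ b₂) (h₂ : a₂⁻¹ + b₂⁻¹ = 1 + r₂⁻¹)
    {f g : G × H → ℝ≥0∞} (hf : Measurable f) (hg : Measurable g) :
    mixedELpNorm (f ⋆ₗ[μ.prod ν] g) r₁ r₂ μ ν ≤
      mixedELpNorm f a₁ a₂ μ ν * mixedELpNorm g b₁ b₂ μ ν := by
  have fubini (x : G) (ξ : H) : (f ⋆ₗ[μ.prod ν] g) (x, ξ) =
      ∫⁻ η, ((fun y => f (y, η)) ⋆ₗ[μ] fun y => g (y, -η + ξ)) x ∂ν := by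
    have hg' : Measurable fun w : G × H => g (-w.1 + x, -w.2 + ξ) := by fun_prop
    exact lintegral_prod_symm' _ (hf.mul hg')
  have inner (ξ : H) : eLpNorm (fun x => (f ⋆ₗ[μ.prod ν] g) (x, ξ)) r₁ μ ≤
      ∫⁻ η, eLpNorm (fun x => f (x, η)) a₁ μ * eLpNorm (fun x => g (x, -η + ξ)) b₁ μ ∂ν := by
    have hc : Measurable fun w : G × H =>
        ((fun y => f (y, w.2)) ⋆ₗ[μ] fun y => g (y, -w.2 + ξ)) w.1 :=
      Measurable.lintegral_prod_right'
        (f := fun w : (G × H) × G => f (w.2, w.1.2) * g (-w.2 + w.1.1, -w.1.2 + ξ)) (by fun_prop)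
    simp only [fubini]
    exact (eLpNorm_lintegral_le (one_le_of_inv_add_inv ha₁ hb₁ h₁) hc).trans
      (lintegral_mono fun η => eLpNorm_lconvolution_le (f := fun x => f (x, η))
        (g := fun x => g (x, -η + ξ)) ha₁ hb₁ h₁ (by fun_prop) (by fun_prop))
  calc mixedELpNorm (f ⋆ₗ[μ.prod ν] g) r₁ r₂ μ ν
      ≤ eLpNorm ((fun η => eLpNorm (fun x => f (x, η)) a₁ μ) ⋆ₗ[ν]
          fun η => eLpNorm (fun x => g (x, η)) b₁ μ) r₂ ν := eLpNorm_mono_ennreal inner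
    _ ≤ _ := eLpNorm_lconvolution_le ha₂ hb₂ h₂
          (measurable_eLpNorm_prodMk hf a₁) (measurable_eLpNorm_prodMk hg b₁)

end Convolution

section MixedNorm

variable {α β : Type*} [MeasurableSpace α] [MeasurableSpace β] {μ : Measure α} {ν : Measure β}

theorem eLpNorm_const_mul_le {p c : ℝ≥0∞} (hc : c ≠ ∞) (f : α → ℝ≥0∞) :
    eLpNorm (fun x => c * f x) p μ ≤ c * eLpNorm f p μ := by
  lift c to ℝ≥0 using hc
  refine (eLpNorm_le_nnreal_smul_eLpNorm_of_ae_le_mul' (f := fun x => c * f x) (g := f) (c := c)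
    (.of_forall fun x => ?_) p).trans_eq ?_
  · simp
  · rfl

theorem eLpNorm_const_mul {p c : ℝ≥0∞} (hc : c ≠ ∞) (f : α → ℝ≥0∞) :
    eLpNorm (fun x => c * f x) p μ = c * eLpNorm f p μ := by
  rcases eq_or_ne c 0 with rfl | hc0
  · simp
  refine le_antisymm (eLpNorm_const_mul_le hc f) (ENNReal.mul_le_of_le_div' ?_)
  calc eLpNorm f p μ = eLpNorm (fun x => c⁻¹ * (c * f x)) p μ := by
        simp only [← mul_assoc, ENNReal.inv_mul_cancel hc0 hc, one_mul]
    _ ≤ c⁻¹ * eLpNorm (fun x => c * f x) p μ := eLpNorm_const_mul_le (ENNReal.inv_ne_top.2 hc0) _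
    _ = eLpNorm (fun x => c * f x) p μ / c := mul_comm _ _

theorem mixedELpNorm_mono {F G : α × β → ℝ≥0∞} {p q : ℝ≥0∞} (h : ∀ w, F w ≤ G w) :
    mixedELpNorm F p q μ ν ≤ mixedELpNorm G p q μ ν :=
  eLpNorm_mono_ennreal fun _ => eLpNorm_mono_ennreal fun _ => h _

theorem mixedELpNorm_const_mul_le {p q c : ℝ≥0∞} (hc : c ≠ ∞) (F : α × β → ℝ≥0∞) :
    mixedELpNorm (fun w => c * F w) p q μ ν ≤ c * mixedELpNorm F p q μ ν :=
  (eLpNorm_mono_ennreal fun _ => eLpNorm_const_mul_le hc _).trans (eLpNorm_const_mul_le hc _)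

theorem mixedELpNorm_mul {f : α → ℝ≥0∞} {h : β → ℝ≥0∞} {p : ℝ≥0∞} (hf : eLpNorm f p μ ≠ ∞)
    (hh : ∀ y, h y ≠ ∞) (q : ℝ≥0∞) :
    mixedELpNorm (fun w => f w.1 * h w.2) p q μ ν = eLpNorm f p μ * eLpNorm h q ν := by
  simp only [mixedELpNorm, mul_comm (f _), eLpNorm_const_mul (hh _)]
  simp only [mul_comm (h _), eLpNorm_const_mul hf]

theorem eLpNorm_rpow_div (f : α → ℝ≥0∞) {p q : ℝ≥0∞} (h0 : p ≠ 0) (ht : p ≠ ∞) :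
    eLpNorm (fun x => f x ^ p.toReal) (q / p) μ = eLpNorm f q μ ^ p.toReal := by
  have h := eLpNorm_enorm_rpow (p := q / p) (μ := μ) f (ENNReal.toReal_pos h0 ht)
  rwa [ENNReal.ofReal_toReal ht, ENNReal.div_mul_cancel h0 ht] at h

theorem mixedELpNorm_rpow_div (F : α × β → ℝ≥0∞) {p P Q : ℝ≥0∞} (h0 : p ≠ 0) (ht : p ≠ ∞) :
    mixedELpNorm (fun w => F w ^ p.toReal) (P / p) (Q / p) μ ν =
      mixedELpNorm F P Q μ ν ^ p.toReal := by
  simp only [mixedELpNorm, eLpNorm_rpow_div _ h0 ht]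

theorem mixedELpNorm_self [SFinite μ] [SFinite ν] {F : α × β → ℝ≥0∞} (hF : Measurable F)
    {p : ℝ≥0∞} (hp : p ≠ 0) : mixedELpNorm F p p μ ν = eLpNorm F p (μ.prod ν) := by
  unfold mixedELpNorm
  rcases eq_or_ne p ∞ with rfl | ht
  · refine eq_of_forall_ge_iff fun c => ?_
    simp only [eLpNorm_top_le_iff]
    rw [← Measure.prod_swap,
      ae_map_iff measurable_swap.aemeasurable (measurableSet_le hF measurable_const)]
    exact (Measure.ae_prod_iff_ae_ae
      (measurableSet_le (hF.comp measurable_swap) measurable_const)).symm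
  · rw [eLpNorm_eq_lintegral_rpow hp ht, eLpNorm_eq_lintegral_rpow hp ht,
      lintegral_prod_symm _ (hF.pow_const _).aemeasurable]
    simp only [eLpNorm_rpow_eq_lintegral hp ht]

theorem le_eLpNorm_top_of_continuous [TopologicalSpace α] [μ.IsOpenPosMeasure] {f : α → ℝ≥0∞}
    (hf : Continuous f) (x : α) : f x ≤ eLpNorm f ∞ μ := by
  by_contra! hlt
  have hnull : μ {y | eLpNorm f ∞ μ < f y} = 0 := by
    simpa only [ae_iff, not_le] using ae_le_eLpNorm_top f
  exact ((isOpen_lt continuous_const hf).measure_pos _ ⟨x, hlt⟩).ne' hnull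

theorem mixedELpNorm_comp_neg {G H : Type*} [MeasurableSpace G] [AddGroup G] [MeasurableNeg G]
    [MeasurableSpace H] [AddGroup H] [MeasurableNeg H] {μ : Measure G} [SFinite μ]
    [μ.IsNegInvariant] {ν : Measure H} [ν.IsNegInvariant] {F : G × H → ℝ≥0∞}
    (hF : Measurable F) (p q : ℝ≥0∞) :
    mixedELpNorm (fun w => F (-w)) p q μ ν = mixedELpNorm F p q μ ν := by
  have inner (ξ : H) :
      eLpNorm (fun x => F (-x, ξ)) p μ = eLpNorm (fun x => F (x, ξ)) p μ :=
    eLpNorm_comp_measurePreserving (hF.comp measurable_prodMk_right).aestronglyMeasurable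
      (Measure.measurePreserving_neg μ)
  calc mixedELpNorm (fun w => F (-w)) p q μ ν
      = eLpNorm ((fun ξ => eLpNorm (fun x => F (x, ξ)) p μ) ∘ Neg.neg) q ν := by
        unfold mixedELpNorm
        congr 1 with ξ
        exact inner (-ξ)
    _ = mixedELpNorm F p q μ ν :=
        eLpNorm_comp_measurePreserving (measurable_eLpNorm_prodMk hF p).aestronglyMeasurable
          (Measure.measurePreserving_neg ν)

end MixedNorm

section ProductEstimate

theorem div_inv_add_div_inv {p q p₁ p₂ : ℝ≥0∞} (h0 : p ≠ 0) (ht : p ≠ ∞)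
    (h : p₁⁻¹ + p₂⁻¹ = p⁻¹ + q⁻¹) : (p₁ / p)⁻¹ + (p₂ / p)⁻¹ = 1 + (q / p)⁻¹ := by
  have inv_div (r : ℝ≥0∞) : (r / p)⁻¹ = p * r⁻¹ := by
    rw [ENNReal.inv_div (Or.inl ht) (Or.inl h0), div_eq_mul_inv]
  rw [inv_div, inv_div, inv_div, ← mul_add, h, mul_add, ENNReal.mul_inv_cancel h0 ht]

theorem lintegral_mul_sub_add {G : Type*} [MeasurableSpace G] [AddCommGroup G] [MeasurableAdd G]
    {μ : Measure G} [μ.IsAddLeftInvariant] (A B : G → ℝ≥0∞) (a b : G) :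
    ∫⁻ z, A (z - a) * B (z + b) ∂μ = (B ⋆ₗ[μ] fun w => A (-w)) (a + b) := by
  rw [← lintegral_sub_right_eq_self _ b, lconvolution_def]
  refine lintegral_congr fun z => ?_
  rw [sub_add_cancel, mul_comm, neg_add, neg_neg, sub_sub, add_comm b, sub_eq_add_neg]

variable {E : Type*} [NormedAddCommGroup E] [InnerProductSpace ℝ E] [FiniteDimensional ℝ E]
  [MeasurableSpace E] [BorelSpace E]

theorem eLpNorm_toLp (f : WithLp 2 (E × E) → ℝ≥0∞) (p : ℝ≥0∞) :
    eLpNorm f p volume = eLpNorm (fun w : E × E => f (WithLp.toLp 2 w)) p volume := by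
  rw [← (WithLp.volume_preserving_toLp E E).map_eq]
  exact (MeasurableEquiv.toLp 2 (E × E)).measurableEmbedding.eLpNorm_map_measure

theorem lconvolution_toLp (f g : WithLp 2 (E × E) → ℝ≥0∞) (w : E × E) :
    (f ⋆ₗ g) (WithLp.toLp 2 w) =
      ((fun u => f (WithLp.toLp 2 u)) ⋆ₗ fun u => g (WithLp.toLp 2 u)) w :=
  ((WithLp.volume_preserving_toLp E E).lintegral_comp_emb
    (MeasurableEquiv.toLp 2 (E × E)).measurableEmbedding
    fun z => f z * g (-z + WithLp.toLp 2 w)).symm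

/- The `p`-th power of the inner norm is `(B ^ p ⋆ A(-·) ^ p) u`, so this is Young's inequality
with all exponents divided by `p`. -/
theorem eLpNorm_eLpNorm_mul_sub_add_le {A B : WithLp 2 (E × E) → ℝ≥0∞} (hA : Measurable A)
    (hB : Measurable B) {p q P₁ P₂ Q₁ Q₂ : ℝ≥0∞} (hp : p ≠ 0) (ht : p ≠ ∞) (hpq : p ≤ q)
    (hP₁ : p ≤ P₁) (hP₂ : p ≤ P₂) (hP : P₁⁻¹ + P₂⁻¹ = p⁻¹ + q⁻¹)
    (hQ₁ : p ≤ Q₁) (hQ₂ : p ≤ Q₂) (hQ : Q₁⁻¹ + Q₂⁻¹ = p⁻¹ + q⁻¹) :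
    eLpNorm (fun u : WithLp 2 (E × E) => eLpNorm
        (fun z => A (z - (1 / 2 : ℝ) • u) * B (z + (1 / 2 : ℝ) • u)) p volume) q volume ≤
      mixedELpNorm (fun w => A (WithLp.toLp 2 w)) P₁ Q₁ volume volume *
        mixedELpNorm (fun w => B (WithLp.toLp 2 w)) P₂ Q₂ volume volume := by
  have hp' := ENNReal.toReal_pos hp ht
  have one_le {r : ℝ≥0∞} (h : p ≤ r) : 1 ≤ r / p :=
    (ENNReal.le_div_iff_mul_le (Or.inl hp) (Or.inl ht)).2 (by rwa [one_mul])
  let a : E × E → ℝ≥0∞ := fun w => A (WithLp.toLp 2 w) ^ p.toReal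
  let b : E × E → ℝ≥0∞ := fun w => B (WithLp.toLp 2 w) ^ p.toReal
  have ha : Measurable a := (hA.comp (MeasurableEquiv.toLp 2 (E × E)).measurable).pow_const _
  have hb : Measurable b := (hB.comp (MeasurableEquiv.toLp 2 (E × E)).measurable).pow_const _
  have ha' : Measurable fun w => a (-w) := ha.comp measurable_neg
  have inner (u : WithLp 2 (E × E)) :
      eLpNorm (fun z => A (z - (1 / 2 : ℝ) • u) * B (z + (1 / 2 : ℝ) • u)) p volume ^ p.toReal =
        ((fun z => B z ^ p.toReal) ⋆ₗ fun z => A (-z) ^ p.toReal) u := by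
    simp only [eLpNorm_rpow_eq_lintegral hp ht, ENNReal.mul_rpow_of_nonneg _ _ hp'.le]
    rw [lintegral_mul_sub_add (fun z => A z ^ p.toReal) (fun z => B z ^ p.toReal), ← add_smul,
      add_halves, one_smul]
  rw [← ENNReal.rpow_le_rpow_iff hp', ← eLpNorm_rpow_div _ hp ht,
    ENNReal.mul_rpow_of_nonneg _ _ hp'.le]
  simp only [inner]
  calc eLpNorm ((fun z => B z ^ p.toReal) ⋆ₗ fun z => A (-z) ^ p.toReal) (q / p) volume
      = eLpNorm (b ⋆ₗ fun w => a (-w)) (q / p) volume := by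
        rw [eLpNorm_toLp]
        simp only [lconvolution_toLp]
        rfl
    _ = mixedELpNorm (b ⋆ₗ fun w => a (-w)) (q / p) (q / p) volume volume :=
        (mixedELpNorm_self (measurable_lconvolution _ hb ha')
          (one_pos.trans_le (one_le hpq)).ne').symm
    _ ≤ mixedELpNorm b (P₂ / p) (Q₂ / p) volume volume *
          mixedELpNorm (fun w => a (-w)) (P₁ / p) (Q₁ / p) volume volume :=
        mixedELpNorm_lconvolution_le (one_le hP₂) (one_le hP₁)
          (div_inv_add_div_inv hp ht ((add_comm _ _).trans hP)) (one_le hQ₂) (one_le hQ₁)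
          (div_inv_add_div_inv hp ht ((add_comm _ _).trans hQ)) hb ha'
    _ = _ := by
        rw [mixedELpNorm_comp_neg ha, mixedELpNorm_rpow_div _ hp ht,
          mixedELpNorm_rpow_div _ hp ht, mul_comm]

theorem eLpNorm_top_eLpNorm_top_mul_sub_add_le {A B : WithLp 2 (E × E) → ℝ≥0∞}
    (hA : Continuous A) (hB : Continuous B) :
    eLpNorm (fun u : WithLp 2 (E × E) => eLpNorm
        (fun z => A (z - (1 / 2 : ℝ) • u) * B (z + (1 / 2 : ℝ) • u)) ∞ volume) ∞ volume ≤
      mixedELpNorm (fun w => A (WithLp.toLp 2 w)) ∞ ∞ volume volume *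
        mixedELpNorm (fun w => B (WithLp.toLp 2 w)) ∞ ∞ volume volume := by
  have le_mixedELpNorm {F : WithLp 2 (E × E) → ℝ≥0∞} (hF : Continuous F)
      (z : WithLp 2 (E × E)) :
      F z ≤ mixedELpNorm (fun w => F (WithLp.toLp 2 w)) ∞ ∞ volume volume := by
    have hm : Measurable fun w => F (WithLp.toLp 2 w) :=
      hF.measurable.comp (MeasurableEquiv.toLp 2 (E × E)).measurable
    rw [mixedELpNorm_self hm ENNReal.top_ne_zero]
    exact (le_eLpNorm_top_of_continuous hF z).trans_eq (eLpNorm_toLp F ∞)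
  exact eLpNorm_top_le_iff.2 <| .of_forall fun u => eLpNorm_top_le_iff.2 <| .of_forall fun z =>
    mul_le_mul' (le_mixedELpNorm hA _) (le_mixedELpNorm hB _)

/-- The map `J (x, ξ) = (ξ, -x)` of phase space. -/
noncomputable def symplecticRotation (E : Type*) [NormedAddCommGroup E] [InnerProductSpace ℝ E] :
    WithLp 2 (E × E) ≃ₗᵢ[ℝ] WithLp 2 (E × E) :=
  (LinearIsometryEquiv.withLpProdComm 2 ℝ E E).trans
    (LinearIsometryEquiv.withLpProdCongr 2 (.refl ℝ E) (.neg ℝ))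

theorem eLpNorm_eLpNorm_mul_symplecticRotation_le {A B : WithLp 2 (E × E) → ℝ≥0∞}
    (hA : Continuous A) (hB : Continuous B) {p q P₁ P₂ Q₁ Q₂ : ℝ≥0∞} (hp : p ≠ 0) (hpq : p ≤ q)
    (hP₁ : p ≤ P₁) (hP₂ : p ≤ P₂) (hP : P₁⁻¹ + P₂⁻¹ = p⁻¹ + q⁻¹)
    (hQ₁ : p ≤ Q₁) (hQ₂ : p ≤ Q₂) (hQ : Q₁⁻¹ + Q₂⁻¹ = p⁻¹ + q⁻¹) :
    eLpNorm (fun ζ => eLpNorm (fun z => A (z - (1 / 2 : ℝ) • symplecticRotation E ζ) *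
        B (z + (1 / 2 : ℝ) • symplecticRotation E ζ)) p volume) q volume ≤
      mixedELpNorm (fun w => A (WithLp.toLp 2 w)) P₁ Q₁ volume volume *
        mixedELpNorm (fun w => B (WithLp.toLp 2 w)) P₂ Q₂ volume volume := by
  have hAB : Measurable fun w : WithLp 2 (E × E) × WithLp 2 (E × E) =>
      A (w.1 - (1 / 2 : ℝ) • w.2) * B (w.1 + (1 / 2 : ℝ) • w.2) :=
    (hA.measurable.comp (by fun_prop)).mul (hB.measurable.comp (by fun_prop))
  refine (eLpNorm_comp_measurePreserving
    (measurable_eLpNorm_prodMk hAB p).aestronglyMeasurable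
    (symplecticRotation E).measurePreserving).trans_le ?_
  rcases eq_or_ne p ∞ with rfl | ht
  · rw [top_le_iff] at hpq hP₁ hP₂ hQ₁ hQ₂
    rw [hpq, hP₁, hP₂, hQ₁, hQ₂]
    exact eLpNorm_top_eLpNorm_top_mul_sub_add_le hA hB
  · exact eLpNorm_eLpNorm_mul_sub_add_le hA.measurable hB.measurable hp ht hpq hP₁ hP₂ hP
      hQ₁ hQ₂ hQ

end ProductEstimate

/-! ### Schwartz functions on product spaces and tempered distributions -/

section Tensor

variable {E F : Type*} [NormedAddCommGroup E] [NormedSpace ℝ E]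
  [NormedAddCommGroup F] [NormedSpace ℝ F]

theorem norm_iteratedFDeriv_comp_le_of_norm_le_one (φ : 𝓢(F, ℂ)) (L : E →L[ℝ] F) (hL : ‖L‖ ≤ 1)
    (n : ℕ) (z : E) :
    ‖iteratedFDeriv ℝ n (fun z => φ (L z)) z‖ ≤ ‖iteratedFDeriv ℝ n φ (L z)‖ := by
  have comp_right : iteratedFDeriv ℝ n (φ ∘ L) z =
      (iteratedFDeriv ℝ n φ (L z)).compContinuousLinearMap fun _ => L :=
    L.iteratedFDeriv_comp_right (φ.smooth n) z le_rfl
  calc ‖iteratedFDeriv ℝ n (φ ∘ L) z‖ ≤ ‖iteratedFDeriv ℝ n φ (L z)‖ * ∏ _ : Fin n, ‖L‖ := by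
        rw [comp_right]
        exact ContinuousMultilinearMap.norm_compContinuousLinearMap_le _ _
    _ ≤ _ := mul_le_of_le_one_right (norm_nonneg _)
        (Finset.prod_le_one (fun _ _ => norm_nonneg _) fun _ _ => hL)

theorem norm_pow_mul_iteratedFDeriv_mul_le (φ : 𝓢(E, ℂ)) (ψ : 𝓢(F, ℂ)) (k i j : ℕ) (z : E × F) :
    ‖z‖ ^ k * (‖iteratedFDeriv ℝ i φ z.1‖ * ‖iteratedFDeriv ℝ j ψ z.2‖) ≤
      SchwartzMap.seminorm ℝ k i φ * SchwartzMap.seminorm ℝ 0 j ψ +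
        SchwartzMap.seminorm ℝ 0 i φ * SchwartzMap.seminorm ℝ k j ψ := by
  have norm_pow_le : ‖z‖ ^ k ≤ ‖z.1‖ ^ k + ‖z.2‖ ^ k := by
    rw [Prod.norm_def]
    rcases max_choice ‖z.1‖ ‖z.2‖ with h | h <;> rw [h] <;> simp
  have h₁ := φ.le_seminorm ℝ k i z.1
  have h₂ := φ.norm_iteratedFDeriv_le_seminorm ℝ i z.1
  have h₃ := ψ.le_seminorm ℝ k j z.2
  have h₄ := ψ.norm_iteratedFDeriv_le_seminorm ℝ j z.2
  calc ‖z‖ ^ k * (‖iteratedFDeriv ℝ i φ z.1‖ * ‖iteratedFDeriv ℝ j ψ z.2‖)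
      ≤ (‖z.1‖ ^ k + ‖z.2‖ ^ k) *
          (‖iteratedFDeriv ℝ i φ z.1‖ * ‖iteratedFDeriv ℝ j ψ z.2‖) := by gcongr
    _ = ‖z.1‖ ^ k * ‖iteratedFDeriv ℝ i φ z.1‖ * ‖iteratedFDeriv ℝ j ψ z.2‖ +
          ‖iteratedFDeriv ℝ i φ z.1‖ * (‖z.2‖ ^ k * ‖iteratedFDeriv ℝ j ψ z.2‖) := by ring
    _ ≤ _ := by gcongr

/-- The tensor product `φ ⊗ ψ` of two Schwartz functions. -/
noncomputable def tensor (φ : 𝓢(E, ℂ)) (ψ : 𝓢(F, ℂ)) : 𝓢(E × F, ℂ) where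
  toFun z := φ z.1 * ψ z.2
  smooth' := ((φ.smooth ⊤).comp contDiff_fst).mul ((ψ.smooth ⊤).comp contDiff_snd)
  decay' k n := by
    refine ⟨∑ i ∈ Finset.range (n + 1), (n.choose i : ℝ) *
      (SchwartzMap.seminorm ℝ k i φ * SchwartzMap.seminorm ℝ 0 (n - i) ψ +
        SchwartzMap.seminorm ℝ 0 i φ * SchwartzMap.seminorm ℝ k (n - i) ψ), fun z => ?_⟩
    calc ‖z‖ ^ k * ‖iteratedFDeriv ℝ n (fun z : E × F => φ z.1 * ψ z.2) z‖
        ≤ ‖z‖ ^ k * ∑ i ∈ Finset.range (n + 1), (n.choose i : ℝ) *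
            ‖iteratedFDeriv ℝ i (fun z : E × F => φ z.1) z‖ *
            ‖iteratedFDeriv ℝ (n - i) (fun z : E × F => ψ z.2) z‖ := by
          gcongr
          exact norm_iteratedFDeriv_mul_le ((φ.smooth n).comp contDiff_fst)
            ((ψ.smooth n).comp contDiff_snd) z le_rfl
      _ ≤ ‖z‖ ^ k * ∑ i ∈ Finset.range (n + 1), (n.choose i : ℝ) *
            ‖iteratedFDeriv ℝ i φ z.1‖ * ‖iteratedFDeriv ℝ (n - i) ψ z.2‖ := by
          gcongr with i
          · exact norm_iteratedFDeriv_comp_le_of_norm_le_one φ (.fst ℝ E F)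
              (ContinuousLinearMap.norm_fst_le ℝ E F) i z
          · exact norm_iteratedFDeriv_comp_le_of_norm_le_one ψ (.snd ℝ E F)
              (ContinuousLinearMap.norm_snd_le ℝ E F) (n - i) z
      _ = ∑ i ∈ Finset.range (n + 1), (n.choose i : ℝ) *
            (‖z‖ ^ k * (‖iteratedFDeriv ℝ i φ z.1‖ * ‖iteratedFDeriv ℝ (n - i) ψ z.2‖)) := by
          rw [Finset.mul_sum]
          exact Finset.sum_congr rfl fun i _ => by ring
      _ ≤ _ := by
          gcongr with i
          exact norm_pow_mul_iteratedFDeriv_mul_le φ ψ k i (n - i) z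

@[simp]
theorem tensor_apply (φ : 𝓢(E, ℂ)) (ψ : 𝓢(F, ℂ)) (z : E × F) :
    tensor φ ψ z = φ z.1 * ψ z.2 := rfl

end Tensor

section Character

variable {E : Type*} [NormedAddCommGroup E] [InnerProductSpace ℝ E]
  {V : Type*} [NormedAddCommGroup V] [NormedSpace ℝ V]

theorem character_comp_hasTemperateGrowth (L M : V →L[ℝ] E) :
    (fun w => character (L w) (M w)).HasTemperateGrowth := by
  have inner_growth : (fun w => inner ℝ (L w) (M w)).HasTemperateGrowth :=
    (innerSL ℝ (E := E)).bilinear_hasTemperateGrowth L.hasTemperateGrowth M.hasTemperateGrowth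
  convert (character_hasTemperateGrowth (1 : ℝ)).comp inner_growth using 1
  funext w
  simp [character]

theorem character_add_left (ξ η t : E) : character (ξ + η) t = character ξ t * character η t := by
  simp only [character, inner_add_left, ← Complex.exp_add]
  congr 1
  push_cast
  ring

theorem character_add_right (ξ s t : E) : character ξ (s + t) = character ξ s * character ξ t := by
  simp only [character, inner_add_right, ← Complex.exp_add]
  congr 1
  push_cast
  ring

theorem character_comm (ξ t : E) : character ξ t = character t ξ := by
  simp only [character, real_inner_comm]

theorem character_neg_left (ξ t : E) : character (-ξ) t = (starRingEnd ℂ) (character ξ t) := by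
  simp only [character, inner_neg_left, ← Complex.exp_conj]
  congr 1
  simp [map_ofNat (starRingEnd ℂ) 2]

theorem character_neg_right (ξ t : E) : character ξ (-t) = (starRingEnd ℂ) (character ξ t) := by
  rw [character_comm, character_neg_left, character_comm]

end Character

section Fubini

variable {W F : Type*} [NormedAddCommGroup W] [NormedSpace ℝ W]
  [NormedAddCommGroup F] [NormedSpace ℝ F]

theorem continuous_slice (Ψ : 𝓢(W × F, ℂ)) : Continuous fun w => slice w Ψ := by
  rw [continuous_iff_continuousAt]
  intro w
  rw [ContinuousAt, (schwartz_withSeminorms ℂ F ℂ).tendsto_nhds]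
  rintro ⟨k, n⟩ ε hε
  obtain ⟨C, -, hrem⟩ := translation_remainder Ψ k n
  have hlim : Filter.Tendsto (fun v : W => C * ‖v - w‖ ^ 2 +
      ‖v - w‖ * SchwartzMap.seminorm ℂ k (n + 1) Ψ) (nhds w) (nhds 0) := by
    have hcont : Continuous fun v : W => C * ‖v - w‖ ^ 2 +
      ‖v - w‖ * SchwartzMap.seminorm ℂ k (n + 1) Ψ := by fun_prop
    simpa using hcont.tendsto w
  filter_upwards [hlim.eventually_lt_const hε, Metric.closedBall_mem_nhds w one_pos] with v hv hvw
  let a : W × F := (v - w, 0)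
  have ha : ‖a‖ = ‖v - w‖ := by simp [a, Prod.norm_def]
  have ha₁ : ‖a‖ ≤ 1 := by simpa [ha, dist_eq_norm] using hvw
  have slice_sub : slice v Ψ - slice w Ψ = slice w (compSubConstCLM ℂ (-a) Ψ - Ψ) := by
    rw [map_sub, ← slice_add, add_sub_cancel]
  calc SchwartzMap.seminorm ℂ k n (slice v Ψ - slice w Ψ)
      ≤ SchwartzMap.seminorm ℂ k n (compSubConstCLM ℂ (-a) Ψ - Ψ) := by
        rw [slice_sub]
        simpa using norm_pow_mul_seminorm_slice_le 0 k n w (compSubConstCLM ℂ (-a) Ψ - Ψ)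
    _ = SchwartzMap.seminorm ℂ k n
          ((compSubConstCLM ℂ (-a) Ψ - Ψ - ∂_{a} Ψ) + ∂_{a} Ψ) := by rw [sub_add_cancel]
    _ ≤ C * ‖a‖ ^ 2 + ‖a‖ * SchwartzMap.seminorm ℂ k (n + 1) Ψ :=
        (map_add_le_add _ _ _).trans (add_le_add (hrem a ha₁) (seminorm_lineDeriv_le Ψ a k n))
    _ < ε := by rwa [ha]

/-- The Banach space of bounded continuous functions with values in `n`-linear forms, in which the
`n`-th derivatives of Schwartz functions live. It is a type synonym so that its real scalar
multiplication is the restriction of the complex one. -/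
def DerivSpace (F : Type*) [NormedAddCommGroup F] [NormedSpace ℝ F] (n : ℕ) : Type _ :=
  F →ᵇ F [×n]→L[ℝ] ℂ

noncomputable instance (n : ℕ) : NormedAddCommGroup (DerivSpace F n) :=
  inferInstanceAs (NormedAddCommGroup (F →ᵇ F [×n]→L[ℝ] ℂ))

noncomputable instance (n : ℕ) : NormedSpace ℂ (DerivSpace F n) :=
  inferInstanceAs (NormedSpace ℂ (F →ᵇ F [×n]→L[ℝ] ℂ))

instance (n : ℕ) : CompleteSpace (DerivSpace F n) :=
  inferInstanceAs (CompleteSpace (F →ᵇ F [×n]→L[ℝ] ℂ))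

/-- Evaluation of a function with values in `n`-linear forms at a point and `n` vectors. These
functionals separate points, so that identities in `DerivSpace F n` can be checked on them. -/
noncomputable def derivEval {n : ℕ} (t : F) (m : Fin n → F) : DerivSpace F n →L[ℂ] ℂ :=
  LinearMap.mkContinuous
    { toFun := fun u : F →ᵇ F [×n]→L[ℝ] ℂ => u t m
      map_add' := fun u v => rfl
      map_smul' := fun c u => rfl } (∏ i, ‖m i‖) fun u => by
    rw [mul_comm]
    exact (((show F →ᵇ F [×n]→L[ℝ] ℂ from u) t).le_opNorm m).trans
      (mul_le_mul_of_nonneg_right (BoundedContinuousFunction.norm_coe_le_norm _ t) (by positivity))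

theorem derivSpace_ext {n : ℕ} {u v : DerivSpace F n}
    (h : ∀ t m, derivEval t m u = derivEval t m v) :
    u = v :=
  BoundedContinuousFunction.ext fun t => ContinuousMultilinearMap.ext fun m => h t m

/-- The weighted `n`-th derivative `t ↦ ‖t‖ ^ k • D^n φ(t)` of a Schwartz function; its sup norm is
the seminorm of `φ` of index `(k, n)`. -/
noncomputable def weightedDerivFun (k n : ℕ) (φ : 𝓢(F, ℂ)) : DerivSpace F n :=
  BoundedContinuousFunction.ofNormedAddCommGroup
    (fun t => (‖t‖ ^ k) • iteratedFDeriv ℝ n φ t)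
    ((continuous_norm.pow k).smul ((φ.smooth n).continuous_iteratedFDeriv le_rfl))
    (SchwartzMap.seminorm ℂ k n φ) fun t => by
      rw [norm_smul, norm_pow, norm_norm]
      exact φ.le_seminorm ℂ k n t

theorem derivEval_weightedDerivFun (k n : ℕ) (φ : 𝓢(F, ℂ)) (t : F) (m : Fin n → F) :
    derivEval t m (weightedDerivFun k n φ) = (‖t‖ ^ k : ℝ) • (∂^{m} φ) t := by
  rw [iteratedLineDerivOp_eq_iteratedFDeriv]
  rfl

theorem norm_weightedDerivFun_le (k n : ℕ) (φ : 𝓢(F, ℂ)) :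
    ‖weightedDerivFun k n φ‖ ≤ SchwartzMap.seminorm ℂ k n φ :=
  BoundedContinuousFunction.norm_ofNormedAddCommGroup_le _ (apply_nonneg _ _) _

/-- The weighted `n`-th derivative `weightedDerivFun k n` as a continuous linear map. -/
noncomputable def weightedDeriv (F : Type*) [NormedAddCommGroup F] [NormedSpace ℝ F] (k n : ℕ) :
    𝓢(F, ℂ) →L[ℂ] DerivSpace F n :=
  letI : NormedSpace ℝ (DerivSpace F n) := NormedSpace.restrictScalars ℝ ℂ _
  mkCLMtoNormedSpace (σ := RingHom.id ℂ) (weightedDerivFun k n)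
    (fun φ ψ => derivSpace_ext fun t m => by
      simp only [map_add, derivEval_weightedDerivFun, LineDeriv.iteratedLineDerivOp_add, add_apply,
        smul_add])
    (fun c φ => derivSpace_ext fun t m => by
      simp only [map_smul, derivEval_weightedDerivFun, LineDeriv.iteratedLineDerivOp_smul,
        smul_apply, RingHom.id_apply, smul_comm c])
    ⟨{(k, n)}, 1, zero_le_one, fun φ => by
      rw [one_mul, Finset.sup_singleton]
      exact norm_weightedDerivFun_le k n φ⟩

theorem derivEval_weightedDeriv (k n : ℕ) (φ : 𝓢(F, ℂ)) (t : F) (m : Fin n → F) :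
    derivEval t m (weightedDeriv F k n φ) = (‖t‖ ^ k : ℝ) • (∂^{m} φ) t :=
  derivEval_weightedDerivFun k n φ t m

theorem seminorm_le_norm_weightedDeriv (k n : ℕ) (φ : 𝓢(F, ℂ)) :
    SchwartzMap.seminorm ℂ k n φ ≤ ‖weightedDeriv F k n φ‖ := by
  refine seminorm_le_bound ℂ k n φ (norm_nonneg (weightedDeriv F k n φ)) fun t => ?_
  have norm_apply_le : ‖(‖t‖ ^ k) • iteratedFDeriv ℝ n φ t‖ ≤ ‖weightedDeriv F k n φ‖ :=
    BoundedContinuousFunction.norm_coe_le_norm (weightedDeriv F k n φ : F →ᵇ F [×n]→L[ℝ] ℂ) t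
  rwa [norm_smul, norm_pow, norm_norm] at norm_apply_le

/-- The finitely many weighted derivatives with indices in `s`, taken together. They map `𝓢(F, ℂ)`
to a Banach space, where Bochner integrals are available. -/
noncomputable def weightedDerivs (F : Type*) [NormedAddCommGroup F] [NormedSpace ℝ F]
    (s : Finset (ℕ × ℕ)) : 𝓢(F, ℂ) →L[ℂ] (Π i : s, DerivSpace F i.1.2) :=
  ContinuousLinearMap.pi fun i => weightedDeriv F i.1.1 i.1.2

theorem injective_weightedDerivs {s : Finset (ℕ × ℕ)} (hs : (0, 0) ∈ s) :
    Function.Injective (weightedDerivs F s) := by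
  intro φ ψ h
  ext t
  have eval_eq : derivEval t 0 (weightedDeriv F 0 0 φ) = derivEval t 0 (weightedDeriv F 0 0 ψ) :=
    congrArg (derivEval t 0) (congrFun h ⟨(0, 0), hs⟩)
  simpa [derivEval_weightedDeriv] using eval_eq

theorem exists_norm_apply_le_norm_weightedDerivs (f : 𝓢'(F, ℂ)) :
    ∃ s : Finset (ℕ × ℕ), (0, 0) ∈ s ∧ ∃ C : ℝ, ∀ φ, ‖f φ‖ ≤ C * ‖weightedDerivs F s φ‖ := by
  obtain ⟨s, C, -, hf⟩ := Seminorm.bound_of_continuous (schwartz_withSeminorms ℂ F ℂ)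
    ((normSeminorm ℂ ℂ).comp (f : 𝓢(F, ℂ) →ₗ[ℂ] ℂ)) (continuous_norm.comp (map_continuous f))
  refine ⟨insert (0, 0) s, Finset.mem_insert_self _ _, C, fun φ => (hf φ).trans
    (mul_le_mul_of_nonneg_left (Seminorm.finset_sup_apply_le (norm_nonneg _) fun i hi => ?_) C.2)⟩
  exact (seminorm_le_norm_weightedDeriv i.1 i.2 φ).trans
    (norm_le_pi_norm (weightedDerivs F (insert (0, 0) s) φ) ⟨i, Finset.mem_insert_of_mem hi⟩)

theorem hasDerivAt_line (φ : 𝓢(F, ℂ)) (t a : F) (r : ℝ) :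
    HasDerivAt (fun r : ℝ => φ (t + r • a)) ((∂_{a} φ) (t + r • a)) r := by
  rw [lineDerivOp_apply_eq_fderiv]
  have line_deriv : HasDerivAt (fun r : ℝ => t + r • a) a r := by
    simpa using ((hasDerivAt_id r).smul_const a).const_add t
  exact (φ.hasFDerivAt (t + r • a)).comp_hasDerivAt r line_deriv

theorem slice_lineDeriv (w : W) (a : F) (Ψ : 𝓢(W × F, ℂ)) :
    slice w (∂_{((0 : W), a)} Ψ) = ∂_{a} (slice w Ψ) := by
  ext t
  have slice_deriv := hasDerivAt_line (slice w Ψ) t a 0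
  have total_deriv := hasDerivAt_line Ψ (w, t) (0, a) 0
  have line_eq : (fun r : ℝ => Ψ ((w, t) + r • ((0 : W), a))) = fun r => slice w Ψ (t + r • a) := by
    funext r
    simp
  rw [line_eq] at total_deriv
  simpa using total_deriv.unique slice_deriv

theorem slice_iteratedLineDeriv (w : W) {n : ℕ} (m : Fin n → F) (Ψ : 𝓢(W × F, ℂ)) :
    slice w (∂^{fun i => ((0 : W), m i)} Ψ) = ∂^{m} (slice w Ψ) := by
  induction n with
  | zero => simp
  | succ n ih =>
    rw [LineDeriv.iteratedLineDerivOp_succ_left, LineDeriv.iteratedLineDerivOp_succ_left,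
      slice_lineDeriv]
    congr 1
    exact ih (Fin.tail m)

theorem exists_norm_pow_mul_norm_clm_slice_le {B : Type*} [NormedAddCommGroup B]
    [NormedSpace ℂ B] (L : 𝓢(F, ℂ) →L[ℂ] B) (Ψ : 𝓢(W × F, ℂ)) (j : ℕ) :
    ∃ C, ∀ w, ‖w‖ ^ j * ‖L (slice w Ψ)‖ ≤ C := by
  obtain ⟨s, C, -, h⟩ := Seminorm.bound_of_continuous (schwartz_withSeminorms ℂ F ℂ)
    ((normSeminorm ℂ B).comp (L : 𝓢(F, ℂ) →ₗ[ℂ] B)) (continuous_norm.comp L.continuous)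
  refine ⟨C * ∑ i ∈ s, SchwartzMap.seminorm ℂ (j + i.1) i.2 Ψ, fun w => ?_⟩
  have norm_le : ‖L (slice w Ψ)‖ ≤ C * ∑ i ∈ s, SchwartzMap.seminorm ℂ i.1 i.2 (slice w Ψ) := by
    refine (h _).trans (mul_le_mul_of_nonneg_left ?_ C.2)
    exact (Seminorm.finset_sup_le_sum (schwartzSeminormFamily ℂ F ℂ) s (slice w Ψ)).trans_eq
      (sum_apply _ _ _)
  calc ‖w‖ ^ j * ‖L (slice w Ψ)‖
      ≤ ‖w‖ ^ j * (C * ∑ i ∈ s, SchwartzMap.seminorm ℂ i.1 i.2 (slice w Ψ)) := by gcongr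
    _ = C * ∑ i ∈ s, ‖w‖ ^ j * SchwartzMap.seminorm ℂ i.1 i.2 (slice w Ψ) := by
        rw [← Finset.mul_sum]
        ring
    _ ≤ _ := by
        gcongr with i
        exact norm_pow_mul_seminorm_slice_le j i.1 i.2 w Ψ

variable [MeasurableSpace W] [BorelSpace W] [SecondCountableTopology W] {μ : Measure W}
  [μ.HasTemperateGrowth]

theorem integrable_clm_slice {B : Type*} [NormedAddCommGroup B] [NormedSpace ℂ B]
    (L : 𝓢(F, ℂ) →L[ℂ] B) (Ψ : 𝓢(W × F, ℂ)) : Integrable (fun w => L (slice w Ψ)) μ := by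
  obtain ⟨C₀, hC₀⟩ := exists_norm_pow_mul_norm_clm_slice_le L Ψ 0
  obtain ⟨C, hC⟩ := exists_norm_pow_mul_norm_clm_slice_le L Ψ (0 + μ.integrablePower)
  have hm : AEStronglyMeasurable (fun w => L (slice w Ψ)) μ :=
    (L.continuous.comp (continuous_slice Ψ)).aestronglyMeasurable
  rw [← integrable_norm_iff hm]
  simpa using integrable_of_le_of_pow_mul_le (k := 0) (fun w => by simpa using hC₀ w) hC hm

theorem integrable_slice_left (Ψ : 𝓢(W × F, ℂ)) (t : F) : Integrable (fun w => Ψ (w, t)) μ :=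
  (integrable_clm_slice ((BoundedContinuousFunction.evalCLM ℂ t) ∘L
    toBoundedContinuousFunctionCLM ℂ F ℂ) Ψ).congr (.of_forall fun w => slice_apply w Ψ t)

theorem lineDeriv_integral_slice (Ψ : 𝓢(W × F, ℂ)) (Θ : 𝓢(F, ℂ))
    (h : ∀ t, Θ t = ∫ w, Ψ (w, t) ∂μ) (a t : F) :
    (∂_{a} Θ) t = ∫ w, (∂_{((0 : W), a)} Ψ) (w, t) ∂μ := by
  let T := toBoundedContinuousFunctionCLM ℂ F ℂ
  have hasDerivAt_integral := (hasDerivAt_integral_of_dominated_loc_of_deriv_le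
    (μ := μ) (𝕜 := ℝ) (x₀ := 0)
    (F := fun r w => Ψ (w, t + r • a)) (F' := fun r w => (∂_{((0 : W), a)} Ψ) (w, t + r • a))
    (s := Set.univ) (bound := fun w => ‖T (slice w (∂_{((0 : W), a)} Ψ))‖) Filter.univ_mem
    (.of_forall fun r => (integrable_slice_left _ _).aestronglyMeasurable)
    (integrable_slice_left _ _) (integrable_slice_left _ _).aestronglyMeasurable
    (.of_forall fun w r _ => ?bound) (integrable_clm_slice T _).norm
    (.of_forall fun w r _ => ?deriv)).2
  case bound =>
    have norm_apply_le := (T (slice w (∂_{((0 : W), a)} Ψ))).norm_coe_le_norm (t + r • a)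
    simpa [T] using norm_apply_le
  case deriv =>
    have hasDerivAt_slice := hasDerivAt_line (slice w Ψ) t a r
    rw [← slice_lineDeriv] at hasDerivAt_slice
    simpa using hasDerivAt_slice
  have hasDerivAt_Θ := hasDerivAt_line Θ t a 0
  simp only [h] at hasDerivAt_Θ
  simpa using hasDerivAt_Θ.unique hasDerivAt_integral

theorem iteratedLineDeriv_integral_slice (Ψ : 𝓢(W × F, ℂ)) (Θ : 𝓢(F, ℂ))
    (h : ∀ t, Θ t = ∫ w, Ψ (w, t) ∂μ) {n : ℕ} (m : Fin n → F) (t : F) :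
    (∂^{m} Θ) t = ∫ w, (∂^{m} (slice w Ψ)) t ∂μ := by
  simp only [← slice_iteratedLineDeriv, slice_apply]
  induction n generalizing t with
  | zero => simpa using h t
  | succ n ih =>
    simp only [LineDeriv.iteratedLineDerivOp_succ_left]
    exact lineDeriv_integral_slice _ _ (fun t => ih (Fin.tail m) t) (m 0) t

theorem weightedDerivs_integral_slice (s : Finset (ℕ × ℕ)) (Ψ : 𝓢(W × F, ℂ)) (Θ : 𝓢(F, ℂ))
    (h : ∀ t, Θ t = ∫ w, Ψ (w, t) ∂μ) :
    weightedDerivs F s Θ = ∫ w, weightedDerivs F s (slice w Ψ) ∂μ := by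
  funext i
  refine derivSpace_ext fun t m => ?_
  let ev : (Π i : s, DerivSpace F i.1.2) →L[ℂ] ℂ := derivEval t m ∘L ContinuousLinearMap.proj i
  have ev_weightedDerivs (φ : 𝓢(F, ℂ)) :
      ev (weightedDerivs F s φ) = (‖t‖ ^ i.1.1 : ℝ) • (∂^{m} φ) t :=
    derivEval_weightedDeriv i.1.1 i.1.2 φ t m
  calc ev (weightedDerivs F s Θ)
      = ∫ w, ev (weightedDerivs F s (slice w Ψ)) ∂μ := by
        simp only [ev_weightedDerivs]
        rw [integral_smul, iteratedLineDeriv_integral_slice Ψ Θ h]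
    _ = ev (∫ w, weightedDerivs F s (slice w Ψ) ∂μ) :=
        ev.integral_comp_comm (integrable_clm_slice (weightedDerivs F s) Ψ)

theorem exists_strongDual_apply_eq_of_norm_le {V B : Type*} [AddCommGroup V] [Module ℂ V]
    [NormedAddCommGroup B] [NormedSpace ℂ B] {L : V →ₗ[ℂ] B} (hL : Function.Injective L)
    {f : V →ₗ[ℂ] ℂ} {C : ℝ} (h : ∀ v, ‖f v‖ ≤ C * ‖L v‖) :
    ∃ G : StrongDual ℂ B, ∀ v, G (L v) = f v := by
  let e := LinearEquiv.ofInjective L hL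
  let f₀ : StrongDual ℂ (LinearMap.range L) :=
    LinearMap.mkContinuous (f ∘ₗ e.symm.toLinearMap) C fun x => by
      obtain ⟨v, rfl⟩ := e.surjective x
      simpa [e] using h v
  obtain ⟨G, hG, -⟩ := exists_extension_norm_eq _ f₀
  refine ⟨G, fun v => (hG (e v)).trans ?_⟩
  change f (e.symm (e v)) = f v
  rw [e.symm_apply_apply]

/- By Hahn-Banach, `f` factors through finitely many weighted derivatives, that is, through a Banach
space, and there it commutes with the Bochner integral. -/
theorem distribution_integral_slice (f : 𝓢'(F, ℂ)) (Ψ : 𝓢(W × F, ℂ)) (Θ : 𝓢(F, ℂ))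
    (h : ∀ t, Θ t = ∫ w, Ψ (w, t) ∂μ) : f Θ = ∫ w, f (slice w Ψ) ∂μ := by
  obtain ⟨s, hs, C, hC⟩ := exists_norm_apply_le_norm_weightedDerivs f
  obtain ⟨G, hG⟩ : ∃ G : StrongDual ℂ (Π i : s, DerivSpace F i.1.2),
      ∀ φ, G (weightedDerivs F s φ) = f φ :=
    exists_strongDual_apply_eq_of_norm_le (L := (weightedDerivs F s).toLinearMap)
      (f := (f : 𝓢(F, ℂ) →ₗ[ℂ] ℂ)) (injective_weightedDerivs hs) hC
  calc f Θ = G (∫ w, weightedDerivs F s (slice w Ψ) ∂μ) := by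
        rw [← hG, weightedDerivs_integral_slice s Ψ Θ h]
    _ = ∫ w, f (slice w Ψ) ∂μ := by
        rw [← G.integral_comp_comm (integrable_clm_slice (weightedDerivs F s) Ψ)]
        simp only [hG]

end Fubini

/-! ### Continuity and change of window for the short-time Fourier transform -/

section Window

variable {E : Type*} [NormedAddCommGroup E] [InnerProductSpace ℝ E]

/-- The family `(w, t) ↦ A w • conjShift g w.1 w.2 t` of time-frequency shifts of `conj g` with
Schwartz coefficients, as a Schwartz function: this makes `w ↦ A w * stft g f w.1 w.2` the image of
its slices under `f`. -/
noncomputable def shiftFamily (g : 𝓢(E, ℂ)) (A : 𝓢(E × E, ℂ)) : 𝓢((E × E) × E, ℂ) :=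
  smulLeftCLM ℂ (fun z : (E × E) × E => character z.1.2 z.2)
    (compCLMOfContinuousLinearEquiv ℂ
      (ContinuousLinearEquiv.skewProd (.refl ℝ (E × E)) (.refl ℝ E) (-.fst ℝ E E))
      (tensor A (conjSchwartz g)))

theorem shiftFamily_apply (g : 𝓢(E, ℂ)) (A : 𝓢(E × E, ℂ)) (w : E × E) (t : E) :
    shiftFamily g A (w, t) = A w * conjShift g w.1 w.2 t := by
  have htemperate : (fun z : (E × E) × E => character z.1.2 z.2).HasTemperateGrowth :=
    character_comp_hasTemperateGrowth
      (ContinuousLinearMap.snd ℝ E E ∘L ContinuousLinearMap.fst ℝ (E × E) E)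
      (ContinuousLinearMap.snd ℝ (E × E) E)
  rw [shiftFamily, smulLeftCLM_apply_apply htemperate, conjShift_apply]
  change character w.2 t * (A w * (starRingEnd ℂ) (g (t + -w.1))) = _
  rw [← sub_eq_add_neg]
  ring

theorem slice_shiftFamily (g : 𝓢(E, ℂ)) (A : 𝓢(E × E, ℂ)) (w : E × E) :
    slice w (shiftFamily g A) = A w • conjShift g w.1 w.2 := by
  ext t
  rw [slice_apply, shiftFamily_apply, smul_apply, smul_eq_mul]

theorem distribution_slice_shiftFamily (g : 𝓢(E, ℂ)) (A : 𝓢(E × E, ℂ)) (f : 𝓢'(E, ℂ)) (w : E × E) :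
    f (slice w (shiftFamily g A)) = A w * stft g f w.1 w.2 := by
  rw [slice_shiftFamily, map_smul, smul_eq_mul]
  rfl

/-- The Schwartz function `(y, s) ↦ k s * g (s - y)`, whose partial inverse Fourier transform is
`crossKernel g k`. -/
noncomputable def windowProduct (g k : 𝓢(E, ℂ)) : 𝓢(E × E, ℂ) :=
  compCLMOfContinuousLinearEquiv ℂ ((ContinuousLinearEquiv.prodComm ℝ E E).trans
    (ContinuousLinearEquiv.skewProd (.refl ℝ E) (.neg ℝ) (.id ℝ E))) (tensor k g)

theorem slice_windowProduct (g k : 𝓢(E, ℂ)) (y s : E) :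
    slice y (windowProduct g k) s = k s * g (s - y) := by
  rw [slice_apply, ← neg_add_eq_sub]
  rfl

variable [FiniteDimensional ℝ E]

/- Near a given point, multiply by a bump function and use the continuity of `f`. -/
theorem continuous_stft (g : 𝓢(E, ℂ)) (f : 𝓢'(E, ℂ)) :
    Continuous fun w : E × E => stft g f w.1 w.2 := by
  rw [continuous_iff_continuousAt]
  intro w₀
  let b : ContDiffBump w₀ := default
  let A : 𝓢(E × E, ℂ) := HasCompactSupport.toSchwartzMap (f := fun w => (b w : ℂ))
    (b.hasCompactSupport.comp_left (g := fun r : ℝ => (r : ℂ)) (by simp))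
    (Complex.ofRealCLM.contDiff.comp b.contDiff)
  have hA : A w₀ ≠ 0 := by
    change ((b w₀ : ℝ) : ℂ) ≠ 0
    exact_mod_cast (b.pos_of_mem_ball (Metric.mem_ball_self b.rOut_pos)).ne'
  have hcont : ContinuousAt (fun w => f (slice w (shiftFamily g A)) / A w) w₀ :=
    ((map_continuous f).comp (continuous_slice _)).continuousAt.div A.continuous.continuousAt hA
  refine hcont.congr ?_
  filter_upwards [A.continuous.continuousAt.eventually_ne hA] with w hw
  rw [distribution_slice_shiftFamily, mul_div_cancel_left₀ _ hw]

variable [MeasurableSpace E] [BorelSpace E]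

instance : (volume : Measure (E × E)).IsAddHaarMeasure :=
  inferInstanceAs (Measure.prod volume volume : Measure (E × E)).IsAddHaarMeasure

theorem fourier_schwartz_apply (φ : 𝓢(E, ℂ)) (ξ : E) :
    𝓕 φ ξ = ∫ t, φ t * character t ξ := by
  rw [fourier_coe, Real.fourier_eq']
  refine integral_congr_ae (.of_forall fun t => ?_)
  simp only [character, smul_eq_mul]
  rw [mul_comm]
  congr 2
  push_cast
  ring

theorem fourierInv_schwartz_apply (φ : 𝓢(E, ℂ)) (η : E) :
    𝓕⁻ φ η = ∫ s, φ s * (starRingEnd ℂ) (character s η) := by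
  rw [fourierInv_apply_eq]
  change 𝓕 φ (-η) = _
  rw [fourier_schwartz_apply]
  simp only [character_neg_right]

/-- The Schwartz function `(y, η) ↦ ∫ s, k s * g (s - y) * exp (2πi η·s)`, that is, the conjugate of
the short-time Fourier transform of `conj k` with window `g`. It is the kernel of the reproducing
formula and of changes of window. -/
noncomputable def crossKernel (g k : 𝓢(E, ℂ)) : 𝓢(E × E, ℂ) :=
  partialCLM (FourierTransform.fourierInvCLM ℂ 𝓢(E, ℂ)) (windowProduct g k)

theorem crossKernel_eq_fourierInv (g k : 𝓢(E, ℂ)) (y η : E) :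
    crossKernel g k (y, η) = 𝓕⁻ (slice y (windowProduct g k)) η := rfl

theorem crossKernel_apply (g k : 𝓢(E, ℂ)) (y η : E) :
    crossKernel g k (y, η) = ∫ s, k s * g (s - y) * (starRingEnd ℂ) (character s η) := by
  rw [crossKernel_eq_fourierInv, fourierInv_schwartz_apply]
  simp only [slice_windowProduct]

theorem integral_crossKernel_mul_conjShift_right (g k : 𝓢(E, ℂ)) (y t : E) :
    ∫ η, crossKernel g k (y, η) * conjShift g y η t = (‖g (t - y)‖ ^ 2 : ℝ) * k t := by
  have integrand_eq (η : E) : crossKernel g k (y, η) * conjShift g y η t =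
      (starRingEnd ℂ) (g (t - y)) * (𝓕⁻ (slice y (windowProduct g k)) η * character η t) := by
    rw [conjShift_apply, crossKernel_eq_fourierInv]
    ring
  simp only [integrand_eq]
  rw [integral_const_mul, ← fourier_schwartz_apply, FourierTransform.fourier_fourierInv_eq,
    slice_windowProduct, mul_left_comm, Complex.conj_mul', mul_comm]
  push_cast
  rfl

theorem integral_crossKernel_mul_conjShift (g k : 𝓢(E, ℂ)) (t : E) :
    ∫ w : E × E, crossKernel g k w * conjShift g w.1 w.2 t = (∫ s, ‖g s‖ ^ 2 : ℝ) * k t := by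
  have hint : Integrable (fun w : E × E => crossKernel g k w * conjShift g w.1 w.2 t) := by
    simpa only [shiftFamily_apply] using
      integrable_slice_left (μ := (volume : Measure (E × E))) (shiftFamily g (crossKernel g k)) t
  calc ∫ w, crossKernel g k w * conjShift g w.1 w.2 t ∂(volume.prod volume)
      = ∫ y, ((‖g (t - y)‖ ^ 2 : ℝ) : ℂ) * k t := by
        rw [integral_prod _ hint]
        simp only [integral_crossKernel_mul_conjShift_right]
    _ = (∫ y, ‖g (t - y)‖ ^ 2 : ℝ) * k t := by rw [integral_mul_const, integral_complex_ofReal]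
    _ = (∫ s, ‖g s‖ ^ 2 : ℝ) * k t := by
        rw [integral_sub_left_eq_self (fun s => ‖g s‖ ^ 2) volume t]

theorem distribution_eq_integral_crossKernel_mul_stft (g k : 𝓢(E, ℂ)) (f : 𝓢'(E, ℂ)) :
    (∫ s, ‖g s‖ ^ 2 : ℝ) * f k = ∫ w : E × E, crossKernel g k w * stft g f w.1 w.2 := by
  have apply_integral := distribution_integral_slice (μ := (volume : Measure (E × E))) f
    (shiftFamily g (crossKernel g k)) (((∫ s, ‖g s‖ ^ 2 : ℝ) : ℂ) • k) fun t => by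
      simp only [shiftFamily_apply]
      rw [integral_crossKernel_mul_conjShift]
      rfl
  simpa only [distribution_slice_shiftFamily, map_smul, smul_eq_mul] using apply_integral

theorem norm_crossKernel_conjShift (g h : 𝓢(E, ℂ)) (x ξ y η : E) :
    ‖crossKernel g (conjShift h x ξ) (y, η)‖ =
      ‖crossKernel g (conjSchwartz h) (y - x, η - ξ)‖ := by
  have integrand_eq (s : E) : conjShift h x ξ (s + x) * g (s + x - y) *
      (starRingEnd ℂ) (character (s + x) η) =
      (character ξ x * (starRingEnd ℂ) (character x η)) *
      (conjSchwartz h s * g (s - (y - x)) * (starRingEnd ℂ) (character s (η - ξ))) := by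
    rw [conjShift_apply, add_sub_cancel_right, sub_sub_eq_add_sub, character_add_right,
      character_add_left, sub_eq_add_neg η, character_add_right, character_neg_right, map_mul,
      map_mul, Complex.conj_conj, character_comm s ξ, conjSchwartz_apply]
    ring
  calc ‖crossKernel g (conjShift h x ξ) (y, η)‖
      = ‖∫ s, conjShift h x ξ (s + x) * g (s + x - y) *
          (starRingEnd ℂ) (character (s + x) η)‖ := by
        rw [crossKernel_apply, ← integral_add_right_eq_self (fun s =>
          conjShift h x ξ s * g (s - y) * (starRingEnd ℂ) (character s η)) x]
    _ = ‖crossKernel g (conjSchwartz h) (y - x, η - ξ)‖ := by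
        simp only [integrand_eq]
        rw [integral_const_mul, ← crossKernel_apply, norm_mul, norm_mul, RCLike.norm_conj,
          norm_character, norm_character, one_mul, one_mul]

theorem integral_norm_sq_pos {g : 𝓢(E, ℂ)} (hg : g ≠ 0) : 0 < ∫ s, ‖g s‖ ^ 2 := by
  obtain ⟨x, hx⟩ : ∃ x, g x ≠ 0 := by
    by_contra! h
    exact hg (SchwartzMap.ext h)
  exact integral_pos_of_integrable_nonneg_nonzero (x := x) (g.continuous.norm.pow 2)
    ((g.memLp 2).integrable_norm_pow (by simp)) (fun s => by positivity) (by simpa using hx)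

theorem enorm_stft_le_lconvolution (g h : 𝓢(E, ℂ)) (f : 𝓢'(E, ℂ)) (w : E × E) :
    ENNReal.ofReal (∫ s, ‖g s‖ ^ 2) * ‖stft h f w.1 w.2‖ₑ ≤
      ((fun w' => ‖stft g f w'.1 w'.2‖ₑ) ⋆ₗ
        fun u => ‖crossKernel g (conjSchwartz h) (-u)‖ₑ) w := by
  have enorm_kernel (w' : E × E) : ‖crossKernel g (conjShift h w.1 w.2) w'‖ₑ =
      ‖crossKernel g (conjSchwartz h) (-(-w' + w))‖ₑ := by
    rw [← ofReal_norm, ← ofReal_norm, neg_add_rev, neg_neg, neg_add_eq_sub]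
    exact congrArg _ (norm_crossKernel_conjShift g h w.1 w.2 w'.1 w'.2)
  calc ENNReal.ofReal (∫ s, ‖g s‖ ^ 2) * ‖stft h f w.1 w.2‖ₑ
      = ‖((∫ s, ‖g s‖ ^ 2 : ℝ) : ℂ) * f (conjShift h w.1 w.2)‖ₑ := by
        rw [enorm_mul, ← ofReal_norm ((_ : ℝ) : ℂ), Complex.norm_real,
          Real.norm_of_nonneg (by positivity)]
        rfl
    _ ≤ ∫⁻ w' : E × E, ‖crossKernel g (conjShift h w.1 w.2) w' * stft g f w'.1 w'.2‖ₑ := by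
        rw [distribution_eq_integral_crossKernel_mul_stft]
        exact enorm_integral_le_lintegral_enorm _
    _ = _ := lintegral_congr fun w' => by rw [enorm_mul, enorm_kernel, mul_comm]

end Window

/-! ### Moderate weights and independence of the window -/

section Weights

variable {Z : Type*} [NormedAddCommGroup Z]

theorem polyWeight_pos (s : ℝ) (z : Z) : 0 < polyWeight s z :=
  Real.rpow_pos_of_pos (by positivity) _

theorem polyWeight_neg (s : ℝ) (z : Z) : polyWeight s (-z) = polyWeight s z := by
  rw [polyWeight, polyWeight, norm_neg]

theorem polyWeight_neg_exponent (s : ℝ) (z : Z) : polyWeight (-s) z = (polyWeight s z)⁻¹ := by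
  rw [polyWeight, polyWeight, neg_div, Real.rpow_neg (by positivity)]

theorem continuous_polyWeight (s : ℝ) : Continuous (polyWeight s : Z → ℝ) :=
  Continuous.rpow_const (by fun_prop) fun _ => Or.inl (by positivity)

theorem one_add_norm_sq_le (z w : Z) :
    1 + ‖z‖ ^ 2 ≤ 2 * ((1 + ‖w‖ ^ 2) * (1 + ‖z - w‖ ^ 2)) := by
  have triangle : ‖z‖ ^ 2 ≤ (‖w‖ + ‖z - w‖) ^ 2 := by
    gcongr
    exact norm_le_norm_add_norm_sub' z w
  nlinarith [sq_nonneg (‖w‖ - ‖z - w‖), sq_nonneg (‖w‖ * ‖z - w‖)]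

theorem polyWeight_le_of_nonneg {s : ℝ} (hs : 0 ≤ s) (z w : Z) :
    polyWeight s z ≤ 2 ^ (s / 2) * (polyWeight s w * polyWeight s (z - w)) := by
  unfold polyWeight
  rw [← Real.mul_rpow (by positivity) (by positivity),
    ← Real.mul_rpow (by positivity) (by positivity)]
  exact Real.rpow_le_rpow (by positivity) (one_add_norm_sq_le z w) (by positivity)

theorem polyWeight_le (s : ℝ) (z w : Z) :
    polyWeight s z ≤ 2 ^ (|s| / 2) * (polyWeight s w * polyWeight |s| (z - w)) := by
  rcases le_total 0 s with hs | hs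
  · rw [abs_of_nonneg hs]
    exact polyWeight_le_of_nonneg hs z w
  · obtain ⟨t, rfl⟩ : ∃ t, s = -t := ⟨-s, (neg_neg s).symm⟩
    have ht : 0 ≤ t := neg_nonpos.1 hs
    have swapped := polyWeight_le_of_nonneg ht w z
    have hz := polyWeight_pos t z
    have hw := polyWeight_pos t w
    rw [abs_neg, abs_of_nonneg ht, polyWeight_neg_exponent, polyWeight_neg_exponent,
      ← polyWeight_neg t (z - w), neg_sub]
    field_simp
    linarith

theorem polyWeight_le_one_add_norm_pow {s : ℝ} (hs : 0 ≤ s) (z : Z) :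
    polyWeight s z ≤ (1 + ‖z‖) ^ ⌈s⌉₊ := by
  have hz := norm_nonneg z
  calc (1 + ‖z‖ ^ 2) ^ (s / 2) ≤ ((1 + ‖z‖) ^ (2 : ℝ)) ^ (s / 2) := by
        gcongr
        rw [Real.rpow_two]
        nlinarith
    _ = (1 + ‖z‖) ^ s := by rw [← Real.rpow_mul (by positivity), mul_div_cancel₀ s two_ne_zero]
    _ ≤ (1 + ‖z‖) ^ ((⌈s⌉₊ : ℕ) : ℝ) :=
        Real.rpow_le_rpow_of_exponent_le (by linarith) (Nat.le_ceil _)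
    _ = (1 + ‖z‖) ^ ⌈s⌉₊ := Real.rpow_natCast _ _

end Weights

theorem mixedELpNorm_schwartz_mul_pow_lt_top {E F V : Type*}
    [NormedAddCommGroup E] [NormedSpace ℝ E] [MeasurableSpace E]
    [NormedAddCommGroup F] [NormedSpace ℝ F] [MeasurableSpace F]
    [NormedAddCommGroup V] [NormedSpace ℝ V]
    (μ : Measure E) [μ.HasTemperateGrowth] (ν : Measure F) [ν.HasTemperateGrowth]
    (κ : 𝓢(E × F, V)) (N : ℕ) (a b : ℝ≥0∞) :
    mixedELpNorm (fun w => ‖κ w‖ₑ * ENNReal.ofReal ((1 + ‖w‖) ^ N)) a b μ ν < ∞ := by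
  obtain ⟨k, hk⟩ := Measure.HasTemperateGrowth.exists_eLpNorm_lt_top a (μ := μ) inferInstance
  obtain ⟨l, hl⟩ := Measure.HasTemperateGrowth.exists_eLpNorm_lt_top b (μ := ν) inferInstance
  rw [← eLpNorm_enorm] at hk hl
  obtain ⟨M, decay⟩ : ∃ M : ℝ, ∀ w : E × F, (1 + ‖w‖) ^ (N + k + l) * ‖κ w‖ ≤ M :=
    ⟨_, fun w => by
      simpa only [norm_iteratedFDeriv_zero] using one_add_le_sup_seminorm_apply (𝕜 := ℝ)
        (m := (N + k + l, 0)) (n := 0) le_rfl le_rfl κ w⟩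
  have pointwise (x : E) (y : F) : ‖κ (x, y)‖ₑ * ENNReal.ofReal ((1 + ‖(x, y)‖) ^ N) ≤
      ENNReal.ofReal M * ‖(1 + ‖y‖) ^ (-l : ℝ)‖ₑ * ‖(1 + ‖x‖) ^ (-k : ℝ)‖ₑ := by
    have hx : ‖x‖ ≤ ‖(x, y)‖ := norm_fst_le (x, y)
    have hy : ‖y‖ ≤ ‖(x, y)‖ := norm_snd_le (x, y)
    rw [Real.enorm_of_nonneg (by positivity), Real.enorm_of_nonneg (by positivity),
      ← ofReal_norm, mul_assoc, ← ENNReal.ofReal_mul (by positivity),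
      ← ENNReal.ofReal_mul (by positivity), ← ENNReal.ofReal_mul' (by positivity)]
    refine ENNReal.ofReal_le_ofReal ?_
    rw [Real.rpow_neg (by positivity), Real.rpow_neg (by positivity), Real.rpow_natCast,
      Real.rpow_natCast, ← mul_inv, ← div_eq_mul_inv, le_div_iff₀ (by positivity)]
    calc ‖κ (x, y)‖ * (1 + ‖(x, y)‖) ^ N * ((1 + ‖y‖) ^ l * (1 + ‖x‖) ^ k)
        ≤ ‖κ (x, y)‖ * (1 + ‖(x, y)‖) ^ N * ((1 + ‖(x, y)‖) ^ l * (1 + ‖(x, y)‖) ^ k) := by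
          gcongr
      _ = (1 + ‖(x, y)‖) ^ (N + k + l) * ‖κ (x, y)‖ := by ring
      _ ≤ M := decay (x, y)
  set A := eLpNorm (fun x => ‖(1 + ‖x‖) ^ (-k : ℝ)‖ₑ) a μ
  set B := eLpNorm (fun y => ‖(1 + ‖y‖) ^ (-l : ℝ)‖ₑ) b ν
  calc mixedELpNorm (fun w => ‖κ w‖ₑ * ENNReal.ofReal ((1 + ‖w‖) ^ N)) a b μ ν
      ≤ eLpNorm (fun y => ENNReal.ofReal M * A * ‖(1 + ‖y‖) ^ (-l : ℝ)‖ₑ) b ν :=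
        eLpNorm_mono_ennreal fun y => (eLpNorm_mono_ennreal fun x => pointwise x y).trans
          ((eLpNorm_const_mul_le (ENNReal.mul_ne_top ENNReal.ofReal_ne_top enorm_ne_top) _).trans_eq
            (mul_right_comm _ _ _))
    _ ≤ ENNReal.ofReal M * A * B :=
        eLpNorm_const_mul_le (ENNReal.mul_ne_top ENNReal.ofReal_ne_top hk.ne) _
    _ < ∞ := ENNReal.mul_lt_top (ENNReal.mul_lt_top ENNReal.ofReal_lt_top hk) hl

theorem exists_young_exponent {p P : ℝ≥0∞} (hp : 1 ≤ p) (hP : p ≤ P) :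
    ∃ a : ℝ≥0∞, 1 ≤ a ∧ p⁻¹ + a⁻¹ = 1 + P⁻¹ := by
  have p_inv_le : p⁻¹ ≤ 1 := ENNReal.inv_le_one.2 hp
  have P_inv_le : P⁻¹ ≤ p⁻¹ := ENNReal.inv_le_inv.2 hP
  refine ⟨(1 + P⁻¹ - p⁻¹)⁻¹, ?_, ?_⟩
  · rw [ENNReal.one_le_inv, tsub_le_iff_right]
    gcongr
  · rw [inv_inv, add_tsub_cancel_of_le (p_inv_le.trans le_self_add)]

section Moderate

variable {E : Type*} [NormedAddCommGroup E]

/-- Continuous nonnegative weights on phase space which change at most by a factor of polynomial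
growth under translations. These are the weights for which the modulation space does not depend on
the window. -/
structure IsModerate (m : E → E → ℝ) : Prop where
  continuous : Continuous (Function.uncurry m)
  nonneg : ∀ x ξ, 0 ≤ m x ξ
  le_mul : ∃ (C : ℝ) (N : ℕ), ∀ w w' : E × E,
    m w.1 w.2 ≤ C * (1 + ‖w - w'‖) ^ N * m w'.1 w'.2

theorem isModerate_one : IsModerate (fun _ _ : E => (1 : ℝ)) where
  continuous := continuous_const
  nonneg _ _ := zero_le_one
  le_mul := ⟨1, 0, fun w w' => by simp⟩

theorem isModerate_polyWeight_comp [NormedSpace ℝ E] {F : Type*} [NormedAddCommGroup F]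
    [NormedSpace ℝ F] (s : ℝ) (L : E × E →L[ℝ] F) :
    IsModerate fun x ξ => polyWeight s (L (x, ξ)) where
  continuous := (continuous_polyWeight s).comp L.continuous
  nonneg _ _ := (polyWeight_pos _ _).le
  le_mul := by
    refine ⟨2 ^ (|s| / 2) * (1 + ‖L‖) ^ ⌈|s|⌉₊, ⌈|s|⌉₊, fun w w' => ?_⟩
    have base_le : 1 + ‖L w - L w'‖ ≤ (1 + ‖L‖) * (1 + ‖w - w'‖) := by
      rw [← map_sub]
      nlinarith [L.le_opNorm (w - w'), norm_nonneg L, norm_nonneg (w - w')]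
    have weight_le : polyWeight |s| (L w - L w') ≤ ((1 + ‖L‖) * (1 + ‖w - w'‖)) ^ ⌈|s|⌉₊ :=
      (polyWeight_le_one_add_norm_pow (abs_nonneg s) _).trans (by gcongr)
    have hpos := polyWeight_pos s (L w')
    calc polyWeight s (L w)
        ≤ 2 ^ (|s| / 2) * (polyWeight s (L w') * polyWeight |s| (L w - L w')) :=
          polyWeight_le s _ _
      _ ≤ 2 ^ (|s| / 2) * (polyWeight s (L w') * ((1 + ‖L‖) * (1 + ‖w - w'‖)) ^ ⌈|s|⌉₊) := by
          gcongr
      _ = 2 ^ (|s| / 2) * (1 + ‖L‖) ^ ⌈|s|⌉₊ * (1 + ‖w - w'‖) ^ ⌈|s|⌉₊ * polyWeight s (L w') := by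
          rw [mul_pow]
          ring

variable [InnerProductSpace ℝ E]

theorem isModerate_phaseWeight (s : ℝ) : IsModerate (phaseWeight s : E → E → ℝ) :=
  isModerate_polyWeight_comp s
    (WithLp.prodContinuousLinearEquiv 2 ℝ E E).symm.toContinuousLinearMap

theorem isModerate_freqWeight (s : ℝ) : IsModerate (freqWeight s : E → E → ℝ) :=
  isModerate_polyWeight_comp s (.snd ℝ E E)

variable [FiniteDimensional ℝ E] [MeasurableSpace E] [BorelSpace E]

theorem mixedNorm_eq_mixedELpNorm {m : E → E → ℝ} (hm : ∀ x ξ, 0 ≤ m x ξ) (p q : ℝ≥0∞)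
    (F : E → E → ℂ) :
    mixedNorm p q m F =
      mixedELpNorm (fun w => ‖F w.1 w.2‖ₑ * ENNReal.ofReal (m w.1 w.2)) p q volume volume := by
  have enorm_weight (x ξ : E) : ‖(m x ξ : ℂ)‖ₑ = ENNReal.ofReal (m x ξ) := by
    rw [← ofReal_norm, Complex.norm_real, Real.norm_of_nonneg (hm x ξ)]
  simp only [mixedNorm, mixedELpNorm, ← enorm_weight, ← enorm_mul, eLpNorm_enorm]

theorem enorm_stft_mul_weight_le_lconvolution (g h : 𝓢(E, ℂ)) {m : E → E → ℝ}
    (hm : ∀ x ξ, 0 ≤ m x ξ) {C : ℝ} {N : ℕ}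
    (hC : ∀ w w' : E × E, m w.1 w.2 ≤ C * (1 + ‖w - w'‖) ^ N * m w'.1 w'.2)
    (f : 𝓢'(E, ℂ)) (w : E × E) :
    ENNReal.ofReal (∫ s, ‖g s‖ ^ 2) * (‖stft h f w.1 w.2‖ₑ * ENNReal.ofReal (m w.1 w.2)) ≤
      ENNReal.ofReal C *
        ((fun w' => ‖stft g f w'.1 w'.2‖ₑ * ENNReal.ofReal (m w'.1 w'.2)) ⋆ₗ
          fun u => ‖crossKernel g (conjSchwartz h) (-u)‖ₑ * ENNReal.ofReal ((1 + ‖-u‖) ^ N)) w := by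
  have weight_le (w' : E × E) : ENNReal.ofReal (m w.1 w.2) ≤
      ENNReal.ofReal C * ENNReal.ofReal ((1 + ‖-(-w' + w)‖) ^ N) *
        ENNReal.ofReal (m w'.1 w'.2) := by
    rw [← ENNReal.ofReal_mul' (by positivity), ← ENNReal.ofReal_mul' (hm _ _), norm_neg,
      neg_add_eq_sub]
    exact ENNReal.ofReal_le_ofReal (hC w w')
  rw [← mul_assoc]
  refine (mul_le_mul_left (enorm_stft_le_lconvolution g h f w) _).trans ?_
  rw [lconvolution_def, lconvolution_def, ← lintegral_mul_const' _ _ ENNReal.ofReal_ne_top,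
    ← lintegral_const_mul' _ _ ENNReal.ofReal_ne_top]
  refine lintegral_mono fun w' => (mul_le_mul_right (weight_le w') _).trans_eq ?_
  ring

/-- Besides independence of the window, this contains the inclusions between modulation spaces with
increasing exponents. -/
theorem exists_modNorm_le {g : 𝓢(E, ℂ)} (hg : g ≠ 0) (h : 𝓢(E, ℂ)) {m : E → E → ℝ}
    (hm : IsModerate m) {p q P Q : ℝ≥0∞} (hp : 1 ≤ p) (hq : 1 ≤ q) (hP : p ≤ P) (hQ : q ≤ Q) :
    ∃ C : ℝ≥0, ∀ f : 𝓢'(E, ℂ), modNorm h P Q m f ≤ C * modNorm g p q m f := by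
  obtain ⟨C, N, hC⟩ := hm.le_mul
  obtain ⟨a, ha, haP⟩ := exists_young_exponent hp hP
  obtain ⟨b, hb, hbQ⟩ := exists_young_exponent hq hQ
  set c := ENNReal.ofReal (∫ s, ‖g s‖ ^ 2)
  have hc : c ≠ 0 := by simpa [c] using integral_norm_sq_pos hg
  set κ := fun u => ‖crossKernel g (conjSchwartz h) u‖ₑ * ENNReal.ofReal ((1 + ‖u‖) ^ N)
  have hκ : Measurable κ := by fun_prop
  set A := mixedELpNorm κ a b volume volume
  have hA : A ≠ ∞ := (mixedELpNorm_schwartz_mul_pow_lt_top volume volume _ N a b).ne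
  have hD : c⁻¹ * ENNReal.ofReal C ≠ ∞ :=
    ENNReal.mul_ne_top (ENNReal.inv_ne_top.2 hc) ENNReal.ofReal_ne_top
  refine ⟨(c⁻¹ * ENNReal.ofReal C * A).toNNReal, fun f => ?_⟩
  rw [ENNReal.coe_toNNReal (ENNReal.mul_ne_top hD hA), modNorm, modNorm,
    mixedNorm_eq_mixedELpNorm hm.nonneg, mixedNorm_eq_mixedELpNorm hm.nonneg]
  set F := fun w : E × E => ‖stft g f w.1 w.2‖ₑ * ENNReal.ofReal (m w.1 w.2)
  have hF : Measurable F := (continuous_stft g f).measurable.enorm.mul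
    hm.continuous.measurable.ennreal_ofReal
  have pointwise (w : E × E) : ‖stft h f w.1 w.2‖ₑ * ENNReal.ofReal (m w.1 w.2) ≤
      c⁻¹ * ENNReal.ofReal C * (F ⋆ₗ fun u => κ (-u)) w := by
    rw [mul_assoc, ← ENNReal.mul_le_iff_le_inv hc ENNReal.ofReal_ne_top]
    exact enorm_stft_mul_weight_le_lconvolution g h hm.nonneg hC f w
  calc mixedELpNorm (fun w => ‖stft h f w.1 w.2‖ₑ * ENNReal.ofReal (m w.1 w.2)) P Q volume volume
      ≤ c⁻¹ * ENNReal.ofReal C * mixedELpNorm (F ⋆ₗ fun u => κ (-u)) P Q volume volume :=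
        (mixedELpNorm_mono pointwise).trans (mixedELpNorm_const_mul_le hD _)
    _ ≤ c⁻¹ * ENNReal.ofReal C *
          (mixedELpNorm F p q volume volume * mixedELpNorm (fun u => κ (-u)) a b volume volume) :=
        mul_le_mul_right (mixedELpNorm_lconvolution_le hp ha haP hq hb hbQ hF (by fun_prop)) _
    _ = c⁻¹ * ENNReal.ofReal C * A * mixedELpNorm F p q volume volume := by
        rw [mixedELpNorm_comp_neg hκ, mul_comm (mixedELpNorm F _ _ _ _), ← mul_assoc]

end Moderate

/-! ### Sufficiency -/

section ProductFormula

variable {E : Type*} [NormedAddCommGroup E] [InnerProductSpace ℝ E]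

theorem symplecticRotation_fst (ζ : WithLp 2 (E × E)) :
    (symplecticRotation E ζ).fst = ζ.snd := rfl

theorem symplecticRotation_snd (ζ : WithLp 2 (E × E)) :
    (symplecticRotation E ζ).snd = -ζ.fst := rfl

theorem polyWeight_le_mul_symplecticRotation (s : ℝ) {z ζ w₁ w₂ : WithLp 2 (E × E)}
    (hw₁ : w₁ = z - (1 / 2 : ℝ) • symplecticRotation E ζ)
    (hw₂ : w₂ = z + (1 / 2 : ℝ) • symplecticRotation E ζ) :
    polyWeight s ζ ≤ 2 ^ (|s| / 2) * (polyWeight |s| w₁ * polyWeight s w₂) := by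
  have rotation_eq : symplecticRotation E ζ = w₂ - w₁ := by
    rw [hw₁, hw₂]
    module
  calc polyWeight s ζ = polyWeight s (w₂ - w₁) := by
        rw [← rotation_eq, polyWeight, polyWeight, LinearIsometryEquiv.norm_map]
    _ ≤ 2 ^ (|s| / 2) * (polyWeight s w₂ * polyWeight |s| (w₂ - w₁ - w₂)) := polyWeight_le s _ _
    _ = 2 ^ (|s| / 2) * (polyWeight |s| w₁ * polyWeight s w₂) := by
        rw [sub_sub_cancel_left, polyWeight_neg, mul_comm (polyWeight s w₂)]

theorem character_half_smul_add (ζ u v : E) :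
    character ζ ((1 / 2 : ℝ) • (u + v)) =
      character ((1 / 2 : ℝ) • ζ) u * character ((1 / 2 : ℝ) • ζ) v := by
  rw [← character_add_right]
  simp only [character, real_inner_smul_left, real_inner_smul_right]

theorem character_toLp (ζ : WithLp 2 (E × E)) (x ξ : E) :
    character ζ (WithLp.toLp 2 (x, ξ)) = character ζ.fst x * character ζ.snd ξ := by
  have inner_toLp : inner ℝ ζ (WithLp.toLp 2 (x, ξ)) = inner ℝ ζ.fst x + inner ℝ ζ.snd ξ :=
    WithLp.prod_inner_apply _ _
  simp only [character, inner_toLp, ← Complex.exp_add, Complex.ofReal_add, mul_add]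

theorem conjSchwartz_conjSchwartz (g : 𝓢(E, ℂ)) : conjSchwartz (conjSchwartz g) = g := by
  ext t
  rw [conjSchwartz_apply, conjSchwartz_apply, Complex.conj_conj]

/-- The Schwartz function `(x, t) ↦ g (x + t/2) * conj (g (x - t/2))`, whose Fourier transform in
`t` is the Wigner distribution of `g`. -/
noncomputable def wignerProduct (g : 𝓢(E, ℂ)) : 𝓢(E × E, ℂ) :=
  compCLMOfContinuousLinearEquiv ℂ (midpointDiff E).symm (tensor g (conjSchwartz g))

theorem wignerProduct_apply (g : 𝓢(E, ℂ)) (x t : E) :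
    wignerProduct g (x, t) =
      g (x + (1 / 2 : ℝ) • t) * (starRingEnd ℂ) (g (x - (1 / 2 : ℝ) • t)) := by
  change tensor g (conjSchwartz g) (x + (1 / 2 : ℝ) • t, x - (1 / 2 : ℝ) • t) = _
  rw [tensor_apply, conjSchwartz_apply]

variable [FiniteDimensional ℝ E]

theorem pairSnd_tensor (f : 𝓢'(E, ℂ)) (φ ψ : 𝓢(E, ℂ)) :
    pairSnd f (tensor φ ψ) = f ψ • φ := by
  ext x
  have slice_tensor : slice x (tensor φ ψ) = φ x • ψ := by
    ext y
    rw [slice_apply, tensor_apply]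
    rfl
  rw [pairSnd_apply, slice_tensor, map_smul, smul_apply, smul_eq_mul, smul_eq_mul, mul_comm]

variable [MeasurableSpace E] [BorelSpace E]

/-- The Wigner distribution `W(g, g)` of a Schwartz function, as a Schwartz function on phase
space. -/
noncomputable def wignerSchwartz (g : 𝓢(E, ℂ)) : 𝓢(WithLp 2 (E × E), ℂ) :=
  compCLMOfContinuousLinearEquiv ℂ (WithLp.prodContinuousLinearEquiv 2 ℝ E E)
    (partialCLM (fourierTransformCLM ℂ) (wignerProduct g))

theorem wignerSchwartz_apply (g : 𝓢(E, ℂ)) (x ξ : E) :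
    wignerSchwartz g (WithLp.toLp 2 (x, ξ)) = 𝓕 (slice x (wignerProduct g)) ξ := rfl

theorem wignerSchwartz_ne_zero {g : 𝓢(E, ℂ)} (hg : g ≠ 0) : wignerSchwartz g ≠ 0 := by
  intro wigner_eq_zero
  refine hg (SchwartzMap.ext fun x => ?_)
  have fourier_eq_zero : 𝓕 (slice x (wignerProduct g)) = 0 := by
    ext ξ
    rw [← wignerSchwartz_apply, wigner_eq_zero]
    rfl
  have slice_eq_zero : slice x (wignerProduct g) = 0 :=
    (FourierTransform.fourierCLE ℂ 𝓢(E, ℂ)).map_eq_zero_iff.1 fourier_eq_zero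
  have diagonal : g x * (starRingEnd ℂ) (g x) = 0 := by
    simpa [slice_apply, wignerProduct_apply] using DFunLike.congr_fun slice_eq_zero 0
  simpa using diagonal

theorem integral_conjShift_wignerSchwartz_mul_character (g : 𝓢(E, ℂ)) (z ζ : WithLp 2 (E × E))
    (x t : E) :
    ∫ ξ, conjShift (wignerSchwartz g) z ζ (WithLp.toLp 2 (x, ξ)) * character ξ t =
      character ζ.fst x * character ζ.snd z.snd * character z.snd t *
        (starRingEnd ℂ) (wignerProduct g (x - z.fst, ζ.snd + t)) := by
  have integrand_eq (ξ : E) : conjShift (wignerSchwartz g) z ζ (WithLp.toLp 2 (x, ξ + z.snd)) *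
      character (ξ + z.snd) t =
      (character ζ.fst x * character ζ.snd z.snd * character z.snd t) *
        (starRingEnd ℂ) (𝓕 (slice (x - z.fst) (wignerProduct g)) ξ *
          (starRingEnd ℂ) (character ξ (ζ.snd + t))) := by
    have translate : WithLp.toLp 2 (x, ξ + z.snd) - z = WithLp.toLp 2 (x - z.fst, ξ) :=
      WithLp.ofLp_injective 2 (Prod.ext rfl (add_sub_cancel_right _ _))
    rw [conjShift_apply, translate, wignerSchwartz_apply, character_toLp, character_add_right,
      character_add_left, map_mul, Complex.conj_conj, character_add_right ξ,
      character_comm ξ ζ.snd]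
    ring
  rw [← integral_add_right_eq_self _ z.snd]
  simp only [integrand_eq]
  rw [integral_const_mul, integral_conj, ← fourierInv_schwartz_apply,
    FourierTransform.fourierInv_fourier_eq, slice_apply]

theorem wignerKernel_conjShift (g : 𝓢(E, ℂ)) {z ζ w₁ w₂ : WithLp 2 (E × E)}
    (hw₁ : w₁ = z - (1 / 2 : ℝ) • symplecticRotation E ζ)
    (hw₂ : w₂ = z + (1 / 2 : ℝ) • symplecticRotation E ζ) :
    wignerKernel (conjShift (wignerSchwartz g) z ζ) = character ζ.snd z.snd •
      tensor (conjShift g w₁.fst w₁.snd) (conjSchwartz (conjShift g w₂.fst w₂.snd)) := by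
  subst hw₁ hw₂
  ext ⟨u, v⟩
  have left_shift : (1 / 2 : ℝ) • (u + v) - z.fst + (1 / 2 : ℝ) • (ζ.snd + (u - v)) =
      u - (z.fst - (1 / 2 : ℝ) • ζ.snd) := by module
  have right_shift : (1 / 2 : ℝ) • (u + v) - z.fst - (1 / 2 : ℝ) • (ζ.snd + (u - v)) =
      v - (z.fst + (1 / 2 : ℝ) • ζ.snd) := by module
  rw [wignerKernel_apply, integral_conjShift_wignerSchwartz_mul_character, wignerProduct_apply,
    left_shift, right_shift, smul_apply, tensor_apply, conjSchwartz_apply, conjShift_apply,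
    conjShift_apply, character_half_smul_add, sub_eq_add_neg u v, character_add_right z.snd,
    character_neg_right]
  simp only [WithLp.sub_fst, WithLp.sub_snd, WithLp.add_fst, WithLp.add_snd, WithLp.smul_fst,
    WithLp.smul_snd, symplecticRotation_fst, symplecticRotation_snd]
  simp only [smul_neg, sub_neg_eq_add, character_add_left, character_neg_left, map_mul,
    Complex.conj_conj, smul_eq_mul]
  ring

theorem enorm_stft_crossWigner (g : 𝓢(E, ℂ)) (f₁ f₂ : 𝓢'(E, ℂ)) {z ζ w₁ w₂ : WithLp 2 (E × E)}
    (hw₁ : w₁ = z - (1 / 2 : ℝ) • symplecticRotation E ζ)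
    (hw₂ : w₂ = z + (1 / 2 : ℝ) • symplecticRotation E ζ) :
    ‖stft (wignerSchwartz g) (crossWigner f₁ f₂) z ζ‖ₑ =
      ‖stft g f₁ w₁.fst w₁.snd‖ₑ * ‖stft g f₂ w₂.fst w₂.snd‖ₑ := by
  rw [stft, crossWigner_apply, wignerKernel_conjShift g hw₁ hw₂, map_smul, pairSnd_tensor, map_smul,
    map_smul, conjDist_apply, conjSchwartz_conjSchwartz, smul_eq_mul, smul_eq_mul, enorm_mul,
    enorm_mul, RCLike.enorm_conj, ← ofReal_norm (character _ _), norm_character, ENNReal.ofReal_one,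
    one_mul, mul_comm]
  rfl

end ProductFormula

section Exponents

theorem exists_exponents {p q p₁ p₂ : ℝ≥0∞} (hpq : p ≤ q) (h₁ : p₁ ≤ q) (h₂ : p₂ ≤ q)
    (h : p⁻¹ + q⁻¹ ≤ p₁⁻¹ + p₂⁻¹) :
    ∃ P₁ P₂ : ℝ≥0∞, p₁ ≤ P₁ ∧ p₂ ≤ P₂ ∧ p ≤ P₁ ∧ p ≤ P₂ ∧ P₁⁻¹ + P₂⁻¹ = p⁻¹ + q⁻¹ := by
  rw [← ENNReal.inv_le_inv] at hpq h₁ h₂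
  set α := max q⁻¹ (p⁻¹ + q⁻¹ - p₂⁻¹)
  have α_le_p₁ : α ≤ p₁⁻¹ := max_le h₁ (tsub_le_iff_right.2 h)
  have α_le_p : α ≤ p⁻¹ := max_le hpq (tsub_le_iff_right.2 (by gcongr))
  have α_le_sum : α ≤ p⁻¹ + q⁻¹ := max_le le_add_self tsub_le_self
  have sum_le_α_add : p⁻¹ + q⁻¹ ≤ α + p₂⁻¹ := tsub_le_iff_right.1 (le_max_right _ _)
  have sum_le_α_add' : p⁻¹ + q⁻¹ ≤ α + p⁻¹ := by
    rw [add_comm]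
    gcongr
    exact le_max_left _ _
  refine ⟨α⁻¹, (p⁻¹ + q⁻¹ - α)⁻¹, ENNReal.le_inv_iff_le_inv.2 α_le_p₁,
    ENNReal.le_inv_iff_le_inv.2 (tsub_le_iff_left.2 sum_le_α_add),
    ENNReal.le_inv_iff_le_inv.2 α_le_p,
    ENNReal.le_inv_iff_le_inv.2 (tsub_le_iff_left.2 sum_le_α_add'), ?_⟩
  rw [inv_inv, inv_inv, add_tsub_cancel_of_le α_le_sum]

theorem min_inv_add_inv_le {p q p₁ p₂ : ℝ≥0∞} (h₁ : p₁ ≤ q) (h₂ : p₂ ≤ q)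
    (h : p⁻¹ + q⁻¹ ≤ p₁⁻¹ + p₂⁻¹) : (min p q)⁻¹ + q⁻¹ ≤ p₁⁻¹ + p₂⁻¹ := by
  rcases min_choice p q with hmin | hmin
  · rwa [hmin]
  · rw [hmin]
    exact add_le_add (ENNReal.inv_le_inv.2 h₁) (ENNReal.inv_le_inv.2 h₂)

end Exponents

section Sufficiency

variable {E : Type*} [NormedAddCommGroup E] [InnerProductSpace ℝ E] [FiniteDimensional ℝ E]

theorem continuous_enorm_stft_mul_polyWeight (g : 𝓢(E, ℂ)) (f : 𝓢'(E, ℂ)) (s : ℝ) :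
    Continuous fun z : WithLp 2 (E × E) =>
      ‖stft g f z.fst z.snd‖ₑ * ENNReal.ofReal (polyWeight s z) := by
  simp only [← ofReal_norm (stft _ _ _ _), ← ENNReal.ofReal_mul (norm_nonneg _)]
  exact ENNReal.continuous_ofReal.comp (((continuous_stft g f).comp
    (WithLp.prod_continuous_ofLp 2 E E)).norm.mul (continuous_polyWeight s))

variable [MeasurableSpace E] [BorelSpace E]

theorem modNorm_wignerSchwartz_crossWigner_le (g : 𝓢(E, ℂ)) (s : ℝ) {p q P₁ P₂ Q₁ Q₂ : ℝ≥0∞}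
    (hp : p ≠ 0) (hpq : p ≤ q) (hP₁ : p ≤ P₁) (hP₂ : p ≤ P₂) (hP : P₁⁻¹ + P₂⁻¹ = p⁻¹ + q⁻¹)
    (hQ₁ : p ≤ Q₁) (hQ₂ : p ≤ Q₂) (hQ : Q₁⁻¹ + Q₂⁻¹ = p⁻¹ + q⁻¹) (f₁ f₂ : 𝓢'(E, ℂ)) :
    modNorm (wignerSchwartz g) p q (freqWeight s) (crossWigner f₁ f₂) ≤
      ENNReal.ofReal (2 ^ (|s| / 2)) * (modNorm g P₁ Q₁ (phaseWeight |s|) f₁ *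
        modNorm g P₂ Q₂ (phaseWeight s) f₂) := by
  set A := fun z : WithLp 2 (E × E) =>
    ‖stft g f₁ z.fst z.snd‖ₑ * ENNReal.ofReal (polyWeight |s| z) with hA
  set B := fun z : WithLp 2 (E × E) =>
    ‖stft g f₂ z.fst z.snd‖ₑ * ENNReal.ofReal (polyWeight s z) with hB
  have pointwise (z ζ : WithLp 2 (E × E)) :
      ‖stft (wignerSchwartz g) (crossWigner f₁ f₂) z ζ‖ₑ * ENNReal.ofReal (freqWeight s z ζ) ≤
        ENNReal.ofReal (2 ^ (|s| / 2)) * (A (z - (1 / 2 : ℝ) • symplecticRotation E ζ) *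
          B (z + (1 / 2 : ℝ) • symplecticRotation E ζ)) := by
    have weight_le := ENNReal.ofReal_le_ofReal
      (polyWeight_le_mul_symplecticRotation s (z := z) (ζ := ζ) rfl rfl)
    rw [ENNReal.ofReal_mul (by positivity), ENNReal.ofReal_mul (polyWeight_pos _ _).le] at weight_le
    rw [enorm_stft_crossWigner g f₁ f₂ rfl rfl]
    refine (mul_le_mul_right weight_le _).trans_eq ?_
    simp only [hA, hB]
    ring
  rw [modNorm, modNorm, modNorm, mixedNorm_eq_mixedELpNorm (isModerate_freqWeight s).nonneg,
    mixedNorm_eq_mixedELpNorm (isModerate_phaseWeight |s|).nonneg,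
    mixedNorm_eq_mixedELpNorm (isModerate_phaseWeight s).nonneg]
  refine (mixedELpNorm_mono fun w => pointwise w.1 w.2).trans
    ((mixedELpNorm_const_mul_le ENNReal.ofReal_ne_top _).trans (mul_le_mul_right ?_ _))
  exact eLpNorm_eLpNorm_mul_symplecticRotation_le
    (continuous_enorm_stft_mul_polyWeight g f₁ |s|) (continuous_enorm_stft_mul_polyWeight g f₂ s)
    hp hpq hP₁ hP₂ hP hQ₁ hQ₂ hQ

/- By the inclusions between modulation spaces the exponents may be changed to extremal ones, for
which the conditions on their sums are equalities and the inner exponent is the smallest one. -/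
theorem exists_modNorm_crossWigner_le {g₁ g₂ : 𝓢(E, ℂ)} (hg₁ : g₁ ≠ 0) (hg₂ : g₂ ≠ 0)
    (Φ : 𝓢(WithLp 2 (E × E), ℂ)) (s : ℝ) {p₁ q₁ p₂ q₂ p q : ℝ≥0∞} (hp₁ : 1 ≤ p₁) (hq₁ : 1 ≤ q₁)
    (hp₂ : 1 ≤ p₂) (hq₂ : 1 ≤ q₂) (hp : 1 ≤ p) (hq : 1 ≤ q)
    (hp₁q : p₁ ≤ q) (hq₁q : q₁ ≤ q) (hp₂q : p₂ ≤ q) (hq₂q : q₂ ≤ q)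
    (hsum_p : p⁻¹ + q⁻¹ ≤ p₁⁻¹ + p₂⁻¹) (hsum_q : p⁻¹ + q⁻¹ ≤ q₁⁻¹ + q₂⁻¹) :
    ∃ C : ℝ≥0, ∀ f₁ f₂ : 𝓢'(E, ℂ), modNorm Φ p q (freqWeight s) (crossWigner f₁ f₂) ≤
      C * modNorm g₁ p₁ q₁ (phaseWeight |s|) f₁ * modNorm g₂ p₂ q₂ (phaseWeight s) f₂ := by
  obtain ⟨P₁, P₂, hp₁P, hp₂P, hP₁, hP₂, hP⟩ := exists_exponents (min_le_right p q) hp₁q hp₂q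
    (min_inv_add_inv_le hp₁q hp₂q hsum_p)
  obtain ⟨Q₁, Q₂, hq₁Q, hq₂Q, hQ₁, hQ₂, hQ⟩ := exists_exponents (min_le_right p q) hq₁q hq₂q
    (min_inv_add_inv_le hq₁q hq₂q hsum_q)
  have one_le_min : 1 ≤ min p q := le_min hp hq
  obtain ⟨C₀, hC₀⟩ := exists_modNorm_le (wignerSchwartz_ne_zero hg₁) Φ (isModerate_freqWeight s)
    one_le_min hq (min_le_left p q) le_rfl
  obtain ⟨C₁, hC₁⟩ := exists_modNorm_le hg₁ g₁ (isModerate_phaseWeight |s|) hp₁ hq₁ hp₁P hq₁Q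
  obtain ⟨C₂, hC₂⟩ := exists_modNorm_le hg₂ g₁ (isModerate_phaseWeight s) hp₂ hq₂ hp₂P hq₂Q
  refine ⟨C₀ * (2 ^ (|s| / 2) : ℝ).toNNReal * C₁ * C₂, fun f₁ f₂ => ?_⟩
  calc modNorm Φ p q (freqWeight s) (crossWigner f₁ f₂)
      ≤ C₀ * modNorm (wignerSchwartz g₁) (min p q) q (freqWeight s) (crossWigner f₁ f₂) := hC₀ _
    _ ≤ C₀ * (ENNReal.ofReal (2 ^ (|s| / 2)) * (modNorm g₁ P₁ Q₁ (phaseWeight |s|) f₁ *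
          modNorm g₁ P₂ Q₂ (phaseWeight s) f₂)) := by
        gcongr
        exact modNorm_wignerSchwartz_crossWigner_le g₁ s (one_pos.trans_le one_le_min).ne'
          (min_le_right p q) hP₁ hP₂ hP hQ₁ hQ₂ hQ f₁ f₂
    _ ≤ C₀ * (ENNReal.ofReal (2 ^ (|s| / 2)) * ((C₁ * modNorm g₁ p₁ q₁ (phaseWeight |s|) f₁) *
          (C₂ * modNorm g₂ p₂ q₂ (phaseWeight s) f₂))) := by
        gcongr
        exacts [hC₁ f₁, hC₂ f₂]
    _ = _ := by
        rw [ENNReal.ofReal]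
        push_cast
        ring

end Sufficiency

/-! ### Gaussians -/

section GaussianSchwartz

variable {E : Type*} [NormedAddCommGroup E]

theorem exists_norm_iteratedFDeriv_exp_comp_le [NormedSpace ℝ E] {u : E → ℝ}
    (hu : u.HasTemperateGrowth) (n : ℕ) :
    ∃ (l : ℕ) (C : ℝ), 0 ≤ C ∧ ∀ x,
      ‖iteratedFDeriv ℝ n (Real.exp ∘ u) x‖ ≤ C * (1 + ‖x‖) ^ l * Real.exp (u x) := by
  obtain ⟨l, C, hC, hl⟩ := hu.norm_iteratedFDeriv_le_uniform n
  refine ⟨l * n, n.factorial * (1 + C) ^ n, by positivity, fun x => ?_⟩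
  have one_le : 1 ≤ (1 + C) * (1 + ‖x‖) ^ l :=
    one_le_mul_of_one_le_of_one_le (by linarith)
      (one_le_pow₀ (le_add_of_nonneg_right (norm_nonneg x)))
  have exp_bound (i : ℕ) (_ : i ≤ n) : ‖iteratedFDeriv ℝ i Real.exp (u x)‖ ≤ Real.exp (u x) := by
    rw [norm_iteratedFDeriv_eq_norm_iteratedDeriv, iteratedDeriv_eq_iterate, Real.iter_deriv_exp,
      Real.norm_eq_abs, Real.abs_exp]
  have u_bound (i : ℕ) (hi : 1 ≤ i) (hin : i ≤ n) :
      ‖iteratedFDeriv ℝ i u x‖ ≤ ((1 + C) * (1 + ‖x‖) ^ l) ^ i :=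
    calc ‖iteratedFDeriv ℝ i u x‖ ≤ C * (1 + ‖x‖) ^ l := hl i hin x
      _ ≤ (1 + C) * (1 + ‖x‖) ^ l := by gcongr; linarith
      _ ≤ ((1 + C) * (1 + ‖x‖) ^ l) ^ i := le_self_pow₀ one_le (by omega)
  refine (norm_iteratedFDeriv_comp_le (N := n) Real.contDiff_exp (hu.1.of_le (mod_cast le_top))
    le_rfl x exp_bound u_bound).trans_eq ?_
  rw [mul_pow, ← pow_mul]
  ring

theorem exists_pow_mul_exp_neg_le {a : ℝ} (ha : 0 < a) (k : ℕ) :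
    ∃ C : ℝ, ∀ r : ℝ, (1 + r) ^ k * Real.exp (-(a * r ^ 2)) ≤ C := by
  refine ⟨2 ^ k * (k.factorial / a ^ k * Real.exp a), fun r => ?_⟩
  have pow_le : (1 + r) ^ k ≤ 2 ^ k * (1 + r ^ 2) ^ k := by
    rw [← mul_pow]
    refine (le_abs_self _).trans ?_
    rw [abs_pow]
    gcongr
    exact abs_le.2 ⟨by nlinarith [sq_nonneg (r + 1)], by nlinarith [sq_nonneg (r - 1)]⟩
  have pow_le_exp : (1 + r ^ 2) ^ k ≤ k.factorial / a ^ k * Real.exp (a * (1 + r ^ 2)) := by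
    have h := Real.pow_div_factorial_le_exp (x := a * (1 + r ^ 2)) (by positivity) k
    rw [mul_pow, div_le_iff₀ (by positivity)] at h
    rw [div_mul_eq_mul_div, le_div_iff₀ (by positivity)]
    linarith
  calc (1 + r) ^ k * Real.exp (-(a * r ^ 2))
      ≤ 2 ^ k * (k.factorial / a ^ k * Real.exp (a * (1 + r ^ 2))) * Real.exp (-(a * r ^ 2)) := by
        gcongr
        exact pow_le.trans (by gcongr)
    _ = 2 ^ k * (k.factorial / a ^ k * Real.exp a) := by
        rw [mul_assoc, mul_assoc, ← Real.exp_add]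
        ring_nf

variable [InnerProductSpace ℝ E]

/-- The Gaussian `t ↦ exp (-a |t|²)` as a real Schwartz function. -/
noncomputable def realGaussian {a : ℝ} (ha : 0 < a) : 𝓢(E, ℝ) where
  toFun := Real.exp ∘ fun t => -(a * ‖t‖ ^ 2)
  smooth' := Real.contDiff_exp.comp (contDiff_const.mul (contDiff_norm_sq ℝ)).neg
  decay' k n := by
    have growth : (fun t : E => -(a * ‖t‖ ^ 2)).HasTemperateGrowth :=
      ((Function.HasTemperateGrowth.const a).mul (Function.hasTemperateGrowth_norm_sq E)).neg
    obtain ⟨l, C, hC, deriv_le⟩ := exists_norm_iteratedFDeriv_exp_comp_le growth n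
    obtain ⟨C', exp_le⟩ := exists_pow_mul_exp_neg_le ha (k + l)
    refine ⟨C * C', fun x => ?_⟩
    calc ‖x‖ ^ k * ‖iteratedFDeriv ℝ n (Real.exp ∘ fun t => -(a * ‖t‖ ^ 2)) x‖
        ≤ (1 + ‖x‖) ^ k * (C * (1 + ‖x‖) ^ l * Real.exp (-(a * ‖x‖ ^ 2))) := by
          gcongr
          · linarith
          · exact deriv_le x
      _ = C * ((1 + ‖x‖) ^ (k + l) * Real.exp (-(a * ‖x‖ ^ 2))) := by ring
      _ ≤ C * C' := by gcongr; exact exp_le _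

/-- The Gaussian `t ↦ exp (-π a |t|²)` as a complex Schwartz function. -/
noncomputable def gaussian {a : ℝ} (ha : 0 < a) : 𝓢(E, ℂ) :=
  postcompCLM (𝕜 := ℝ) Complex.ofRealCLM (realGaussian (mul_pos Real.pi_pos ha))

theorem gaussian_apply {a : ℝ} (ha : 0 < a) (t : E) :
    gaussian ha t = ((Real.exp (-(Real.pi * a * ‖t‖ ^ 2)) : ℝ) : ℂ) := rfl

theorem gaussian_ne_zero {a : ℝ} (ha : 0 < a) : (gaussian ha : 𝓢(E, ℂ)) ≠ 0 := fun h => by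
  simpa [gaussian_apply] using DFunLike.congr_fun h 0

end GaussianSchwartz

section GaussianExponent

variable {E : Type*} [NormedAddCommGroup E] [InnerProductSpace ℝ E]

variable (E) in
/-- The exponent `σ` for which `‖exp (-π a |·|²)‖_{L^p(E)}` is proportional to `a ^ (-σ)`. -/
noncomputable def gaussianExponent (p : ℝ≥0∞) : ℝ :=
  Module.finrank ℝ E / 2 * p⁻¹.toReal

theorem gaussianExponent_nonneg (p : ℝ≥0∞) : 0 ≤ gaussianExponent E p := by
  unfold gaussianExponent
  positivity

variable [FiniteDimensional ℝ E] [Nontrivial E]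

theorem le_of_gaussianExponent_le {p r : ℝ≥0∞} (hp : p ≠ 0) (hr : r ≠ 0)
    (h : gaussianExponent E p ≤ gaussianExponent E r) : r ≤ p := by
  have dim_pos : (0 : ℝ) < Module.finrank ℝ E / 2 := by
    have := Module.finrank_pos (R := ℝ) (M := E)
    positivity
  rwa [gaussianExponent, gaussianExponent, mul_le_mul_iff_right₀ dim_pos,
    ENNReal.toReal_le_toReal (ENNReal.inv_ne_top.2 hp) (ENNReal.inv_ne_top.2 hr),
    ENNReal.inv_le_inv] at h

theorem inv_add_inv_le_of_gaussianExponent_add_le {p q r s : ℝ≥0∞} (hp : p ≠ 0)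
    (hq : q ≠ 0) (hr : r ≠ 0) (hs : s ≠ 0)
    (h : gaussianExponent E p + gaussianExponent E q ≤
      gaussianExponent E r + gaussianExponent E s) : p⁻¹ + q⁻¹ ≤ r⁻¹ + s⁻¹ := by
  have dim_pos : (0 : ℝ) < Module.finrank ℝ E / 2 := by
    have := Module.finrank_pos (R := ℝ) (M := E)
    positivity
  have hp' := ENNReal.inv_ne_top.2 hp
  have hq' := ENNReal.inv_ne_top.2 hq
  have hr' := ENNReal.inv_ne_top.2 hr
  have hs' := ENNReal.inv_ne_top.2 hs
  simp only [gaussianExponent] at h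
  rwa [← mul_add, ← mul_add, mul_le_mul_iff_right₀ dim_pos, ← ENNReal.toReal_add hp' hq',
    ← ENNReal.toReal_add hr' hs', ENNReal.toReal_le_toReal (ENNReal.add_ne_top.2 ⟨hp', hq'⟩)
      (ENNReal.add_ne_top.2 ⟨hr', hs'⟩)] at h

end GaussianExponent

section ExtendedGaussian

variable {E : Type*} [NormedAddCommGroup E]

/-- The Gaussian `t ↦ exp (-π a |t|²)` with values in `[0, ∞]`, as it occurs in norms of
short-time Fourier transforms. -/
noncomputable def egaussian (a : ℝ) (t : E) : ℝ≥0∞ :=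
  ENNReal.ofReal (Real.exp (-(Real.pi * a * ‖t‖ ^ 2)))

theorem continuous_egaussian (a : ℝ) : Continuous (egaussian a : E → ℝ≥0∞) :=
  ENNReal.continuous_ofReal.comp (by fun_prop)

theorem egaussian_ne_zero (a : ℝ) (t : E) : egaussian a t ≠ 0 := by
  simp [egaussian, Real.exp_pos]

theorem egaussian_ne_top (a : ℝ) (t : E) : egaussian a t ≠ ∞ := ENNReal.ofReal_ne_top

variable [InnerProductSpace ℝ E]

theorem enorm_gaussian {a : ℝ} (ha : 0 < a) (t : E) : ‖gaussian ha t‖ₑ = egaussian a t := by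
  rw [gaussian_apply, ← ofReal_norm, Complex.norm_real, Real.norm_eq_abs, Real.abs_exp, egaussian]

theorem egaussian_sub_mul_egaussian_add {α β : ℝ} (hα : 0 < α) (hβ : 0 < β) (x y : E) :
    egaussian α (x - (1 / 2 : ℝ) • y) * egaussian β (x + (1 / 2 : ℝ) • y) =
      egaussian (α + β) (x + ((β - α) / (2 * (α + β))) • y) *
        egaussian (α * β / (α + β)) y := by
  have hs : α + β ≠ 0 := by positivity
  simp only [egaussian]
  rw [← ENNReal.ofReal_mul (Real.exp_nonneg _), ← ENNReal.ofReal_mul (Real.exp_nonneg _),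
    ← Real.exp_add, ← Real.exp_add]
  congr 2
  simp only [norm_add_sq_real, norm_sub_sq_real, norm_smul, real_inner_smul_right, mul_pow,
    Real.norm_eq_abs, sq_abs]
  field_simp
  ring

variable [FiniteDimensional ℝ E] [MeasurableSpace E] [BorelSpace E]

theorem eLpNorm_egaussian_ne_top {a : ℝ} (ha : 0 < a) (p : ℝ≥0∞) :
    eLpNorm (egaussian a : E → ℝ≥0∞) p volume ≠ ∞ := by
  rw [← funext (enorm_gaussian ha), eLpNorm_enorm]
  exact ((gaussian ha : 𝓢(E, ℂ)).eLpNorm_lt_top p volume).ne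

theorem eLpNorm_egaussian_ne_zero (a : ℝ) {p : ℝ≥0∞} (hp : p ≠ 0) :
    eLpNorm (egaussian a : E → ℝ≥0∞) p volume ≠ 0 := fun h => by
  rw [eLpNorm_eq_zero_iff (continuous_egaussian a).measurable.aestronglyMeasurable hp] at h
  obtain ⟨t, ht⟩ := h.exists
  exact egaussian_ne_zero a t ht

theorem eLpNorm_egaussian {a : ℝ} (ha : 0 < a) (p : ℝ≥0∞) :
    eLpNorm (egaussian a : E → ℝ≥0∞) p volume =
      ENNReal.ofReal (a ^ (-gaussianExponent E p)) *
        eLpNorm (egaussian 1 : E → ℝ≥0∞) p volume := by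
  have hs : √a ≠ 0 := (Real.sqrt_pos.2 ha).ne'
  have dilation : (egaussian a : E → ℝ≥0∞) = egaussian 1 ∘ (√a • ·) := by
    funext t
    simp only [egaussian, Function.comp_apply, norm_smul, mul_pow, Real.norm_eq_abs, sq_abs,
      Real.sq_sqrt ha.le, mul_one, mul_assoc]
  have jacobian_ne_zero : ENNReal.ofReal |(√a ^ Module.finrank ℝ E)⁻¹| ≠ 0 := by
    rw [Ne, ENNReal.ofReal_eq_zero, not_le]
    positivity
  rw [dilation, ← eLpNorm_map_measure (continuous_egaussian 1).measurable.aestronglyMeasurable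
      (by fun_prop), Measure.map_addHaar_smul volume hs,
    eLpNorm_smul_measure_of_ne_zero jacobian_ne_zero, smul_eq_mul,
    ENNReal.ofReal_rpow_of_pos (by positivity)]
  congr 2
  rw [abs_of_pos (by positivity), Real.sqrt_eq_rpow, ← Real.rpow_natCast, ← Real.rpow_mul ha.le,
    ← Real.rpow_neg ha.le, ← Real.rpow_mul ha.le, gaussianExponent]
  congr 1
  rw [one_div p]
  ring

variable (E) in
theorem exists_eLpNorm_egaussian_eq {p : ℝ≥0∞} (hp : p ≠ 0) :
    ∃ k : ℝ, 0 < k ∧ ∀ a : ℝ, 0 < a → eLpNorm (egaussian a : E → ℝ≥0∞) p volume =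
      ENNReal.ofReal (k * a ^ (-gaussianExponent E p)) := by
  refine ⟨(eLpNorm (egaussian 1 : E → ℝ≥0∞) p volume).toReal,
    ENNReal.toReal_pos (eLpNorm_egaussian_ne_zero 1 hp) (eLpNorm_egaussian_ne_top one_pos p),
    fun a ha => ?_⟩
  rw [eLpNorm_egaussian ha, ENNReal.ofReal_mul ENNReal.toReal_nonneg,
    ENNReal.ofReal_toReal (eLpNorm_egaussian_ne_top one_pos p), mul_comm]

end ExtendedGaussian

section GaussianSTFT

variable {E : Type*} [NormedAddCommGroup E] [InnerProductSpace ℝ E]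

theorem norm_sq_add_mul_norm_sq_eq {α γ : ℝ} (hγ : γ ≠ 0) (h : α + γ = 1) (t x : E) :
    ‖t + γ • x - x‖ ^ 2 + α / γ * ‖t + γ • x‖ ^ 2 = ‖t‖ ^ 2 / γ + α * ‖x‖ ^ 2 := by
  obtain rfl : α = 1 - γ := by linarith
  have shift_eq : t + γ • x - x = t - (1 - γ) • x := by module
  simp only [shift_eq, norm_add_sq_real, norm_sub_sq_real, norm_smul, real_inner_smul_right,
    mul_pow, Real.norm_eq_abs, sq_abs]
  field_simp
  ring

theorem conjShift_gaussian_mul_gaussian {α γ : ℝ} (hα : 0 < α) (hγ : 0 < γ) (h : α + γ = 1)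
    (x ξ t : E) :
    conjShift (gaussian one_pos) x ξ (t + γ • x) * gaussian (div_pos hα hγ) (t + γ • x) =
      (gaussian hα x * character ξ (γ • x)) *
        (gaussian (inv_pos.2 hγ) t * character ξ t) := by
  have product : Real.exp (-(Real.pi * 1 * ‖t + γ • x - x‖ ^ 2)) *
      Real.exp (-(Real.pi * (α / γ) * ‖t + γ • x‖ ^ 2)) =
      Real.exp (-(Real.pi * α * ‖x‖ ^ 2)) * Real.exp (-(Real.pi * γ⁻¹ * ‖t‖ ^ 2)) := by
    rw [← Real.exp_add, ← Real.exp_add]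
    congr 1
    linear_combination (-Real.pi) * norm_sq_add_mul_norm_sq_eq hγ.ne' h t x
  have product_cast := congrArg Complex.ofReal product
  rw [Complex.ofReal_mul, Complex.ofReal_mul] at product_cast
  simp only [conjShift_apply, character_add_right, gaussian_apply, Complex.conj_ofReal]
  linear_combination (character ξ t * character ξ (γ • x)) * product_cast

variable [FiniteDimensional ℝ E] [MeasurableSpace E] [BorelSpace E]

theorem integral_gaussian_mul_character {γ : ℝ} (hγ : 0 < γ) (ξ : E) :
    ∫ t, gaussian (inv_pos.2 hγ) t * character ξ t =
      (γ : ℂ) ^ (Module.finrank ℝ E / 2 : ℂ) * gaussian hγ ξ := by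
  have hγ' : (γ : ℂ) ≠ 0 := mod_cast hγ.ne'
  have hπ : (Real.pi : ℂ) ≠ 0 := mod_cast Real.pi_ne_zero
  have hb : 0 < ((Real.pi * γ⁻¹ : ℝ) : ℂ).re := by
    rw [Complex.ofReal_re]
    positivity
  have integrand (t : E) : gaussian (inv_pos.2 hγ) t * character ξ t =
      Complex.exp (-((Real.pi * γ⁻¹ : ℝ) : ℂ) * ‖t‖ ^ 2 +
        -(2 * Real.pi * Complex.I) * (inner ℝ ξ t : ℝ)) := by
    rw [gaussian_apply, character, Complex.exp_add]
    push_cast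
    ring_nf
  simp only [integrand]
  rw [GaussianFourier.integral_cexp_neg_mul_sq_norm_add hb, gaussian_apply]
  congr 1
  · congr 1
    push_cast
    field_simp
  · push_cast
    congr 1
    rw [neg_sq, mul_pow, Complex.I_sq]
    field_simp
    ring

theorem enorm_stft_gaussian {α γ : ℝ} (hα : 0 < α) (hγ : 0 < γ) (h : α + γ = 1) (x ξ : E) :
    ‖stft (gaussian one_pos)
        (toTemperedDistributionCLM E ℂ volume (gaussian (div_pos hα hγ))) x ξ‖ₑ =
      ENNReal.ofReal (γ ^ (Module.finrank ℝ E / 2 : ℝ)) * (egaussian α x * egaussian γ ξ) := by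
  have stft_eq : stft (gaussian one_pos)
      (toTemperedDistributionCLM E ℂ volume (gaussian (div_pos hα hγ))) x ξ =
      (gaussian hα x * character ξ (γ • x)) *
        ((γ ^ (Module.finrank ℝ E / 2 : ℝ) : ℝ) * gaussian hγ ξ) := by
    rw [stft, toTemperedDistributionCLM_apply_apply volume (gaussian (div_pos hα hγ)),
      ← integral_add_right_eq_self _ (γ • x)]
    simp only [smul_eq_mul, conjShift_gaussian_mul_gaussian hα hγ h]
    rw [integral_const_mul, integral_gaussian_mul_character hγ, Complex.ofReal_cpow hγ.le]
    push_cast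
    rfl
  have enorm_character : ‖character ξ (γ • x)‖ₑ = 1 := by
    rw [← ofReal_norm, norm_character, ENNReal.ofReal_one]
  have enorm_power : ‖((γ ^ (Module.finrank ℝ E / 2 : ℝ) : ℝ) : ℂ)‖ₑ =
      ENNReal.ofReal (γ ^ (Module.finrank ℝ E / 2 : ℝ)) := by
    rw [← ofReal_norm, Complex.norm_real, Real.norm_of_nonneg (by positivity)]
  rw [stft_eq, enorm_mul, enorm_mul, enorm_mul, enorm_character, enorm_power, enorm_gaussian,
    enorm_gaussian]
  ring

end GaussianSTFT

/-! ### Necessity -/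

section GaussianModulationNorm

variable {E : Type*} [NormedAddCommGroup E] [InnerProductSpace ℝ E]
  [FiniteDimensional ℝ E] [MeasurableSpace E] [BorelSpace E]

theorem modNorm_one (g : 𝓢(E, ℂ)) (p q : ℝ≥0∞) (f : 𝓢'(E, ℂ)) :
    modNorm g p q (fun _ _ => 1) f =
      mixedELpNorm (fun w => ‖stft g f w.1 w.2‖ₑ) p q volume volume := by
  simp only [modNorm, mixedNorm_eq_mixedELpNorm (fun _ _ => zero_le_one), ENNReal.ofReal_one,
    mul_one]

theorem eLpNorm_egaussian_mul {a b : ℝ} (ha : 0 < a) {p : ℝ≥0∞} (hp : p ≠ 0) (v w : E) :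
    eLpNorm (fun z : WithLp 2 (E × E) => egaussian a (z.fst + v) * egaussian b (z.snd + w))
      p volume = eLpNorm (egaussian a : E → ℝ≥0∞) p volume *
        eLpNorm (egaussian b : E → ℝ≥0∞) p volume := by
  have translation (a : ℝ) (v : E) : eLpNorm (fun x => egaussian a (x + v)) p volume =
      eLpNorm (egaussian a : E → ℝ≥0∞) p volume :=
    eLpNorm_comp_measurePreserving (continuous_egaussian a).measurable.aestronglyMeasurable
      (measurePreserving_add_right volume v)
  have measurable_product : Measurable fun z : E × E =>
      egaussian a (z.1 + v) * egaussian b (z.2 + w) :=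
    ((continuous_egaussian a).measurable.comp (measurable_fst.add_const v)).mul
      ((continuous_egaussian b).measurable.comp (measurable_snd.add_const w))
  have norm_ne_top : eLpNorm (fun x : E => egaussian a (x + v)) p volume ≠ ∞ := by
    rw [translation]
    exact eLpNorm_egaussian_ne_top ha p
  calc eLpNorm (fun z : WithLp 2 (E × E) => egaussian a (z.fst + v) * egaussian b (z.snd + w)) p
        volume
      = eLpNorm (fun z : E × E => egaussian a (z.1 + v) * egaussian b (z.2 + w)) p
          (volume.prod volume) := eLpNorm_toLp _ p
    _ = eLpNorm (fun x => egaussian a (x + v)) p volume *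
          eLpNorm (fun x => egaussian b (x + w)) p volume := by
        rw [← mixedELpNorm_self measurable_product hp]
        exact mixedELpNorm_mul (h := fun x => egaussian b (x + w)) norm_ne_top
          (fun _ => egaussian_ne_top _ _) p
    _ = _ := by rw [translation, translation]

theorem modNorm_of_enorm_stft_eq {g : 𝓢(E, ℂ)} {f : 𝓢'(E, ℂ)} {c : ℝ≥0∞} {α γ : ℝ} (hc : c ≠ ∞)
    (hα : 0 < α) (p q : ℝ≥0∞)
    (hf : ∀ x ξ : E, ‖stft g f x ξ‖ₑ = c * (egaussian α x * egaussian γ ξ)) :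
    modNorm g p q (fun _ _ => 1) f = c *
      (eLpNorm (egaussian α : E → ℝ≥0∞) p volume * eLpNorm (egaussian γ : E → ℝ≥0∞) q volume) := by
  have norm_ne_top : eLpNorm (fun x : E => c * egaussian α x) p volume ≠ ∞ := by
    rw [eLpNorm_const_mul hc]
    exact ENNReal.mul_ne_top hc (eLpNorm_egaussian_ne_top hα p)
  simp only [modNorm_one, hf, ← mul_assoc]
  rw [mixedELpNorm_mul norm_ne_top (egaussian_ne_top γ), eLpNorm_const_mul hc]

section CrossWigner

variable {g : 𝓢(E, ℂ)} {f₁ f₂ : 𝓢'(E, ℂ)} {c₁ c₂ : ℝ≥0∞} {α β γ δ : ℝ}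

theorem enorm_stft_crossWigner_of_enorm_stft_eq
    (hα : 0 < α) (hβ : 0 < β) (hγ : 0 < γ) (hδ : 0 < δ)
    (hf₁ : ∀ x ξ : E, ‖stft g f₁ x ξ‖ₑ = c₁ * (egaussian α x * egaussian γ ξ))
    (hf₂ : ∀ x ξ : E, ‖stft g f₂ x ξ‖ₑ = c₂ * (egaussian β x * egaussian δ ξ))
    (z ζ : WithLp 2 (E × E)) :
    ‖stft (wignerSchwartz g) (crossWigner f₁ f₂) z ζ‖ₑ =
      c₁ * c₂ * (egaussian (γ * δ / (γ + δ)) ζ.fst * egaussian (α * β / (α + β)) ζ.snd) *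
        (egaussian (α + β) (z.fst + ((β - α) / (2 * (α + β))) • ζ.snd) *
          egaussian (γ + δ) (z.snd + ((γ - δ) / (2 * (γ + δ))) • ζ.fst)) := by
  have time := egaussian_sub_mul_egaussian_add hα hβ z.fst ζ.snd
  have frequency := egaussian_sub_mul_egaussian_add hδ hγ z.snd ζ.fst
  rw [mul_comm δ γ, add_comm δ γ] at frequency
  rw [enorm_stft_crossWigner g f₁ f₂ rfl rfl, hf₁, hf₂]
  simp only [WithLp.sub_fst, WithLp.sub_snd, WithLp.add_fst, WithLp.add_snd, WithLp.smul_fst,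
    WithLp.smul_snd, symplecticRotation_fst, symplecticRotation_snd, smul_neg, sub_neg_eq_add,
    ← sub_eq_add_neg]
  rw [mul_mul_mul_comm c₁, mul_mul_mul_comm (egaussian α _), time, mul_comm (egaussian γ _),
    frequency]
  ring

theorem modNorm_crossWigner_of_enorm_stft_eq (hc₁ : c₁ ≠ ∞) (hc₂ : c₂ ≠ ∞)
    (hα : 0 < α) (hβ : 0 < β) (hγ : 0 < γ) (hδ : 0 < δ) {p q : ℝ≥0∞} (hp : p ≠ 0) (hq : q ≠ 0)
    (hf₁ : ∀ x ξ : E, ‖stft g f₁ x ξ‖ₑ = c₁ * (egaussian α x * egaussian γ ξ))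
    (hf₂ : ∀ x ξ : E, ‖stft g f₂ x ξ‖ₑ = c₂ * (egaussian β x * egaussian δ ξ)) :
    modNorm (wignerSchwartz g) p q (fun _ _ => 1) (crossWigner f₁ f₂) =
      c₁ * c₂ * ((eLpNorm (egaussian (α + β) : E → ℝ≥0∞) p volume *
          eLpNorm (egaussian (γ + δ) : E → ℝ≥0∞) p volume) *
        (eLpNorm (egaussian (α * β / (α + β)) : E → ℝ≥0∞) q volume *
          eLpNorm (egaussian (γ * δ / (γ + δ)) : E → ℝ≥0∞) q volume)) := by
  have hc : c₁ * c₂ ≠ ∞ := ENNReal.mul_ne_top hc₁ hc₂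
  have outer_ne_top (a b : ℝ) (x y : E) : c₁ * c₂ * (egaussian a x * egaussian b y) ≠ ∞ :=
    ENNReal.mul_ne_top hc (ENNReal.mul_ne_top (egaussian_ne_top _ _) (egaussian_ne_top _ _))
  set N := eLpNorm (egaussian (α + β) : E → ℝ≥0∞) p volume *
    eLpNorm (egaussian (γ + δ) : E → ℝ≥0∞) p volume with hN
  have hN_ne_top : N ≠ ∞ := ENNReal.mul_ne_top (eLpNorm_egaussian_ne_top (by positivity) p)
    (eLpNorm_egaussian_ne_top (by positivity) p)
  have outer : eLpNorm (fun ζ : WithLp 2 (E × E) =>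
      egaussian (γ * δ / (γ + δ)) ζ.fst * egaussian (α * β / (α + β)) ζ.snd) q volume =
      eLpNorm (egaussian (γ * δ / (γ + δ)) : E → ℝ≥0∞) q volume *
        eLpNorm (egaussian (α * β / (α + β)) : E → ℝ≥0∞) q volume := by
    simpa only [add_zero] using eLpNorm_egaussian_mul (E := E) (a := γ * δ / (γ + δ))
      (b := α * β / (α + β)) (by positivity) hq 0 0
  simp only [modNorm_one, mixedELpNorm,
    enorm_stft_crossWigner_of_enorm_stft_eq hα hβ hγ hδ hf₁ hf₂,
    eLpNorm_const_mul (outer_ne_top _ _ _ _), eLpNorm_egaussian_mul (add_pos hα hβ) hp, ← hN,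
    mul_comm _ N, eLpNorm_const_mul hN_ne_top, eLpNorm_const_mul hc, outer]
  ring

end CrossWigner

end GaussianModulationNorm

section Exponents

theorem le_of_rpow_neg_le {u v C : ℝ}
    (h : ∀ x : ℝ, 0 < x → x ≤ 1 / 2 → x ^ (-u) ≤ C * x ^ (-v)) : u ≤ v := by
  by_contra! hvu
  have unbounded := (tendsto_rpow_atTop (sub_pos.2 hvu)).eventually_gt_atTop C
  obtain ⟨y, hC, hy⟩ := (unbounded.and (Filter.eventually_ge_atTop 2)).exists
  have hy0 : 0 < y := by linarith
  have bound := h y⁻¹ (inv_pos.2 hy0) (by rw [one_div]; exact inv_anti₀ two_pos hy)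
  simp only [Real.inv_rpow hy0.le, ← Real.rpow_neg hy0.le, neg_neg] at bound
  rw [Real.rpow_sub hy0, lt_div_iff₀ (Real.rpow_pos_of_pos hy0 v)] at hC
  exact hC.not_ge bound

/-- The inequality between powers obtained by testing the boundedness of the cross-Wigner
distribution on Gaussians whose short-time Fourier transforms decay with rates `α`, `γ` and `β`,
`δ` in time and frequency. The parameters stand for multiples of the reciprocals of the Lebesgue
exponents. -/
def GaussianBound (u v a₁ b₁ a₂ b₂ : ℝ) : Prop :=
  ∃ C : ℝ, 0 ≤ C ∧ ∀ α β γ δ : ℝ, 0 < α → 0 < β → 0 < γ → 0 < δ → α + γ = 1 → β + δ = 1 →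
    (α + β) ^ (-u) * (γ + δ) ^ (-u) * ((α * β / (α + β)) ^ (-v) * (γ * δ / (γ + δ)) ^ (-v)) ≤
      C * (α ^ (-a₁) * γ ^ (-b₁)) * (β ^ (-a₂) * δ ^ (-b₂))

namespace GaussianBound

variable {u v a₁ b₁ a₂ b₂ : ℝ}

theorem swap_time_frequency (h : GaussianBound u v a₁ b₁ a₂ b₂) :
    GaussianBound u v b₁ a₁ b₂ a₂ := by
  obtain ⟨C, hC, bound⟩ := h
  refine ⟨C, hC, fun α β γ δ hα hβ hγ hδ hαγ hβδ => ?_⟩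
  have swapped := bound γ δ α β hγ hδ hα hβ (by linarith) (by linarith)
  linarith

theorem swap_functions (h : GaussianBound u v a₁ b₁ a₂ b₂) : GaussianBound u v a₂ b₂ a₁ b₁ := by
  obtain ⟨C, hC, bound⟩ := h
  refine ⟨C, hC, fun α β γ δ hα hβ hγ hδ hαγ hβδ => ?_⟩
  have swapped := bound β α δ γ hβ hα hδ hγ hβδ hαγ
  rw [add_comm β, add_comm δ, mul_comm β, mul_comm δ] at swapped
  linarith

theorem exists_le (h : GaussianBound u v a₁ b₁ a₂ b₂) (hu : 0 ≤ u) (hv : 0 ≤ v) (hb₁ : 0 ≤ b₁)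
    (hb₂ : 0 ≤ b₂) :
    ∃ C : ℝ, 0 ≤ C ∧ ∀ α β : ℝ, 0 < α → 0 < β → α ≤ 1 / 2 → β ≤ 1 / 2 →
      (α + β) ^ (-u) * (α * β / (α + β)) ^ (-v) ≤ C * (α ^ (-a₁) * β ^ (-a₂)) := by
  obtain ⟨C, hC, bound⟩ := h
  refine ⟨C * (1 / 2) ^ (-b₁) * (1 / 2) ^ (-b₂) / 2 ^ (-u), by positivity,
    fun α β hα hβ hα' hβ' => ?_⟩
  have hγ : 0 < 1 - α := by linarith
  have hδ : 0 < 1 - β := by linarith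
  have sum_le : (2 : ℝ) ^ (-u) ≤ (1 - α + (1 - β)) ^ (-u) :=
    Real.rpow_le_rpow_of_nonpos (by positivity) (by linarith) (neg_nonpos.2 hu)
  have harmonic_le : 1 ≤ ((1 - α) * (1 - β) / (1 - α + (1 - β))) ^ (-v) :=
    Real.one_le_rpow_of_pos_of_le_one_of_nonpos (by positivity)
      ((div_le_one (by positivity)).2 (by nlinarith)) (neg_nonpos.2 hv)
  have power_le {x w : ℝ} (hx : 1 / 2 ≤ x) (hw : 0 ≤ w) : x ^ (-w) ≤ (1 / 2 : ℝ) ^ (-w) :=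
    Real.rpow_le_rpow_of_nonpos (by norm_num) hx (neg_nonpos.2 hw)
  rw [div_mul_eq_mul_div, le_div_iff₀ (by positivity)]
  calc (α + β) ^ (-u) * (α * β / (α + β)) ^ (-v) * 2 ^ (-u)
      = (α + β) ^ (-u) * 2 ^ (-u) * ((α * β / (α + β)) ^ (-v) * 1) := by ring
    _ ≤ (α + β) ^ (-u) * (1 - α + (1 - β)) ^ (-u) * ((α * β / (α + β)) ^ (-v) *
          ((1 - α) * (1 - β) / (1 - α + (1 - β))) ^ (-v)) := by gcongr
    _ ≤ C * (α ^ (-a₁) * (1 - α) ^ (-b₁)) * (β ^ (-a₂) * (1 - β) ^ (-b₂)) :=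
        bound α β (1 - α) (1 - β) hα hβ hγ hδ (by ring) (by ring)
    _ ≤ C * (α ^ (-a₁) * (1 / 2) ^ (-b₁)) * (β ^ (-a₂) * (1 / 2) ^ (-b₂)) := by
        gcongr C * (_ * ?_) * (_ * ?_)
        · exact power_le (by linarith) hb₁
        · exact power_le (by linarith) hb₂
    _ = C * (1 / 2) ^ (-b₁) * (1 / 2) ^ (-b₂) * (α ^ (-a₁) * β ^ (-a₂)) := by ring

theorem le (h : GaussianBound u v a₁ b₁ a₂ b₂) (hu : 0 ≤ u) (hv : 0 ≤ v) (hb₁ : 0 ≤ b₁)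
    (hb₂ : 0 ≤ b₂) : v ≤ a₁ := by
  obtain ⟨C, -, bound⟩ := h.exists_le hu hv hb₁ hb₂
  refine le_of_rpow_neg_le (C := C * (1 / 2) ^ (-a₂)) fun x hx hx' => ?_
  have one_le_sum : 1 ≤ (x + 1 / 2) ^ (-u) :=
    Real.one_le_rpow_of_pos_of_le_one_of_nonpos (by positivity) (by linarith) (neg_nonpos.2 hu)
  have harmonic_le : x * (1 / 2) / (x + 1 / 2) ≤ x := by
    rw [div_le_iff₀ (by positivity)]
    nlinarith
  calc x ^ (-v) ≤ (x * (1 / 2) / (x + 1 / 2)) ^ (-v) :=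
        Real.rpow_le_rpow_of_nonpos (by positivity) harmonic_le (neg_nonpos.2 hv)
    _ ≤ (x + 1 / 2) ^ (-u) * (x * (1 / 2) / (x + 1 / 2)) ^ (-v) :=
        le_mul_of_one_le_left (by positivity) one_le_sum
    _ ≤ C * (x ^ (-a₁) * (1 / 2) ^ (-a₂)) := bound x (1 / 2) hx (by norm_num) hx' le_rfl
    _ = C * (1 / 2) ^ (-a₂) * x ^ (-a₁) := by ring

theorem add_le (h : GaussianBound u v a₁ b₁ a₂ b₂) (hu : 0 ≤ u) (hv : 0 ≤ v) (hb₁ : 0 ≤ b₁)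
    (hb₂ : 0 ≤ b₂) : u + v ≤ a₁ + a₂ := by
  obtain ⟨C, -, bound⟩ := h.exists_le hu hv hb₁ hb₂
  refine le_of_rpow_neg_le (C := C / (2 ^ (-u) * 2⁻¹ ^ (-v))) fun x hx hx' => ?_
  have harmonic_eq : x * x / (x + x) = 2⁻¹ * x := by field_simp; ring
  rw [div_mul_eq_mul_div, le_div_iff₀ (by positivity)]
  calc x ^ (-(u + v)) * (2 ^ (-u) * 2⁻¹ ^ (-v))
      = (x + x) ^ (-u) * (x * x / (x + x)) ^ (-v) := by
        rw [harmonic_eq, ← two_mul, Real.mul_rpow two_pos.le hx.le,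
          Real.mul_rpow (by norm_num) hx.le, neg_add, Real.rpow_add hx]
        ring
    _ ≤ C * (x ^ (-a₁) * x ^ (-a₂)) := bound x x hx hx hx' hx'
    _ = C * x ^ (-(a₁ + a₂)) := by rw [neg_add, Real.rpow_add hx]

end GaussianBound

end Exponents

section Testing

variable {E : Type*} [NormedAddCommGroup E] [InnerProductSpace ℝ E]
  [FiniteDimensional ℝ E] [MeasurableSpace E] [BorelSpace E]

/-- Boundedness of the cross-Wigner distribution `M^{p₁,q₁} × M^{p₂,q₂} → M^{p,q}` on Schwartz
functions, the norms being defined by the windows `g₁`, `g₂` and `Φ`. -/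
def CrossWignerBounded (g₁ g₂ : 𝓢(E, ℂ)) (Φ : 𝓢(WithLp 2 (E × E), ℂ))
    (p₁ q₁ p₂ q₂ p q : ℝ≥0∞) : Prop :=
  ∃ C : ℝ≥0, ∀ f₁ f₂ : 𝓢(E, ℂ), modNorm Φ p q (fun _ _ => 1)
    (crossWigner (toTemperedDistributionCLM E ℂ volume f₁)
      (toTemperedDistributionCLM E ℂ volume f₂)) ≤
    C * modNorm g₁ p₁ q₁ (fun _ _ => 1) (toTemperedDistributionCLM E ℂ volume f₁) *
      modNorm g₂ p₂ q₂ (fun _ _ => 1) (toTemperedDistributionCLM E ℂ volume f₂)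

variable {g₁ g₂ : 𝓢(E, ℂ)} {Φ : 𝓢(WithLp 2 (E × E), ℂ)} {p₁ q₁ p₂ q₂ p q : ℝ≥0∞}

namespace CrossWignerBounded

theorem change_windows (h : CrossWignerBounded g₁ g₂ Φ p₁ q₁ p₂ q₂ p q) (hΦ : Φ ≠ 0)
    {k : 𝓢(E, ℂ)} (hk : k ≠ 0) (Ψ : 𝓢(WithLp 2 (E × E), ℂ)) (hp₁ : 1 ≤ p₁) (hq₁ : 1 ≤ q₁)
    (hp₂ : 1 ≤ p₂) (hq₂ : 1 ≤ q₂) (hp : 1 ≤ p) (hq : 1 ≤ q) :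
    CrossWignerBounded k k Ψ p₁ q₁ p₂ q₂ p q := by
  obtain ⟨C, hC⟩ := h
  obtain ⟨C₀, hC₀⟩ := exists_modNorm_le hΦ Ψ isModerate_one hp hq le_rfl le_rfl
  obtain ⟨C₁, hC₁⟩ := exists_modNorm_le hk g₁ isModerate_one hp₁ hq₁ le_rfl le_rfl
  obtain ⟨C₂, hC₂⟩ := exists_modNorm_le hk g₂ isModerate_one hp₂ hq₂ le_rfl le_rfl
  refine ⟨C₀ * C * C₁ * C₂, fun f₁ f₂ => ?_⟩
  set F₁ := toTemperedDistributionCLM E ℂ volume f₁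
  set F₂ := toTemperedDistributionCLM E ℂ volume f₂
  calc modNorm Ψ p q (fun _ _ => 1) (crossWigner F₁ F₂)
      ≤ C₀ * (C * modNorm g₁ p₁ q₁ (fun _ _ => 1) F₁ * modNorm g₂ p₂ q₂ (fun _ _ => 1) F₂) :=
        (hC₀ _).trans (by gcongr; exact hC f₁ f₂)
    _ ≤ C₀ * (C * (C₁ * modNorm k p₁ q₁ (fun _ _ => 1) F₁) *
          (C₂ * modNorm k p₂ q₂ (fun _ _ => 1) F₂)) := by
        gcongr
        · exact hC₁ F₁
        · exact hC₂ F₂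
    _ = _ := by
        push_cast
        ring

theorem gaussianBound
    (h : CrossWignerBounded (gaussian one_pos : 𝓢(E, ℂ)) (gaussian one_pos)
      (wignerSchwartz (gaussian one_pos)) p₁ q₁ p₂ q₂ p q)
    (hp₁ : p₁ ≠ 0) (hq₁ : q₁ ≠ 0) (hp₂ : p₂ ≠ 0) (hq₂ : q₂ ≠ 0) (hp : p ≠ 0) (hq : q ≠ 0) :
    GaussianBound (gaussianExponent E p) (gaussianExponent E q) (gaussianExponent E p₁)
      (gaussianExponent E q₁) (gaussianExponent E p₂) (gaussianExponent E q₂) := by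
  obtain ⟨C, hC⟩ := h
  obtain ⟨k, hk, norm_p⟩ := exists_eLpNorm_egaussian_eq E hp
  obtain ⟨l, hl, norm_q⟩ := exists_eLpNorm_egaussian_eq E hq
  obtain ⟨k₁, hk₁, norm_p₁⟩ := exists_eLpNorm_egaussian_eq E hp₁
  obtain ⟨l₁, hl₁, norm_q₁⟩ := exists_eLpNorm_egaussian_eq E hq₁
  obtain ⟨k₂, hk₂, norm_p₂⟩ := exists_eLpNorm_egaussian_eq E hp₂
  obtain ⟨l₂, hl₂, norm_q₂⟩ := exists_eLpNorm_egaussian_eq E hq₂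
  refine ⟨C * (k₁ * l₁ * (k₂ * l₂)) / (k * k * (l * l)), by positivity,
    fun α β γ δ hα hβ hγ hδ hαγ hβδ => ?_⟩
  have stft₁ := enorm_stft_gaussian (E := E) hα hγ hαγ
  have stft₂ := enorm_stft_gaussian (E := E) hβ hδ hβδ
  set c₁ : ℝ := γ ^ (Module.finrank ℝ E / 2 : ℝ)
  set c₂ : ℝ := δ ^ (Module.finrank ℝ E / 2 : ℝ)
  have hc₁ : 0 < c₁ := Real.rpow_pos_of_pos hγ _
  have hc₂ : 0 < c₂ := Real.rpow_pos_of_pos hδ _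
  have bound := hC (gaussian (div_pos hα hγ)) (gaussian (div_pos hβ hδ))
  rw [modNorm_crossWigner_of_enorm_stft_eq ENNReal.ofReal_ne_top ENNReal.ofReal_ne_top hα hβ hγ hδ
      hp hq stft₁ stft₂, modNorm_of_enorm_stft_eq ENNReal.ofReal_ne_top hα p₁ q₁ stft₁,
    modNorm_of_enorm_stft_eq ENNReal.ofReal_ne_top hβ p₂ q₂ stft₂,
    norm_p _ (by positivity), norm_p _ (by positivity), norm_q _ (by positivity),
    norm_q _ (by positivity), norm_p₁ α hα, norm_q₁ γ hγ, norm_p₂ β hβ, norm_q₂ δ hδ,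
    ← ENNReal.ofReal_coe_nnreal] at bound
  simp (discharger := positivity) only [← ENNReal.ofReal_mul] at bound
  rw [ENNReal.ofReal_le_ofReal_iff (by positivity)] at bound
  rw [div_mul_eq_mul_div, div_mul_eq_mul_div, le_div_iff₀ (by positivity)]
  refine le_of_mul_le_mul_left ?_ (mul_pos hc₁ hc₂)
  linarith

variable [Nontrivial E]

theorem exponents_le (h : CrossWignerBounded g₁ g₂ Φ p₁ q₁ p₂ q₂ p q) (hΦ : Φ ≠ 0)
    (hp₁ : 1 ≤ p₁) (hq₁ : 1 ≤ q₁) (hp₂ : 1 ≤ p₂) (hq₂ : 1 ≤ q₂) (hp : 1 ≤ p) (hq : 1 ≤ q) :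
    (p₁ ≤ q ∧ q₁ ≤ q ∧ p₂ ≤ q ∧ q₂ ≤ q) ∧
      (p⁻¹ + q⁻¹ ≤ p₁⁻¹ + p₂⁻¹ ∧ p⁻¹ + q⁻¹ ≤ q₁⁻¹ + q₂⁻¹) := by
  have ne_zero {r : ℝ≥0∞} (hr : 1 ≤ r) : r ≠ 0 := (zero_lt_one.trans_le hr).ne'
  have bound := (h.change_windows hΦ (gaussian_ne_zero one_pos) (wignerSchwartz (gaussian one_pos))
    hp₁ hq₁ hp₂ hq₂ hp hq).gaussianBound (ne_zero hp₁) (ne_zero hq₁) (ne_zero hp₂) (ne_zero hq₂)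
    (ne_zero hp) (ne_zero hq)
  have nonneg := gaussianExponent_nonneg (E := E)
  refine ⟨⟨?_, ?_, ?_, ?_⟩, ?_, ?_⟩
  · exact le_of_gaussianExponent_le (ne_zero hq) (ne_zero hp₁)
      (bound.le (nonneg p) (nonneg q) (nonneg q₁) (nonneg q₂))
  · exact le_of_gaussianExponent_le (ne_zero hq) (ne_zero hq₁)
      (bound.swap_time_frequency.le (nonneg p) (nonneg q) (nonneg p₁) (nonneg p₂))
  · exact le_of_gaussianExponent_le (ne_zero hq) (ne_zero hp₂)
      (bound.swap_functions.le (nonneg p) (nonneg q) (nonneg q₂) (nonneg q₁))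
  · exact le_of_gaussianExponent_le (ne_zero hq) (ne_zero hq₂)
      (bound.swap_functions.swap_time_frequency.le (nonneg p) (nonneg q) (nonneg p₂) (nonneg p₁))
  · exact inv_add_inv_le_of_gaussianExponent_add_le (ne_zero hp) (ne_zero hq) (ne_zero hp₁)
      (ne_zero hp₂) (bound.add_le (nonneg p) (nonneg q) (nonneg q₁) (nonneg q₂))
  · exact inv_add_inv_le_of_gaussianExponent_add_le (ne_zero hp) (ne_zero hq) (ne_zero hq₁)
      (ne_zero hq₂) (bound.swap_time_frequency.add_le (nonneg p) (nonneg q) (nonneg p₁) (nonneg p₂))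

end CrossWignerBounded

end Testing

end TFA

theorem theorem1p1_general {E : Type*} [NormedAddCommGroup E] [InnerProductSpace ℝ E]
    [FiniteDimensional ℝ E] [Nontrivial E] [MeasurableSpace E] [BorelSpace E]
    {g₁ g₂ : 𝓢(E, ℂ)} (hg₁ : g₁ ≠ 0) (hg₂ : g₂ ≠ 0)
    {Φ : 𝓢(WithLp 2 (E × E), ℂ)} (hΦ : Φ ≠ 0) {p₁ q₁ p₂ q₂ p q : ℝ≥0∞}
    (hp₁ : 1 ≤ p₁) (hq₁ : 1 ≤ q₁) (hp₂ : 1 ≤ p₂) (hq₂ : 1 ≤ q₂) (hp : 1 ≤ p) (hq : 1 ≤ q) :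
    (∀ s : ℝ, (p₁ ≤ q ∧ q₁ ≤ q ∧ p₂ ≤ q ∧ q₂ ≤ q) →
      (p⁻¹ + q⁻¹ ≤ p₁⁻¹ + p₂⁻¹ ∧ p⁻¹ + q⁻¹ ≤ q₁⁻¹ + q₂⁻¹) →
      ∃ C : ℝ≥0, ∀ f₁ ∈ TFA.modulationSpace g₁ p₁ q₁ (TFA.phaseWeight |s|),
        ∀ f₂ ∈ TFA.modulationSpace g₂ p₂ q₂ (TFA.phaseWeight s),
          TFA.crossWigner f₁ f₂ ∈ TFA.modulationSpace Φ p q (TFA.freqWeight s) ∧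
          TFA.modNorm Φ p q (TFA.freqWeight s) (TFA.crossWigner f₁ f₂) ≤
            C * TFA.modNorm g₁ p₁ q₁ (TFA.phaseWeight |s|) f₁ *
              TFA.modNorm g₂ p₂ q₂ (TFA.phaseWeight s) f₂) ∧
    (TFA.CrossWignerBounded g₁ g₂ Φ p₁ q₁ p₂ q₂ p q →
      (p₁ ≤ q ∧ q₁ ≤ q ∧ p₂ ≤ q ∧ q₂ ≤ q) ∧
      (p⁻¹ + q⁻¹ ≤ p₁⁻¹ + p₂⁻¹ ∧ p⁻¹ + q⁻¹ ≤ q₁⁻¹ + q₂⁻¹)) := by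
  refine ⟨fun s ⟨hp₁q, hq₁q, hp₂q, hq₂q⟩ ⟨hsum_p, hsum_q⟩ => ?_,
    fun h => h.exponents_le hΦ hp₁ hq₁ hp₂ hq₂ hp hq⟩
  obtain ⟨C, hC⟩ := TFA.exists_modNorm_crossWigner_le hg₁ hg₂ Φ s hp₁ hq₁ hp₂ hq₂ hp hq
    hp₁q hq₁q hp₂q hq₂q hsum_p hsum_q
  refine ⟨C, fun f₁ hf₁ f₂ hf₂ => ⟨(hC f₁ f₂).trans_lt ?_, hC f₁ f₂⟩⟩
  exact ENNReal.mul_lt_top (ENNReal.mul_lt_top ENNReal.coe_lt_top hf₁) hf₂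

theorem theorem1p1 (d : ℕ) (hd : 0 < d)
    (g : 𝓢(EuclideanSpace ℝ (Fin d), ℂ)) (hg : g ≠ 0)
    (Φ : 𝓢(WithLp 2 (EuclideanSpace ℝ (Fin d) × EuclideanSpace ℝ (Fin d)), ℂ)) (hΦ : Φ ≠ 0)
    (p₁ q₁ p₂ q₂ p q : ℝ≥0∞) (hp₁ : 1 ≤ p₁) (hq₁ : 1 ≤ q₁) (hp₂ : 1 ≤ p₂) (hq₂ : 1 ≤ q₂)
    (hp : 1 ≤ p) (hq : 1 ≤ q) :
    (∀ s : ℝ, (p₁ ≤ q ∧ q₁ ≤ q ∧ p₂ ≤ q ∧ q₂ ≤ q) →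
      (p⁻¹ + q⁻¹ ≤ p₁⁻¹ + p₂⁻¹ ∧ p⁻¹ + q⁻¹ ≤ q₁⁻¹ + q₂⁻¹) →
      ∃ C : ℝ≥0, ∀ f₁ ∈ TFA.modulationSpace g p₁ q₁ (TFA.phaseWeight |s|),
        ∀ f₂ ∈ TFA.modulationSpace g p₂ q₂ (TFA.phaseWeight s),
          TFA.crossWigner f₁ f₂ ∈ TFA.modulationSpace Φ p q (TFA.freqWeight s) ∧
          TFA.modNorm Φ p q (TFA.freqWeight s) (TFA.crossWigner f₁ f₂) ≤
            C * TFA.modNorm g p₁ q₁ (TFA.phaseWeight |s|) f₁ *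
              TFA.modNorm g p₂ q₂ (TFA.phaseWeight s) f₂) ∧
    ((∃ C : ℝ≥0, ∀ f₁ f₂ : 𝓢(EuclideanSpace ℝ (Fin d), ℂ),
        TFA.modNorm Φ p q (fun _ _ => 1)
            (TFA.crossWigner (toTemperedDistributionCLM _ ℂ volume f₁)
              (toTemperedDistributionCLM _ ℂ volume f₂)) ≤
          C * TFA.modNorm g p₁ q₁ (fun _ _ => 1) (toTemperedDistributionCLM _ ℂ volume f₁) *
            TFA.modNorm g p₂ q₂ (fun _ _ => 1) (toTemperedDistributionCLM _ ℂ volume f₂)) →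
      (p₁ ≤ q ∧ q₁ ≤ q ∧ p₂ ≤ q ∧ q₂ ≤ q) ∧
      (p⁻¹ + q⁻¹ ≤ p₁⁻¹ + p₂⁻¹ ∧ p⁻¹ + q⁻¹ ≤ q₁⁻¹ + q₂⁻¹)) := by
  have : Nonempty (Fin d) := Fin.pos_iff_nonempty.1 hd
  exact theorem1p1_general hg hg hΦ hp₁ hq₁ hp₂ hq₂ hp hq
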